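/- **Setting.** Consider the screened Poisson equation $-\Delta u+\omega^2u=f$ on a rectangle $[a,b]\times[c,d]$ with zero Dirichlet conditions, or with zero Neumann conditions and $\omega\ne0$. Take partitions of $[a,b]$ and $[c,d]$ into $m\ge1$ and $n\ge1$ elements and a polynomial degree $p\ge1$. In each direction use the basis consisting of the piecewise linear hat functions (without the two boundary hats in the Dirichlet case), followed, for $k=0,\dots,p-2$, by the functions that equal the affinely mapped integrated Legendre polynomial $W_k(x)=(1-x^2)C_k^{(3/2)}(x)/((k+1)(k+2))$ on one element and vanish on the others. Let $M_x,M_y$ be the mass matrices and $A_x,A_y$ the matrices $-\Delta+\tfrac{\omega^2}{2}M$. Let $N\ge 1$ be the larger of the numbers of degrees of freedom in the two directions (both assumed positive), and $\nu=\max(m,n)$. The discrete problem is the generalised Sylvester equation $AUC-DUB=F$ with $A=A_x$, $B=-A_y$, $C=M_y$, $D=M_x$. Write $\sigma(X,Y)=\{\lambda: X-\lambda Y\text{ is singular}\}$. **Algorithm (generalised ADI), tolerance $0<\epsilon<1$.** *Precomputation.* From the entries of $A,B,C,D$ and from $\epsilon$: find intervals $[\alpha_1,\alpha_2]\supseteq\sigma(A,D)$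 and $[\beta_1,\beta_2]\supseteq\sigma(B,C)$ with $\alpha_1<\alpha_2$ and $\beta_1<\beta_2$, each of whose endpoints agrees with a generalised eigenvalue up to a fixed relative accuracy $\delta\in(0,1)$; set $$\gamma=\frac{|\beta_1-\alpha_1||\beta_2-\alpha_2|}{|\beta_1-\alpha_2||\beta_2-\alpha_1|},\qquad J=\Big\lceil \frac{\log(16\gamma)\log(4/\epsilon)}{\pi^2}\Big\rceil ;$$ compute the shifts $p_j=T(-\alpha\,\mathrm{dn}(\tfrac{2j-1}{2J}K(k),k))$ and $q_j=T(\alpha\,\mathrm{dn}(\tfrac{2j-1}{2J}K(k),k))$, $1\le j\le J$, where $\alpha=-1+2\gamma+2\sqrt{\gamma^2-\gamma}$, $k=\sqrt{1-\alpha^{-2}}$, $K$ is the complete elliptic integral of the first kind, $\mathrm{dn}$ the Jacobi elliptic function, and $T$ the Möbius map taking $-\alpha,-1,1,\alpha$ to $\alpha_1,\alpha_2,\beta_1,\beta_2$; and compute the reverse Cholesky factorisations $L_j^\top L_j=A-q_jD$ and $R_j^\top R_j=p_jC-B$ ($L_j,R_j$ lower triangular with positive diagonal). *Solve.* Given $F$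 and the precomputed data, set $W_0=0$ and for $j=1,\dots,J$ $$W_{j-1/2}=(F-(A-p_jD)W_{j-1})(B-p_jC)^{-1},\qquad W_j=(A-q_jD)^{-1}(F-W_{j-1/2}(B-q_jC));$$ return $W_JC^{-1}$. **Cost model.** An operation is a real $+,-,\times,\div$, a square root, a comparison, writing a rational constant, or an evaluation of $\sinh,\cosh,\tanh,\log,K,\mathrm{dn}$; rounding a real $x$ up to a natural number costs $\lceil x\rceil+1$ operations. Programs are algebraic computation trees, one for each boundary condition and $(m,n,p)$ (and $J$, for the solve), which take the real data above as input. **Theorem.** For every $\delta\in(0,1)$ there are such programs for the precomputation and for the solve with the following properties. 1. The precomputation uses $O(\nu N^2+JN)$ operations, with a constant that depends only on $\delta$. 2. Each solve uses $O(JN^2)$ operations, with a constant that depends only on $\delta$. 3. For a fixed rectangle, boundary condition and $\omega$, and for partitions in which the ratio of any two element lengths is at least a fixed $\rho>0$, uniformly for $N\ge2$ and $0<\epsilon\le\tfrac12$: $J=O(\log N\log\epsilon^{-1})$, the precomputation uses $O(\nu N^2+N\log N\log\epsilon^{-1})$ operations, and each solve uses $O(N^2\log N\log\epsilon^{-1})$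 operations, with constants that depend only on $\delta,\rho,\omega$, the rectangle and the boundary condition. 4. If moreover the number of elements is bounded, $\nu\le n_0$ (so that $N\to\infty$ means $p\to\infty$), the precomputation uses $O(N^2+N\log N\log\epsilon^{-1})$ operations and precomputation and solve together use $O(N^2\log N\log\epsilon^{-1})$ operations, that is, quasi-optimal complexity; here the constants may also depend on $n_0$. -/

import Mathlib

open Polynomial

noncomputable section

namespace GenADI

/-! ### Operation counts: real computation trees

A program works on a growing list of real registers, which initially holds the input. It is an
algebraic computation tree: which registers are used may depend on the control flow, but never on
the value of a register other than through `branch` and `ceil`; the only literal constants are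
rational. -/

/-- The incomplete elliptic integral of the first kind `F(φ, k)`, with modulus `k`. -/
def ellF (φ k : ℝ) : ℝ := ∫ θ in (0 : ℝ)..φ, 1 / Real.sqrt (1 - k ^ 2 * Real.sin θ ^ 2)

/-- The complete elliptic integral of the first kind `K(k)`, with modulus `k`. -/
def ellK (k : ℝ) : ℝ := ellF (Real.pi / 2) k

/-- The Jacobi amplitude `am(u, k)`: the inverse of `φ ↦ F(φ, k)` (a bijection for `0 ≤ k < 1`). -/
def jacobiAm (u k : ℝ) : ℝ := Function.invFun (fun φ => ellF φ k) u

/-- The Jacobi elliptic function `dn(u, k)`, with modulus `k`. -/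
def jacobiDn (u k : ℝ) : ℝ := Real.sqrt (1 - k ^ 2 * Real.sin (jacobiAm u k) ^ 2)

/-- Unary unit-cost operations: square root and special functions of one variable. -/
inductive UnOp
  | sqrt
  | sinh
  | cosh
  | tanh
  | log
  | ellK

/-- Binary unit-cost operations: field operations and the elliptic function `dn(u, k)`. -/
inductive BinOp
  | add
  | sub
  | mul
  | div
  | dn

def UnOp.eval : UnOp → ℝ → ℝ
  | .sqrt, x => Real.sqrt x
  | .sinh, x => Real.sinh x
  | .cosh, x => Real.cosh x
  | .tanh, x => Real.tanh x
  | .log, x => Real.log x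
  | .ellK, x => GenADI.ellK x

def BinOp.eval : BinOp → ℝ → ℝ → ℝ
  | .add, x, y => x + y
  | .sub, x, y => x - y
  | .mul, x, y => x * y
  | .div, x, y => x / y
  | .dn, x, y => jacobiDn x y

/-- Programs. Register addresses are natural numbers; the instructions `const`, `un`, `bin` append
one new register, `branch i j s t` continues with `s` if register `i` is smaller than register `j`
and with `t` otherwise, `ceil i t` continues with `t r`, where `r` is register `i` rounded up to a
natural number, and `ret l` stops and returns the registers listed in `l`. -/
inductive Prog
  | ret (l : List ℕ)
  | const (q : ℚ) (t : Prog)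
  | un (f : UnOp) (i : ℕ) (t : Prog)
  | bin (f : BinOp) (i j : ℕ) (t : Prog)
  | branch (i j : ℕ) (s t : Prog)
  | ceil (i : ℕ) (t : ℕ → Prog)

/-- The content of register `i`. -/
def reg (mem : List ℝ) (i : ℕ) : ℝ := mem.getD i 0

/-- The list of values that a program returns. -/
def Prog.output : Prog → List ℝ → List ℝ
  | .ret l, mem => l.map (reg mem)
  | .const q t, mem => t.output (mem ++ [(q : ℝ)])
  | .un f i t, mem => t.output (mem ++ [f.eval (reg mem i)])
  | .bin f i j t, mem => t.output (mem ++ [f.eval (reg mem i) (reg mem j)])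
  | .branch i j s t, mem =>
      open Classical in if reg mem i < reg mem j then s.output mem else t.output mem
  | .ceil i t, mem => (t ⌈reg mem i⌉₊).output mem

/-- The number of operations that a program executes. Every instruction costs one operation, except
that rounding `x` up costs `⌈x⌉ + 1` (comparing `x` with `0, 1, 2, …` in turn). -/
def Prog.cost : Prog → List ℝ → ℕ
  | .ret _, _ => 0
  | .const q t, mem => t.cost (mem ++ [(q : ℝ)]) + 1
  | .un f i t, mem => t.cost (mem ++ [f.eval (reg mem i)]) + 1
  | .bin f i j t, mem => t.cost (mem ++ [f.eval (reg mem i) (reg mem j)]) + 1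
  | .branch i j s t, mem =>
      (open Classical in if reg mem i < reg mem j then s.cost mem else t.cost mem) + 1
  | .ceil i t, mem => (t ⌈reg mem i⌉₊).cost mem + (⌈reg mem i⌉₊ + 1)

/-- The entries of a matrix, row by row. -/
def matList {M N : ℕ} (X : Matrix (Fin M) (Fin N) ℝ) : List ℝ :=
  (List.ofFn fun i => List.ofFn (X i)).flatten

/-! ### The generalised ADI algorithm for `A U C - D U B = F` -/

/-- The generalised spectrum `σ(A, B)`. -/
def genSpectrum {N : ℕ} (A B : Matrix (Fin N) (Fin N) ℝ) : Set ℝ :=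
  {lam | ¬ IsUnit (A - lam • B)}

/-- `L` is the reverse Cholesky factor of `A`: `A = Lᵀ L`, `L` lower triangular with positive
diagonal. -/
def IsRevCholesky {N : ℕ} (A L : Matrix (Fin N) (Fin N) ℝ) : Prop :=
  (∀ i j, i < j → L i j = 0) ∧ (∀ i, 0 < L i i) ∧ A = L.transpose * L

/-- `a` and `b` are the extreme points of the set `S` up to the relative error `δ`, rounded
outwards. -/
def IsEnclosure (δ : ℝ) (S : Set ℝ) (a b : ℝ) : Prop :=
  a < b ∧ S ⊆ Set.Icc a b ∧ (∃ s ∈ S, |a - s| ≤ δ * |s|) ∧ (∃ s ∈ S, |b - s| ≤ δ * |s|)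

/-- The cross-ratio `γ`. -/
def adiGamma (a b c d : ℝ) : ℝ := |c - a| * |d - b| / (|c - b| * |d - a|)

/-- The number of iterations `J`. -/
def adiCount (a b c d ε : ℝ) : ℕ :=
  ⌈Real.log (16 * adiGamma a b c d) * Real.log (4 / ε) / Real.pi ^ 2⌉₊

/-- The parameter `α > 1` for which `(-α, -1, 1, α)` and `(a, b, c, d)` have the same
cross-ratio. -/
def adiAlpha (a b c d : ℝ) : ℝ :=
  -1 + 2 * adiGamma a b c d + 2 * Real.sqrt (adiGamma a b c d ^ 2 - adiGamma a b c d)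

/-- The Möbius transformation that maps `-α, -1, 1` to `a, b, c` (and hence `α` to `d`). -/
def adiMobius (a b c d z : ℝ) : ℝ :=
  (a * ((z - 1) * (adiAlpha a b c d - 1) * (b - c)) + c * (2 * (z + adiAlpha a b c d) * (b - a))) /
    ((z - 1) * (adiAlpha a b c d - 1) * (b - c) + 2 * (z + adiAlpha a b c d) * (b - a))

/-- The modulus `√(1 - 1/α²)`. -/
def adiModulus (a b c d : ℝ) : ℝ := Real.sqrt (1 - 1 / adiAlpha a b c d ^ 2)

/-- `dn((2j-1)/(2J) K(k), k)` for `k = √(1 - 1/α²)`; the index is `i = j - 1`. -/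
def adiDn (a b c d : ℝ) (J i : ℕ) : ℝ :=
  jacobiDn ((2 * (i : ℝ) + 1) / (2 * (J : ℝ)) * ellK (adiModulus a b c d)) (adiModulus a b c d)

/-- The shift `p_j`, `j = i + 1`. -/
def adiShiftP (a b c d : ℝ) (J i : ℕ) : ℝ :=
  adiMobius a b c d (-(adiAlpha a b c d * adiDn a b c d J i))

/-- The shift `q_j`, `j = i + 1`. -/
def adiShiftQ (a b c d : ℝ) (J i : ℕ) : ℝ :=
  adiMobius a b c d (adiAlpha a b c d * adiDn a b c d J i)

/-- What the precomputation hands over to the solve. -/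
structure ADIData (M N : ℕ) where
  a : ℝ
  b : ℝ
  c : ℝ
  d : ℝ
  J : ℕ
  p : Fin J → ℝ
  q : Fin J → ℝ
  L : Fin J → Matrix (Fin M) (Fin M) ℝ
  R : Fin J → Matrix (Fin N) (Fin N) ℝ

/-- The data as a list of reals (`J` can be read off from its length). -/
def ADIData.toList {M N : ℕ} (S : ADIData M N) : List ℝ :=
  [S.a, S.b, S.c, S.d] ++ List.ofFn S.p ++ List.ofFn S.q ++
    (List.ofFn fun j => matList (S.L j)).flatten ++ (List.ofFn fun j => matList (S.R j)).flatten

/-- `S` is a result of the precomputation for `A, B, C, D` and tolerance `ε`, where the extreme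
generalised eigenvalues are computed to relative accuracy `δ`. As `B - p_j C` is negative definite
in the case at hand, the matrix that is factorised is `p_j C - B`. -/
structure ADIData.IsPrecomputation {M N : ℕ} (S : ADIData M N) (δ ε : ℝ)
    (A : Matrix (Fin M) (Fin M) ℝ) (B C : Matrix (Fin N) (Fin N) ℝ)
    (D : Matrix (Fin M) (Fin M) ℝ) : Prop where
  encl_left : IsEnclosure δ (genSpectrum A D) S.a S.b
  encl_right : IsEnclosure δ (genSpectrum B C) S.c S.d
  count : S.J = adiCount S.a S.b S.c S.d ε
  shift_p : ∀ j, S.p j = adiShiftP S.a S.b S.c S.d S.J j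
  shift_q : ∀ j, S.q j = adiShiftQ S.a S.b S.c S.d S.J j
  chol_left : ∀ j, IsRevCholesky (A - S.q j • D) (S.L j)
  chol_right : ∀ j, IsRevCholesky (S.p j • C - B) (S.R j)

/-- One ADI step `W_{j-1} ↦ W_j` with shifts `p_j = s` and `q_j = t`. -/
def adiStep {M N : ℕ} (A : Matrix (Fin M) (Fin M) ℝ) (B C : Matrix (Fin N) (Fin N) ℝ)
    (D : Matrix (Fin M) (Fin M) ℝ) (F : Matrix (Fin M) (Fin N) ℝ) (s t : ℝ)
    (W : Matrix (Fin M) (Fin N) ℝ) : Matrix (Fin M) (Fin N) ℝ :=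
  let W' : Matrix (Fin M) (Fin N) ℝ := (F - (A - s • D) * W) * (B - s • C)⁻¹
  (A - t • D)⁻¹ * (F - W' * (B - t • C))

/-- The matrix `W_J C⁻¹` returned by the solve. -/
def adiSolution {M N : ℕ} (A : Matrix (Fin M) (Fin M) ℝ) (B C : Matrix (Fin N) (Fin N) ℝ)
    (D : Matrix (Fin M) (Fin M) ℝ) (F : Matrix (Fin M) (Fin N) ℝ) (S : ADIData M N) :
    Matrix (Fin M) (Fin N) ℝ :=
  Fin.foldl S.J (fun W j => adiStep A B C D F (S.p j) (S.q j) W) 0 * C⁻¹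

/-! ### The `hp`-finite element discretisation -/

/-- The Legendre polynomial `P_k` (Rodrigues' formula). -/
def legendreP (k : ℕ) : ℝ[X] :=
  Polynomial.C (1 / (2 ^ k * (k.factorial : ℝ))) * derivative^[k] ((X ^ 2 - 1) ^ k)

/-- The integrated Legendre polynomial
`W_k = (1 - x²) C_k^{(3/2)} / ((k+1)(k+2))`, that is, the polynomial with `W_k' = -P_{k+1}` and
`W_k(±1) = 0`. -/
def bubbleW (k : ℕ) : ℝ[X] :=
  -(Polynomial.C (1 / (2 ^ (k + 1) * ((k + 1).factorial : ℝ))) *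
    derivative^[k] ((X ^ 2 - 1) ^ (k + 1)))

theorem derivative_bubbleW (k : ℕ) : derivative (bubbleW k) = -legendreP (k + 1) := by
  simp only [bubbleW, legendreP, derivative_neg, derivative_C_mul, Function.iterate_succ_apply']

theorem bubbleW_eval_of_sq_eq_one (k : ℕ) {t : ℝ} (ht : t ^ 2 = 1) : (bubbleW k).eval t = 0 := by
  have h := pow_sub_dvd_iterate_derivative_pow (X ^ 2 - 1 : ℝ[X]) (k + 1) k
  obtain ⟨r, hr⟩ := h
  rw [bubbleW, hr]
  simp [ht]

/-- A partition `a = x_0 < x_1 < ⋯ < x_n = b` (only `node 0, …, node n` matter). -/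
structure Mesh (a b : ℝ) (n : ℕ) where
  node : ℕ → ℝ
  node_zero : node 0 = a
  node_last : node n = b
  node_lt : ∀ j < n, node j < node (j + 1)

/-- The ratio of the lengths of any two elements is at least `ρ`. -/
def Mesh.QuasiUniform {a b : ℝ} {n : ℕ} (x : Mesh a b n) (ρ : ℝ) : Prop :=
  ∀ i < n, ∀ j < n, ρ * (x.node (j + 1) - x.node j) ≤ x.node (i + 1) - x.node i

/-- The hat function `h_j`, `0 ≤ j ≤ n`. -/
def Mesh.hat {a b : ℝ} {n : ℕ} (x : Mesh a b n) (j : ℕ) (t : ℝ) : ℝ :=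
  open Classical in
  if 1 ≤ j ∧ x.node (j - 1) ≤ t ∧ t ≤ x.node j then
    (t - x.node (j - 1)) / (x.node j - x.node (j - 1))
  else if j + 1 ≤ n ∧ x.node j ≤ t ∧ t ≤ x.node (j + 1) then
    (x.node (j + 1) - t) / (x.node (j + 1) - x.node j)
  else 0

/-- The bubble function of index `k` on the element `[x_e, x_{e+1}]`, `0 ≤ e < n`. -/
def Mesh.bubble {a b : ℝ} {n : ℕ} (x : Mesh a b n) (k e : ℕ) (t : ℝ) : ℝ :=
  open Classical in
  if x.node e ≤ t ∧ t ≤ x.node (e + 1) then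
    (bubbleW k).eval ((2 * t - x.node e - x.node (e + 1)) / (x.node (e + 1) - x.node e))
  else 0

/-- The boundary condition. -/
inductive BC
  | dirichlet
  | neumann

/-- The number of hat functions in the basis on `n` elements. -/
def BC.numHats : BC → ℕ → ℕ
  | .dirichlet, n => n - 1
  | .neumann, n => n + 1

/-- The index of the first hat function in the basis. -/
def BC.firstHat : BC → ℕ
  | .dirichlet => 1
  | .neumann => 0

/-- The number of degrees of freedom on `n ≥ 1` elements with degree `p ≥ 1`: `pn - 1` for
Dirichlet and `pn + 1` for Neumann conditions. -/
def BC.dof (bc : BC) (n p : ℕ) : ℕ := bc.numHats n + n * (p - 1)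

/-- The basis `[hats | W_{0,1}, …, W_{0,n} | W_{1,1}, …, W_{1,n} | ⋯]`. -/
def Mesh.basis {a b : ℝ} {n : ℕ} (x : Mesh a b n) (bc : BC) (i : ℕ) : ℝ → ℝ :=
  if i < bc.numHats n then x.hat (bc.firstHat + i)
  else x.bubble ((i - bc.numHats n) / n) ((i - bc.numHats n) % n)

/-- The mass matrix. -/
def Mesh.mass {a b : ℝ} {n : ℕ} (x : Mesh a b n) (bc : BC) (p : ℕ) :
    Matrix (Fin (bc.dof n p)) (Fin (bc.dof n p)) ℝ :=
  Matrix.of fun i j => ∫ t in a..b, x.basis bc i t * x.basis bc j t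

/-- The weak (negative) Laplacian. -/
def Mesh.stiffness {a b : ℝ} {n : ℕ} (x : Mesh a b n) (bc : BC) (p : ℕ) :
    Matrix (Fin (bc.dof n p)) (Fin (bc.dof n p)) ℝ :=
  Matrix.of fun i j => ∫ t in a..b, deriv (x.basis bc i) t * deriv (x.basis bc j) t

/-- The matrix `-Δ + (ω²/2) M`. -/
def Mesh.screened {a b : ℝ} {n : ℕ} (x : Mesh a b n) (bc : BC) (ω : ℝ) (p : ℕ) :
    Matrix (Fin (bc.dof n p)) (Fin (bc.dof n p)) ℝ :=
  x.stiffness bc p + (ω ^ 2 / 2) • x.mass bc p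

/-- A discretisation of the screened Poisson equation `-Δu + ω² u = f` on `[a, b] × [c, d]` by
tensor products of piecewise polynomials of degree `p` on `m × n` rectangular elements. -/
structure Discretisation (bc : BC) (a b c d ω : ℝ) (m n p : ℕ) where
  x : Mesh a b m
  y : Mesh c d n
  one_le_m : 1 ≤ m
  one_le_n : 1 ≤ n
  one_le_p : 1 ≤ p
  dof_x_pos : 0 < bc.dof m p
  dof_y_pos : 0 < bc.dof n p
  omega_ne_zero : bc = BC.neumann → ω ≠ 0

namespace Discretisation

variable {bc : BC} {a b c d ω : ℝ} {m n p : ℕ}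

/-- The matrices of the generalised Sylvester equation `A U C - D U B = F`, which is
`A_x U M_y + M_x U A_y = F` for the screened Poisson equation. -/
def matA (P : Discretisation bc a b c d ω m n p) :
    Matrix (Fin (bc.dof m p)) (Fin (bc.dof m p)) ℝ := P.x.screened bc ω p

def matB (P : Discretisation bc a b c d ω m n p) :
    Matrix (Fin (bc.dof n p)) (Fin (bc.dof n p)) ℝ := -P.y.screened bc ω p

def matC (P : Discretisation bc a b c d ω m n p) :
    Matrix (Fin (bc.dof n p)) (Fin (bc.dof n p)) ℝ := P.y.mass bc p

def matD (P : Discretisation bc a b c d ω m n p) :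
    Matrix (Fin (bc.dof m p)) (Fin (bc.dof m p)) ℝ := P.x.mass bc p

/-- The maximal number of elements in either coordinate direction. -/
def numElem (_P : Discretisation bc a b c d ω m n p) : ℕ := max m n

/-- The maximal number of degrees of freedom in either coordinate direction. -/
def maxDof (_P : Discretisation bc a b c d ω m n p) : ℕ := max (bc.dof m p) (bc.dof n p)

/-- The entries of `A, B, C, D`. -/
def matrices (P : Discretisation bc a b c d ω m n p) : List ℝ :=
  matList P.matA ++ matList P.matB ++ matList P.matC ++ matList P.matD

/-- The input of the precomputation. -/
def preInput (P : Discretisation bc a b c d ω m n p) (ε : ℝ) : List ℝ := P.matrices ++ [ε]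

/-- `S` is a result of the precomputation for this discretisation. -/
def IsPre (P : Discretisation bc a b c d ω m n p) (δ ε : ℝ)
    (S : ADIData (bc.dof m p) (bc.dof n p)) : Prop :=
  S.IsPrecomputation δ ε P.matA P.matB P.matC P.matD

/-- The input of the solve with right-hand side `F`. -/
def solveInput (P : Discretisation bc a b c d ω m n p)
    (S : ADIData (bc.dof m p) (bc.dof n p))
    (F : Matrix (Fin (bc.dof m p)) (Fin (bc.dof n p)) ℝ) : List ℝ :=
  P.matrices ++ S.toList ++ matList F

/-- The result of the solve with right-hand side `F`. -/
def solution (P : Discretisation bc a b c d ω m n p)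
    (S : ADIData (bc.dof m p) (bc.dof n p))
    (F : Matrix (Fin (bc.dof m p)) (Fin (bc.dof n p)) ℝ) :
    Matrix (Fin (bc.dof m p)) (Fin (bc.dof n p)) ℝ :=
  adiSolution P.matA P.matB P.matC P.matD F S

end Discretisation

end GenADI

end

/-!
The pencils of both directions couple each hat function only to its two neighbours and to the
lowest bubbles of the adjacent elements, and couple bubbles only to bubbles of degree differing
by two. With the hats first, a reverse Cholesky factorisation therefore creates no fill-in: the
factors keep at most four off-diagonal entries per row, and factorising or solving takes `O(N)`
operations. A linear solve with `N` right-hand sides then costs `O(N²)`, which gives `O(J N²)`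
for the `J` iterations.

Whether `λ D - A` is positive definite can be decided in `O(N)` operations by attempting the
factorisation. The trace of `D⁻¹ A` bounds the largest generalised eigenvalue up to a factor `N`,
so a geometric search downwards from it reaches relative accuracy `δ` after `O(N)` such tests;
exchanging `A` and `D` gives the smallest one. The shifts satisfy `q_j < 0 < p_j`, so every shifted
matrix is positive definite.

For the count `J`, Poincaré's inequality (or `ω ≠ 0` in the Neumann case) bounds the generalised
eigenvalues from below, and a Markov-type inequality on each element bounds them from above by a
power of `N`. Hence `γ` grows at most polynomially in `N` and `J = O(log N log ε⁻¹)`.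
-/

noncomputable section

namespace GenADI

/-! ### Program fragments and their cost -/

/-- Register `i` exists and holds the value `v`. -/
def Holds (mem : List ℝ) (i : ℕ) (v : ℝ) : Prop := mem[i]? = some v

theorem Holds.reg_eq {mem : List ℝ} {i : ℕ} {v : ℝ} (h : Holds mem i v) : reg mem i = v := by
  unfold Holds at h
  rw [reg, List.getD, h, Option.getD_some]

theorem Holds.mono {mem mem' : List ℝ} {i : ℕ} {v : ℝ} (h : Holds mem i v)
    (hm : mem <+: mem') : Holds mem' i v := by
  obtain ⟨t, rfl⟩ := hm
  unfold Holds at *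
  rw [List.getElem?_append_left (List.getElem?_eq_some_iff.1 h).1, h]

theorem holds_append_singleton (mem : List ℝ) (v : ℝ) : Holds (mem ++ [v]) mem.length v := by
  simp [Holds]

/-- A property of the memory that survives when further registers are appended. -/
def Persistent (P : List ℝ → Prop) : Prop := ∀ ⦃m m'⦄, m <+: m' → P m → P m'

/-- A program fragment with result in `α`, in continuation-passing style: it takes the number of
registers in use and a continuation, which receives the result and the new number of registers. -/
def Frag (α : Type) : Type := ℕ → (α → ℕ → Prog) → Prog

namespace Frag

variable {α β σ ι : Type}

instance : Monad Frag where
  pure a := fun s k => k a s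
  bind f g := fun s k => f s fun a s' => g a s' k

/-- Stores a rational constant and returns its address. -/
def const (q : ℚ) : Frag ℕ := fun s k => .const q (k s (s + 1))

/-- Applies `f` to register `i` and returns the address of the value. -/
def un (f : UnOp) (i : ℕ) : Frag ℕ := fun s k => .un f i (k s (s + 1))

/-- Applies `f` to registers `i` and `j` and returns the address of the value. -/
def bin (f : BinOp) (i j : ℕ) : Frag ℕ := fun s k => .bin f i j (k s (s + 1))

/-- Runs `f` if register `i` is smaller than register `j`, and `g` otherwise. -/
def ifLt (i j : ℕ) (f g : Frag α) : Frag α := fun s k => .branch i j (f s k) (g s k)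

/-- Returns register `i` rounded up to a natural number. -/
def ceil (i : ℕ) : Frag ℕ := fun s k => .ceil i fun r => k r s

/-- The program that runs the fragment on `s` input registers and outputs the registers listed in
its result. -/
def toProg (f : Frag (List ℕ)) (s : ℕ) : Prog := f s fun l _ => .ret l

/-- The Hoare triple of the program logic: started with memory `mem`, the fragment appends
registers, returns a result that satisfies `P`, and performs at most `c` operations. -/
def Computes (f : Frag α) (mem : List ℝ) (c : ℕ) (P : α → List ℝ → Prop) : Prop :=
  ∃ a mem', mem <+: mem' ∧ P a mem' ∧ ∀ k : α → ℕ → Prog,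
    (f mem.length k).output mem = (k a mem'.length).output mem' ∧
      (f mem.length k).cost mem ≤ (k a mem'.length).cost mem' + c

namespace Computes

variable {f : Frag α} {g : α → Frag β} {mem : List ℝ} {c c₁ c₂ : ℕ}
  {P : α → List ℝ → Prop} {Q : β → List ℝ → Prop}

theorem mono {P' : α → List ℝ → Prop} (h : f.Computes mem c₁ P') (hc : c₁ ≤ c)
    (hP : ∀ a mem', mem <+: mem' → P' a mem' → P a mem') : f.Computes mem c P := by
  obtain ⟨a, mem', hm, hQ, hk⟩ := h
  exact ⟨a, mem', hm, hP a mem' hm hQ, fun k => ⟨(hk k).1, (hk k).2.trans (by lia)⟩⟩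

theorem mono_cost (h : f.Computes mem c₁ P) (hc : c₁ ≤ c) : f.Computes mem c P :=
  h.mono hc fun _ _ _ h => h

theorem pure {a : α} (h : P a mem) : (Pure.pure a : Frag α).Computes mem 0 P :=
  ⟨a, mem, List.prefix_rfl, h, fun _ => ⟨rfl, le_rfl⟩⟩

theorem bind (hf : f.Computes mem c₁ P)
    (hg : ∀ a mem', mem <+: mem' → P a mem' → (g a).Computes mem' c₂ Q) :
    (f >>= g).Computes mem (c₁ + c₂) Q := by
  obtain ⟨a, mem', hm, hP, hf'⟩ := hf
  obtain ⟨b, mem'', hm', hQ, hg'⟩ := hg a mem' hm hP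
  refine ⟨b, mem'', hm.trans hm', hQ, fun k => ?_⟩
  have hf_k := hf' fun a s' => g a s' k
  have hg_k := hg' k
  exact ⟨hf_k.1.trans hg_k.1, hf_k.2.trans (by lia)⟩

theorem exists_bind {ξ : Type} {R : ξ → Prop} {c' : ξ → ℕ} {Q' : ξ → β → List ℝ → Prop}
    (hf : f.Computes mem c P)
    (hg : ∀ a mem', mem <+: mem' → P a mem' → ∃ x, R x ∧ (g a).Computes mem' (c' x) (Q' x)) :
    ∃ x, R x ∧ (f >>= g).Computes mem (c + c' x) (Q' x) := by
  obtain ⟨a, mem', hm, hP, hf'⟩ := hf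
  obtain ⟨x, hx, hg'⟩ := hg a mem' hm hP
  refine ⟨x, hx, bind (P := fun a' m => a' = a ∧ m = mem') ⟨a, mem', hm, ⟨rfl, rfl⟩, hf'⟩ ?_⟩
  rintro _ _ - ⟨rfl, rfl⟩
  exact hg'

theorem const (q : ℚ) : (Frag.const q).Computes mem 1 fun a m => Holds m a q :=
  ⟨mem.length, mem ++ [(q : ℝ)], List.prefix_append _ _, holds_append_singleton _ _, fun k => by
    simp [Frag.const, Prog.output, Prog.cost]⟩

theorem un {i : ℕ} {v : ℝ} (op : UnOp) (h : Holds mem i v) :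
    (Frag.un op i).Computes mem 1 fun a m => Holds m a (op.eval v) :=
  ⟨mem.length, mem ++ [op.eval v], List.prefix_append _ _, holds_append_singleton _ _, fun k => by
    simp [Frag.un, Prog.output, Prog.cost, h.reg_eq]⟩

theorem bin {i j : ℕ} {v w : ℝ} (op : BinOp) (hi : Holds mem i v) (hj : Holds mem j w) :
    (Frag.bin op i j).Computes mem 1 fun a m => Holds m a (op.eval v w) :=
  ⟨mem.length, mem ++ [op.eval v w], List.prefix_append _ _, holds_append_singleton _ _,
    fun k => by simp [Frag.bin, Prog.output, Prog.cost, hi.reg_eq, hj.reg_eq]⟩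

theorem ifLt {i j : ℕ} {v w : ℝ} {f g : Frag α} (hi : Holds mem i v) (hj : Holds mem j w)
    (hf : v < w → f.Computes mem c P) (hg : ¬ v < w → g.Computes mem c P) :
    (Frag.ifLt i j f g).Computes mem (c + 1) P := by
  by_cases h : v < w
  · obtain ⟨a, mem', hm, hP, hk⟩ := hf h
    refine ⟨a, mem', hm, hP, fun k => ?_⟩
    simp only [Frag.ifLt, Prog.output, Prog.cost, hi.reg_eq, hj.reg_eq, h, if_true]
    exact ⟨(hk k).1, by linarith [(hk k).2]⟩
  · obtain ⟨a, mem', hm, hP, hk⟩ := hg h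
    refine ⟨a, mem', hm, hP, fun k => ?_⟩
    simp only [Frag.ifLt, Prog.output, Prog.cost, hi.reg_eq, hj.reg_eq, h, if_false]
    exact ⟨(hk k).1, by linarith [(hk k).2]⟩

theorem ceil {i : ℕ} {v : ℝ} (h : Holds mem i v) :
    (Frag.ceil i).Computes mem (⌈v⌉₊ + 1) fun a _ => a = ⌈v⌉₊ :=
  ⟨⌈v⌉₊, mem, List.prefix_rfl, rfl, fun k => by
    simp [Frag.ceil, Prog.output, Prog.cost, h.reg_eq]⟩

theorem toProg {f : Frag (List ℕ)} {s : ℕ} {R : List ℝ → Prop}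
    (h : f.Computes mem c fun l m => R (l.map (reg m))) (hs : s = mem.length) :
    R ((f.toProg s).output mem) ∧ (f.toProg s).cost mem ≤ c := by
  obtain ⟨l, mem', -, hl, hk⟩ := h
  obtain ⟨h_out, h_cost⟩ := hk fun l _ => .ret l
  rw [← hs] at h_out h_cost
  exact ⟨(congrArg R h_out).mpr hl, h_cost.trans_eq (Nat.zero_add c)⟩

end Computes

end Frag

/-- Arithmetic expressions in the registers. -/
inductive Expr
  | reg (i : ℕ)
  | const (q : ℚ)
  | un (f : UnOp) (e : Expr)
  | bin (f : BinOp) (e₁ e₂ : Expr)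

namespace Expr

instance : Add Expr := ⟨.bin .add⟩
instance : Sub Expr := ⟨.bin .sub⟩
instance : Mul Expr := ⟨.bin .mul⟩
instance : Div Expr := ⟨.bin .div⟩

/-- The number of operations in an expression. -/
def size : Expr → ℕ
  | .reg _ => 0
  | .const _ => 1
  | .un _ e => e.size + 1
  | .bin _ e₁ e₂ => e₁.size + e₂.size + 1

/-- The expression refers to existing registers only and has the value `v`. -/
inductive Denotes (mem : List ℝ) : Expr → ℝ → Prop
  | reg {i v} : Holds mem i v → Denotes mem (.reg i) v
  | const (q : ℚ) : Denotes mem (.const q) q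
  | un (f : UnOp) {e v} : Denotes mem e v → Denotes mem (.un f e) (f.eval v)
  | bin (f : BinOp) {e₁ e₂ v₁ v₂} : Denotes mem e₁ v₁ → Denotes mem e₂ v₂ →
      Denotes mem (.bin f e₁ e₂) (f.eval v₁ v₂)

namespace Denotes

variable {mem mem' : List ℝ} {e e₁ e₂ : Expr} {v v₁ v₂ : ℝ}

theorem mono (h : e.Denotes mem v) (hm : mem <+: mem') : e.Denotes mem' v := by
  induction h with
  | reg h => exact .reg (h.mono hm)
  | const q => exact .const q
  | un f _ ih => exact .un f ih
  | bin f _ _ ih₁ ih₂ => exact .bin f ih₁ ih₂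

theorem add (h₁ : e₁.Denotes mem v₁) (h₂ : e₂.Denotes mem v₂) :
    (e₁ + e₂).Denotes mem (v₁ + v₂) := .bin .add h₁ h₂

theorem sub (h₁ : e₁.Denotes mem v₁) (h₂ : e₂.Denotes mem v₂) :
    (e₁ - e₂).Denotes mem (v₁ - v₂) := .bin .sub h₁ h₂

theorem mul (h₁ : e₁.Denotes mem v₁) (h₂ : e₂.Denotes mem v₂) :
    (e₁ * e₂).Denotes mem (v₁ * v₂) := .bin .mul h₁ h₂

theorem div (h₁ : e₁.Denotes mem v₁) (h₂ : e₂.Denotes mem v₂) :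
    (e₁ / e₂).Denotes mem (v₁ / v₂) := .bin .div h₁ h₂

theorem sqrt (h : e.Denotes mem v) : (Expr.un .sqrt e).Denotes mem (Real.sqrt v) := .un .sqrt h

theorem congr (h : e.Denotes mem v) (hv : v = v₁) : e.Denotes mem v₁ := hv ▸ h

end Denotes

/-- The absolute value, which is not among the operations, as `√(e²)`. -/
def abs (e : Expr) : Expr := .un .sqrt (e * e)

theorem Denotes.abs {mem : List ℝ} {e : Expr} {v : ℝ} (h : e.Denotes mem v) :
    e.abs.Denotes mem |v| :=
  (h.mul h).sqrt.congr (Real.sqrt_mul_self_eq_abs v)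

/-- The negative, which is not among the operations, as `0 - e`. -/
def neg (e : Expr) : Expr := .const 0 - e

theorem Denotes.neg {mem : List ℝ} {e : Expr} {v : ℝ} (h : e.Denotes mem v) :
    e.neg.Denotes mem (-v) :=
  ((Denotes.const 0).sub h).congr (by simp)

end Expr

namespace Frag

variable {α β σ ι : Type} {mem : List ℝ}

/-- Evaluates an expression and returns the address of its value. -/
def expr : Expr → Frag ℕ
  | .reg i => pure i
  | .const q => const q
  | .un f e => do un f (← expr e)
  | .bin f e₁ e₂ => do
    let a ← expr e₁
    let b ← expr e₂
    bin f a b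

theorem Computes.expr {e : Expr} {v : ℝ} (h : e.Denotes mem v) :
    (Frag.expr e).Computes mem e.size fun a m => Holds m a v := by
  induction e generalizing mem v with
  | reg i => cases h with | reg h => exact .pure h
  | const q => cases h; exact .const q
  | un f e ih =>
    cases h with | un _ h =>
    exact (ih h).bind fun a m _ ha => .un f ha
  | bin f e₁ e₂ ih₁ ih₂ =>
    cases h with | bin _ h₁ h₂ =>
    refine ((ih₁ h₁).bind fun a m hm ha => (ih₂ (h₂.mono hm)).bind fun b m' hm' hb =>
      .bin f (ha.mono hm') hb).mono_cost ?_
    rw [Expr.size, add_assoc]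

theorem Computes.expr_le {e : Expr} {v : ℝ} {c : ℕ} (h : e.Denotes mem v) (hc : e.size ≤ c) :
    (Frag.expr e).Computes mem c fun a m => Holds m a v :=
  (Computes.expr h).mono_cost hc

/-- Evaluates the sum of the expressions `e i`, `i ∈ l`. -/
def sumList (e : ι → Expr) : List ι → Frag ℕ
  | [] => const 0
  | i :: l => do
    let a ← sumList e l
    expr (.reg a + e i)

theorem Computes.sumList {e : ι → Expr} {v : ι → ℝ} {c : ℕ} (l : List ι)
    (h : ∀ i ∈ l, (e i).Denotes mem (v i)) (hc : ∀ i ∈ l, (e i).size ≤ c) :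
    (Frag.sumList e l).Computes mem (1 + (c + 1) * l.length)
      fun a m => Holds m a (l.map v).sum := by
  induction l with
  | nil => exact (Computes.const 0).mono (by simp) fun a m _ h => by simpa using h
  | cons i l ih =>
    rw [List.forall_mem_cons] at h hc
    have h_size (a : ℕ) : (Expr.reg a + e i).size ≤ c + 1 :=
      Nat.succ_le_succ ((Nat.zero_add _).trans_le hc.1)
    refine ((ih h.2 hc.2).bind fun a m hm ha =>
      Computes.expr_le (.add (.reg ha) (h.1.mono hm)) (h_size a)).mono ?_ fun a m _ ha => ?_
    · rw [List.length_cons, mul_add_one, add_assoc]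
    · simpa only [List.map_cons, List.sum_cons, add_comm] using ha

/-- Evaluates the sum of the expressions `e i`, `i ∈ s`. -/
def sum (s : Finset ι) (e : ι → Expr) : Frag ℕ := sumList e s.toList

theorem Computes.sum {e : ι → Expr} {v : ι → ℝ} {c : ℕ} {s : Finset ι}
    (h : ∀ i ∈ s, (e i).Denotes mem (v i)) (hc : ∀ i ∈ s, (e i).size ≤ c) :
    (Frag.sum s e).Computes mem (1 + (c + 1) * s.card) fun a m => Holds m a (∑ i ∈ s, v i) := by
  simpa [Frag.sum] using Computes.sumList s.toList (mem := mem) (e := e) (v := v) (c := c)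
    (fun i hi => h i (Finset.mem_toList.1 hi)) (fun i hi => hc i (Finset.mem_toList.1 hi))

/-- Evaluates the product of the registers `t i`, `i ∈ l`. -/
def prodList (t : ι → ℕ) : List ι → Frag ℕ
  | [] => const 1
  | i :: l => do
    let a ← prodList t l
    bin .mul a (t i)

theorem Computes.prodList {t : ι → ℕ} {v : ι → ℝ} (l : List ι)
    (h : ∀ i ∈ l, Holds mem (t i) (v i)) :
    (Frag.prodList t l).Computes mem (1 + l.length) fun a m => Holds m a (l.map v).prod := by
  induction l with
  | nil => exact (Computes.const 1).mono (by simp) fun a m _ h => by simpa using h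
  | cons i l ih =>
    rw [List.forall_mem_cons] at h
    refine ((ih h.2).bind fun a m hm ha => .bin .mul ha (h.1.mono hm)).mono ?_ fun a m _ ha => ?_
    · rw [List.length_cons, add_assoc]
    · simpa only [BinOp.eval, List.map_cons, List.prod_cons, mul_comm] using ha

/-- Evaluates the product of the registers `t i`, `i ∈ s`. -/
def prod (s : Finset ι) (t : ι → ℕ) : Frag ℕ := prodList t s.toList

theorem Computes.prod {t : ι → ℕ} {v : ι → ℝ} {s : Finset ι}
    (h : ∀ i ∈ s, Holds mem (t i) (v i)) :
    (Frag.prod s t).Computes mem (1 + s.card) fun a m => Holds m a (∏ i ∈ s, v i) := by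
  simpa [Frag.prod] using Computes.prodList s.toList (mem := mem) (t := t) (v := v)
    fun i hi => h i (Finset.mem_toList.1 hi)

/-- Runs the fragments `f i`, `i ∈ l`, and tabulates their results. -/
def tabList [DecidableEq ι] [Inhabited α] (f : ι → Frag α) : List ι → Frag (ι → α)
  | [] => pure fun _ => default
  | i :: l => do
    let a ← f i
    let t ← tabList f l
    pure (Function.update t i a)

theorem Computes.tabList [DecidableEq ι] [Inhabited α] {f : ι → Frag α} {c : ℕ}
    {P : ι → α → List ℝ → Prop} (hP : ∀ i a, Persistent (P i a)) (l : List ι)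
    (h : ∀ i ∈ l, ∀ m, mem <+: m → (f i).Computes m c (P i)) :
    (Frag.tabList f l).Computes mem (c * l.length) fun t m => ∀ i ∈ l, P i (t i) m := by
  induction l generalizing mem with
  | nil => exact .pure fun i hi => absurd hi List.not_mem_nil
  | cons i l ih =>
    rw [List.forall_mem_cons] at h
    refine ((h.1 mem List.prefix_rfl).bind fun a m hm ha =>
      (ih fun j hj m' hm' => h.2 j hj m' (hm.trans hm')).bind fun t m' hm' ht =>
        .pure fun j hj => ?_).mono_cost ?_
    · by_cases hij : j = i
      · subst hij
        simpa only [Function.update_self] using hP _ _ hm' ha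
      · simpa only [Function.update_of_ne hij] using ht j ((List.mem_cons.1 hj).resolve_left hij)
    · rw [List.length_cons, mul_add_one, add_zero, add_comm]

/-- Runs the fragments `f i`, `i ∈ s`, and tabulates their results. -/
def tabOn [DecidableEq ι] [Inhabited α] (s : Finset ι) (f : ι → Frag α) : Frag (ι → α) :=
  tabList f s.toList

theorem Computes.tabOn [DecidableEq ι] [Inhabited α] {s : Finset ι} {f : ι → Frag α} {c : ℕ}
    {P : ι → α → List ℝ → Prop} (hP : ∀ i a, Persistent (P i a))
    (h : ∀ i ∈ s, ∀ m, mem <+: m → (f i).Computes m c (P i)) :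
    (Frag.tabOn s f).Computes mem (c * s.card) fun t m => ∀ i ∈ s, P i (t i) m := by
  simpa [Frag.tabOn] using Computes.tabList hP s.toList fun i hi => h i (Finset.mem_toList.1 hi)

theorem Computes.foldlM {N : ℕ} {f : σ → Fin N → Frag σ} {s : σ} {c : Fin N → ℕ}
    (Inv : ℕ → σ → List ℝ → Prop) (h₀ : Inv 0 s mem)
    (h : ∀ (i : Fin N) s' m, mem <+: m → Inv i s' m → (f s' i).Computes m (c i) (Inv (i + 1))) :
    (Fin.foldlM N f s).Computes mem (∑ i, c i) (Inv N) := by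
  induction N generalizing mem s Inv with
  | zero => rw [Fin.foldlM_zero]; exact .pure h₀
  | succ N ih =>
    rw [Fin.foldlM_succ, Fin.sum_univ_succ]
    refine (h 0 s mem List.prefix_rfl h₀).bind fun s' m hm hs' => ?_
    exact ih (fun k => Inv (k + 1)) hs' fun i s'' m' hm' hs'' => h i.succ s'' m' (hm.trans hm') hs''

theorem Computes.foldlM_foldl {τ : Type} {N c : ℕ} {f : σ → Fin N → Frag σ}
    {g : τ → Fin N → τ} {s : σ} {x : τ} (R : σ → τ → List ℝ → Prop)
    (h₀ : R s x mem)
    (h : ∀ i s' x' m, mem <+: m → R s' x' m →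
      (f s' i).Computes m c fun s'' m' => R s'' (g x' i) m') :
    (Fin.foldlM N f s).Computes mem (N * c) fun s' m => R s' (Fin.foldl N g x) m := by
  induction N generalizing mem s x with
  | zero =>
    rw [Fin.foldlM_zero, Fin.foldl_zero]
    exact (Computes.pure (P := fun s' m => R s' x m) h₀).mono_cost (Nat.zero_le _)
  | succ N ih =>
    rw [Fin.foldlM_succ, Fin.foldl_succ]
    exact ((h 0 s x mem List.prefix_rfl h₀).bind fun s' m hm hs' =>
      ih hs' fun i s'' x' m' hm' => h i.succ s'' x' m' (hm.trans hm')).mono_cost (by lia)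

/-- A table whose entries are computed in the order `ord 0, ord 1, …`; each may use the entries
computed before. -/
def seqTab {N : ℕ} [Inhabited α] (ord : Equiv.Perm (Fin N))
    (f : Fin N → (Fin N → α) → Frag α) : Frag (Fin N → α) :=
  Fin.foldlM N (fun t i => do
    let a ← f (ord i) t
    pure (Function.update t (ord i) a)) default

theorem Computes.seqTab {N : ℕ} [Inhabited α] {ord : Equiv.Perm (Fin N)}
    {f : Fin N → (Fin N → α) → Frag α} {c : Fin N → ℕ} {P : Fin N → α → List ℝ → Prop}
    (hP : ∀ i a, Persistent (P i a))
    (h : ∀ i t m, mem <+: m → (∀ j, ord.symm j < ord.symm i → P j (t j) m) →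
      (f i t).Computes m (c i) (P i)) :
    (Frag.seqTab ord f).Computes mem (∑ i, c i) fun t m => ∀ i, P i (t i) m := by
  rw [← Equiv.sum_comp ord c]
  refine (Computes.foldlM (c := fun i => c (ord i))
    (fun k t m => ∀ i, (ord.symm i : ℕ) < k → P i (t i) m) (by simp)
    fun i t m hm ht => ?_).mono le_rfl fun t m _ ht i => ht i (ord.symm i).2
  refine (h (ord i) t m hm fun j hj => ht j (by simpa using hj)).bind fun a m' hm' ha =>
    .pure fun j hj => ?_
  by_cases hij : j = ord i
  · subst hij
    simpa only [Function.update_self] using ha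
  · have h_ne : (ord.symm j : ℕ) ≠ i := fun h_eq => hij (ord.symm_apply_eq.1 (Fin.ext h_eq))
    simpa only [Function.update_of_ne hij] using hP _ _ hm' (ht j (by lia))

/-- A table of independently computed entries. -/
def tab {N : ℕ} [Inhabited α] (f : Fin N → Frag α) : Frag (Fin N → α) :=
  seqTab (Equiv.refl _) fun i _ => f i

theorem Computes.tab_sum {N : ℕ} [Inhabited α] {f : Fin N → Frag α} {c : Fin N → ℕ}
    {P : Fin N → α → List ℝ → Prop} (hP : ∀ i a, Persistent (P i a))
    (h : ∀ i m, mem <+: m → (f i).Computes m (c i) (P i)) :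
    (Frag.tab f).Computes mem (∑ i, c i) fun t m => ∀ i, P i (t i) m :=
  Computes.seqTab hP fun i _ m hm _ => h i m hm

theorem Computes.tab {N : ℕ} [Inhabited α] {f : Fin N → Frag α} {c : ℕ}
    {P : Fin N → α → List ℝ → Prop} (hP : ∀ i a, Persistent (P i a))
    (h : ∀ i m, mem <+: m → (f i).Computes m c (P i)) :
    (Frag.tab f).Computes mem (N * c) fun t m => ∀ i, P i (t i) m := by
  simpa using Computes.tab_sum hP h

end Frag

/-! ### Reverse Cholesky factorisation without fill-in -/

section Cholesky

theorem exists_cholesky {n : Type*} [LinearOrder n] [Fintype n] [LocallyFiniteOrderBot n]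
    {A : Matrix n n ℝ} (hA : A.PosDef) :
    ∃ T : Matrix n n ℝ, (∀ i j, i < j → T i j = 0) ∧ (∀ i, 0 < T i i) ∧ A = T * T.transpose := by
  set T := LDL.lower hA
  set d := LDL.diagEntries hA
  have hT_unit : IsUnit T := (Matrix.isUnit_nonsing_inv_iff).2 (isUnit_of_invertible _)
  have hT_lower : T.IsLowerTriangular := by
    have := LDL.invertibleLowerInv hA
    exact Matrix.blockTriangular_inv_of_blockTriangular fun i j hij =>
      LDL.lowerInv_triangular hA hij
  have hT_diag (i : n) : T i i ≠ 0 := by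
    rw [Matrix.isUnit_iff_isUnit_det, Matrix.det_of_isLowerTriangular T hT_lower] at hT_unit
    exact Finset.prod_ne_zero_iff.1 hT_unit.ne_zero i (Finset.mem_univ i)
  have hd : ∀ i, 0 < d i := by
    have h_conj : (Matrix.diagonal d).PosDef := by
      change (LDL.diag hA).PosDef
      rw [LDL.diag_eq_lowerInv_conj]
      exact hA.mul_mul_conjTranspose_same
        (Matrix.vecMul_injective_iff_isUnit.2 (isUnit_of_invertible _))
    exact Matrix.posDef_diagonal_iff.1 h_conj
  have h_root (j : n) : ∃ r, 0 < T j j * r ∧ r * r = d j := by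
    have h_sq : Real.sqrt (d j) * Real.sqrt (d j) = d j := Real.mul_self_sqrt (hd j).le
    have h_pos : 0 < Real.sqrt (d j) := Real.sqrt_pos.2 (hd j)
    rcases (hT_diag j).lt_or_gt with h_neg | h_pos'
    · exact ⟨-Real.sqrt (d j), mul_pos_of_neg_of_neg h_neg (neg_neg_iff_pos.2 h_pos),
        by rw [neg_mul_neg, h_sq]⟩
    · exact ⟨Real.sqrt (d j), mul_pos h_pos' h_pos, h_sq⟩
  choose r hr_pos hr_sq using h_root
  refine ⟨T * Matrix.diagonal r, fun i j hij => ?_, fun i => ?_, ?_⟩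
  · rw [Matrix.mul_diagonal, hT_lower hij, zero_mul]
  · rw [Matrix.mul_diagonal]
    exact hr_pos i
  · rw [Matrix.transpose_mul, Matrix.diagonal_transpose, Matrix.mul_assoc,
      ← Matrix.mul_assoc (Matrix.diagonal r), Matrix.diagonal_mul_diagonal, ← Matrix.mul_assoc]
    simp only [hr_sq]
    exact (LDL.lower_conj_diag hA).symm

variable {N : ℕ} {A L : Matrix (Fin N) (Fin N) ℝ}

theorem exists_isRevCholesky (hA : A.PosDef) : ∃ L, IsRevCholesky A L := by
  obtain ⟨T, hT_lower, hT_diag, hT⟩ :=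
    exists_cholesky (hA.submatrix (e := OrderDual.ofDual) OrderDual.ofDual.injective)
  refine ⟨(T.submatrix OrderDual.toDual OrderDual.toDual).transpose,
    fun i j hij => hT_lower _ _ hij, fun i => hT_diag _, ?_⟩
  ext i j
  exact congrFun₂ hT (OrderDual.toDual i) (OrderDual.toDual j)

theorem IsRevCholesky.isUnit (hL : IsRevCholesky A L) : IsUnit L := by
  rw [Matrix.isUnit_iff_isUnit_det, Matrix.det_of_isLowerTriangular L fun i j h => hL.1 i j h]
  exact (Finset.prod_pos fun i _ => hL.2.1 i).ne'.isUnit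

theorem IsRevCholesky.posDef (hL : IsRevCholesky A L) : A.PosDef := by
  rw [hL.2.2, ← Matrix.conjTranspose_eq_transpose_of_trivial]
  exact .conjTranspose_mul_self L (Matrix.mulVec_injective_iff_isUnit.2 hL.isUnit)

theorem IsRevCholesky.apply_eq_sum (hL : IsRevCholesky A L) (i j : Fin N) :
    A i j = ∑ k, L k i * L k j := by
  rw [hL.2.2, Matrix.mul_apply]
  rfl

end Cholesky

/-- A sparsity pattern of symmetric matrices (given by the positions below the diagonal), with
boundedly many entries in each row, for which elimination from the last to the first unknown
produces no fill-in. -/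
structure Pattern (N : ℕ) where
  lo : Fin N → Finset (Fin N)
  lt_of_mem : ∀ {i j}, j ∈ lo i → j < i
  card_le : ∀ i, (lo i).card ≤ 4
  clique : ∀ {i j k}, i ∈ lo k → j ∈ lo k → j < i → j ∈ lo i

namespace Pattern

variable {N : ℕ} (P : Pattern N)

/-- The positions of the pattern in column `j`, which are by symmetry those in row `j` above the
diagonal. -/
def up (j : Fin N) : Finset (Fin N) := Finset.univ.filter fun i => j ∈ P.lo i

variable {P}

theorem mem_up {i j : Fin N} : i ∈ P.up j ↔ j ∈ P.lo i := by simp [up]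

theorem lt_of_mem_up {i j : Fin N} (h : i ∈ P.up j) : j < i := P.lt_of_mem (mem_up.1 h)

theorem sum_card_up_le : ∑ j, (P.up j).card ≤ 4 * N :=
  calc ∑ j, (P.up j).card = ∑ i, (P.lo i).card := by
        simp only [up, Finset.card_eq_sum_ones, Finset.sum_filter]
        rw [Finset.sum_comm]
        simp
    _ ≤ ∑ _i : Fin N, 4 := Finset.sum_le_sum fun i _ => P.card_le i
    _ = 4 * N := by simp [mul_comm]

theorem sum_eq_add_sum_lo {i : Fin N} {f : Fin N → ℝ} (h : ∀ k, k ≠ i → k ∉ P.lo i → f k = 0) :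
    ∑ k, f k = f i + ∑ k ∈ P.lo i, f k := by
  rw [← Finset.sum_insert fun hi => (P.lt_of_mem hi).false]
  refine (Finset.sum_subset (Finset.subset_univ _) fun k _ hk => ?_).symm
  rw [Finset.mem_insert, not_or] at hk
  exact h k hk.1 hk.2

theorem sum_eq_add_sum_up {i : Fin N} {f : Fin N → ℝ} (h : ∀ k, k ≠ i → k ∉ P.up i → f k = 0) :
    ∑ k, f k = f i + ∑ k ∈ P.up i, f k := by
  rw [← Finset.sum_insert fun hi => (lt_of_mem_up hi).false]
  refine (Finset.sum_subset (Finset.subset_univ _) fun k _ hk => ?_).symm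
  rw [Finset.mem_insert, not_or] at hk
  exact h k hk.1 hk.2

variable (P) in
/-- `A` is symmetric with sparsity pattern `P`. -/
def Conforms (A : Matrix (Fin N) (Fin N) ℝ) : Prop :=
  A.IsSymm ∧ ∀ i j, j < i → j ∉ P.lo i → A i j = 0

namespace Conforms

variable {A B : Matrix (Fin N) (Fin N) ℝ}

theorem sub (hA : P.Conforms A) (hB : P.Conforms B) : P.Conforms (A - B) :=
  ⟨hA.1.sub hB.1, fun i j h h' => by simp [hA.2 i j h h', hB.2 i j h h']⟩

theorem add (hA : P.Conforms A) (hB : P.Conforms B) : P.Conforms (A + B) :=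
  ⟨hA.1.add hB.1, fun i j h h' => by simp [hA.2 i j h h', hB.2 i j h h']⟩

theorem smul (hA : P.Conforms A) (c : ℝ) : P.Conforms (c • A) :=
  ⟨hA.1.smul c, fun i j h h' => by simp [hA.2 i j h h']⟩

theorem mulVec_apply (hA : P.Conforms A) (v : Fin N → ℝ) (i : Fin N) :
    A.mulVec v i = A i i * v i + (∑ k ∈ P.lo i, A i k * v k + ∑ k ∈ P.up i, A k i * v k) := by
  have h_disj : Disjoint (P.lo i) (P.up i) := Finset.disjoint_left.2 fun k h h' =>
    (P.lt_of_mem h).asymm (lt_of_mem_up h')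
  have hi : i ∉ P.lo i ∪ P.up i := by
    rw [Finset.mem_union, not_or]
    exact ⟨fun h => (P.lt_of_mem h).false, fun h => (lt_of_mem_up h).false⟩
  have h_up : ∑ k ∈ P.up i, A k i * v k = ∑ k ∈ P.up i, A i k * v k :=
    Finset.sum_congr rfl fun k _ => by rw [hA.1.apply]
  rw [Matrix.mulVec, dotProduct, h_up, ← Finset.sum_union h_disj,
    ← Finset.sum_insert (f := fun k => A i k * v k) hi]
  refine (Finset.sum_subset (Finset.subset_univ _) fun k _ hk => ?_).symm
  simp only [Finset.mem_insert, Finset.mem_union, not_or] at hk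
  obtain ⟨hki, hk_lo, hk_up⟩ := hk
  rcases lt_or_gt_of_ne hki with h | h
  · rw [hA.2 i k h hk_lo, zero_mul]
  · rw [← hA.1.apply, hA.2 k i h fun h' => hk_up (mem_up.2 h'), zero_mul]

end Conforms

variable (P) in
/-- The reverse Cholesky recursion, from the last row to the first. -/
def cholRec (A : Matrix (Fin N) (Fin N) ℝ) (i j : Fin N) : ℝ :=
  if j = i then Real.sqrt (A i i - ∑ k ∈ (P.up i).attach, cholRec A k i * cholRec A k i)
  else if j ∈ P.lo i then
    (A i j - ∑ k ∈ (P.up i).attach, cholRec A k i * cholRec A k j) /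
      Real.sqrt (A i i - ∑ k ∈ (P.up i).attach, cholRec A k i * cholRec A k i)
  else 0
termination_by N - i
decreasing_by all_goals
  have := lt_of_mem_up k.2
  lia

variable {A L : Matrix (Fin N) (Fin N) ℝ}

theorem cholRec_diag (i : Fin N) : P.cholRec A i i =
    Real.sqrt (A i i - ∑ k ∈ P.up i, P.cholRec A k i * P.cholRec A k i) := by
  rw [cholRec, if_pos rfl, Finset.sum_attach (P.up i) fun k => P.cholRec A k i * P.cholRec A k i]

theorem cholRec_of_mem {i j : Fin N} (h : j ∈ P.lo i) : P.cholRec A i j =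
    (A i j - ∑ k ∈ P.up i, P.cholRec A k i * P.cholRec A k j) / P.cholRec A i i := by
  rw [cholRec, if_neg (P.lt_of_mem h).ne, if_pos h, cholRec_diag,
    Finset.sum_attach (P.up i) fun k => P.cholRec A k i * P.cholRec A k i,
    Finset.sum_attach (P.up i) fun k => P.cholRec A k i * P.cholRec A k j]

theorem cholRec_eq_zero {i j : Fin N} (h : j ≠ i) (h' : j ∉ P.lo i) : P.cholRec A i j = 0 := by
  rw [cholRec, if_neg h, if_neg h']

/-- No fill-in: if the `k`-th term of `∑ k, L k i * L k j` with `i < k` did not vanish, then `i` and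
`j` would both be in `lo k`, hence `j ∈ lo i` by `Pattern.clique`. -/
theorem Conforms.revCholesky_apply_eq_zero (hA : P.Conforms A) (hL : IsRevCholesky A L)
    {i j : Fin N} (hji : j ≠ i) (hj : j ∉ P.lo i) : L i j = 0 := by
  induction i using WellFoundedGT.induction generalizing j with
  | ind i ih =>
  rcases lt_or_gt_of_ne hji with hlt | hgt
  · have h_sum := hL.apply_eq_sum i j
    rw [hA.2 i j hlt hj, Finset.sum_eq_single i] at h_sum
    · exact (mul_eq_zero.1 h_sum.symm).resolve_left (hL.2.1 i).ne'
    · intro k _ hk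
      rcases lt_or_gt_of_ne hk with hki | hik
      · rw [hL.1 k i hki, zero_mul]
      · by_cases hi_mem : i ∈ P.lo k
        · rw [ih k hik (hlt.trans hik).ne fun hj_mem => hj (P.clique hi_mem hj_mem hlt), mul_zero]
        · rw [ih k hik hik.ne hi_mem, zero_mul]
    · exact fun hi => absurd (Finset.mem_univ i) hi
  · exact hL.1 i j hgt

theorem Conforms.apply_eq_add_sum_up (hA : P.Conforms A) (hL : IsRevCholesky A L) (i j : Fin N) :
    A i j = L i i * L i j + ∑ k ∈ P.up i, L k i * L k j := by
  rw [hL.apply_eq_sum, sum_eq_add_sum_up fun k hki hk => ?_]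
  rw [hA.revCholesky_apply_eq_zero hL hki.symm fun hi => hk (mem_up.2 hi), zero_mul]

theorem Conforms.revCholesky_eq_cholRec (hA : P.Conforms A) (hL : IsRevCholesky A L)
    (i j : Fin N) : L i j = P.cholRec A i j := by
  induction i using WellFoundedGT.induction generalizing j with
  | ind i ih =>
  have h_sum (j : Fin N) : ∑ k ∈ P.up i, P.cholRec A k i * P.cholRec A k j =
      ∑ k ∈ P.up i, L k i * L k j := Finset.sum_congr rfl fun k hk => by
    rw [ih k (lt_of_mem_up hk), ih k (lt_of_mem_up hk)]
  have h_diag : L i i = P.cholRec A i i := by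
    rw [cholRec_diag, h_sum, hA.apply_eq_add_sum_up hL, add_sub_cancel_right,
      Real.sqrt_mul_self (hL.2.1 i).le]
  by_cases hji : j = i
  · rw [hji, h_diag]
  by_cases hj : j ∈ P.lo i
  · rw [cholRec_of_mem hj, h_sum, hA.apply_eq_add_sum_up hL, add_sub_cancel_right, ← h_diag,
      mul_div_cancel_left₀ _ (hL.2.1 i).ne']
  · rw [cholRec_eq_zero hji hj, hA.revCholesky_apply_eq_zero hL hji hj]

theorem Conforms.apply_eq_sum_cholRec (hA : P.Conforms A) (hpos : ∀ i, 0 < P.cholRec A i i)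
    {i j : Fin N} (hji : j ≤ i) : A i j = ∑ k, P.cholRec A k i * P.cholRec A k j := by
  rw [sum_eq_add_sum_up (i := i) fun k hki hk => by
    rw [cholRec_eq_zero hki.symm fun hi => hk (mem_up.2 hi), zero_mul]]
  rcases hji.lt_or_eq with hlt | rfl
  · by_cases hj : j ∈ P.lo i
    · rw [cholRec_of_mem hj, mul_div_cancel₀ _ (hpos i).ne', sub_add_cancel]
    · rw [hA.2 i j hlt hj, cholRec_eq_zero hlt.ne hj, mul_zero, zero_add]
      refine (Finset.sum_eq_zero fun k hk => ?_).symm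
      rw [cholRec_eq_zero (hlt.trans (lt_of_mem_up hk)).ne
        fun hj_mem => hj (P.clique (mem_up.1 hk) hj_mem hlt), mul_zero]
  · have h_sqrt := hpos j
    rw [cholRec_diag] at h_sqrt
    rw [cholRec_diag, Real.mul_self_sqrt (Real.sqrt_pos.1 h_sqrt).le, sub_add_cancel]

theorem Conforms.isRevCholesky_cholRec (hA : P.Conforms A) (hpos : ∀ i, 0 < P.cholRec A i i) :
    IsRevCholesky A (Matrix.of (P.cholRec A)) := by
  refine ⟨fun i j hij => cholRec_eq_zero hij.ne' fun hj => (P.lt_of_mem hj).asymm hij, hpos, ?_⟩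
  ext i j
  simp only [Matrix.mul_apply, Matrix.transpose_apply, Matrix.of_apply]
  rcases le_total j i with hji | hij
  · exact hA.apply_eq_sum_cholRec hpos hji
  · rw [← hA.1.apply, hA.apply_eq_sum_cholRec hpos hij]
    exact Finset.sum_congr rfl fun k _ => mul_comm _ _

theorem Conforms.isRevCholesky_cholRec_of_posDef (hA : P.Conforms A) (h : A.PosDef) :
    IsRevCholesky A (Matrix.of (P.cholRec A)) := by
  obtain ⟨L, hL⟩ := exists_isRevCholesky h
  exact hA.isRevCholesky_cholRec fun i => hA.revCholesky_eq_cholRec hL i i ▸ hL.2.1 i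

theorem Conforms.posDef_iff (hA : P.Conforms A) : A.PosDef ↔ 0 < ∏ i, P.cholRec A i i := by
  refine ⟨fun h => Finset.prod_pos fun i _ => (hA.isRevCholesky_cholRec_of_posDef h).2.1 i,
    fun h => (hA.isRevCholesky_cholRec fun i => lt_of_le_of_ne ?_ fun h_zero => ?_).posDef⟩
  · rw [cholRec_diag]
    exact Real.sqrt_nonneg _
  · exact h.ne' (Finset.prod_eq_zero (Finset.mem_univ i) h_zero.symm)

end Pattern

/-! ### Generalised eigenvalues of definite pencils -/

section Spectrum

variable {N : ℕ} {X Y L : Matrix (Fin N) (Fin N) ℝ}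

theorem mem_genSpectrum_iff {lam : ℝ} :
    lam ∈ genSpectrum X Y ↔ ∃ v ≠ 0, X.mulVec v = lam • Y.mulVec v := by
  rw [genSpectrum, Set.mem_ofPred_eq, Matrix.isUnit_iff_isUnit_det, isUnit_iff_ne_zero, not_not,
    ← Matrix.exists_mulVec_eq_zero_iff]
  simp only [Matrix.sub_mulVec, Matrix.smul_mulVec, sub_eq_zero]

/-- The matrix `L⁻ᵀ X L⁻¹`, whose eigenvalues are the generalised eigenvalues of the pencil
`X - λ Lᵀ L`. -/
def congrInv (L X : Matrix (Fin N) (Fin N) ℝ) : Matrix (Fin N) (Fin N) ℝ :=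
  L⁻¹.transpose * X * L⁻¹

theorem isHermitian_congrInv (hX : X.IsSymm) : (congrInv L X).IsHermitian := by
  rw [Matrix.IsHermitian, Matrix.conjTranspose_eq_transpose_of_trivial]
  simp only [congrInv, Matrix.transpose_mul, Matrix.transpose_transpose, hX.eq, Matrix.mul_assoc]

theorem posSemidef_congrInv (hX : X.PosSemidef) : (congrInv L X).PosSemidef := by
  rw [congrInv, ← Matrix.conjTranspose_eq_transpose_of_trivial]
  exact hX.conjTranspose_mul_mul_same _

theorem IsRevCholesky.smul_sub_eq (hL : IsRevCholesky Y L) (t : ℝ) :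
    t • Y - X = L.transpose * (t • 1 - congrInv L X) * L := by
  have h_det : IsUnit L.det := (Matrix.isUnit_iff_isUnit_det _).1 hL.isUnit
  have h_left : L.transpose * L⁻¹.transpose = 1 := by
    rw [← Matrix.transpose_mul, Matrix.nonsing_inv_mul _ h_det, Matrix.transpose_one]
  have h_congr : L.transpose * congrInv L X * L = X := by
    rw [congrInv, ← Matrix.mul_assoc, ← Matrix.mul_assoc, h_left, Matrix.one_mul, Matrix.mul_assoc,
      Matrix.nonsing_inv_mul _ h_det, Matrix.mul_one]
  rw [Matrix.mul_sub, Matrix.sub_mul, h_congr, Matrix.mul_smul, Matrix.smul_mul, Matrix.mul_one,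
    ← hL.2.2]

theorem IsRevCholesky.genSpectrum_eq (hL : IsRevCholesky Y L) :
    genSpectrum X Y = spectrum ℝ (congrInv L X) := by
  ext t
  have h_det : L.det ≠ 0 := ((Matrix.isUnit_iff_isUnit_det _).1 hL.isUnit).ne_zero
  rw [genSpectrum, Set.mem_ofPred_eq, spectrum.mem_iff, not_iff_not, ← neg_sub, IsUnit.neg_iff,
    hL.smul_sub_eq, Algebra.algebraMap_eq_smul_one]
  simp [Matrix.isUnit_iff_isUnit_det, h_det]

theorem IsRevCholesky.trace_inv_mul (hL : IsRevCholesky Y L) :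
    (Y⁻¹ * X).trace = (congrInv L X).trace := by
  rw [congrInv, hL.2.2, Matrix.mul_inv_rev, Matrix.transpose_nonsing_inv, Matrix.mul_assoc,
    Matrix.trace_mul_comm, Matrix.mul_assoc]

open scoped Pointwise in
theorem posDef_smul_sub_iff (hX : X.IsSymm) (hY : Y.PosDef) {t : ℝ} :
    (t • Y - X).PosDef ↔ ∀ μ ∈ genSpectrum X Y, μ < t := by
  obtain ⟨L, hL⟩ := exists_isRevCholesky hY
  have h_herm : (t • 1 - congrInv L X).IsHermitian :=
    (Matrix.isHermitian_one.smul (IsSelfAdjoint.all t)).sub (isHermitian_congrInv hX)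
  have h_shift : spectrum ℝ (t • 1 - congrInv L X) = ({t} : Set ℝ) - genSpectrum X Y := by
    rw [hL.genSpectrum_eq, spectrum.singleton_sub_eq, Algebra.algebraMap_eq_smul_one]
  rw [hL.smul_sub_eq, ← Matrix.conjTranspose_eq_transpose_of_trivial,
    ← Matrix.star_eq_conjTranspose, Matrix.IsUnit.posDef_star_left_conjugate_iff hL.isUnit,
    h_herm.posDef_iff_eigenvalues_pos, ← Set.forall_mem_range (p := fun x => 0 < x),
    ← h_herm.spectrum_real_eq_range_eigenvalues, h_shift]
  simp

theorem exists_isGreatest_genSpectrum (hN : 0 < N) (hX : X.PosSemidef) (hY : Y.PosDef) :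
    ∃ lam, IsGreatest (genSpectrum X Y) lam ∧ lam ≤ (Y⁻¹ * X).trace ∧
      (Y⁻¹ * X).trace ≤ N * lam := by
  obtain ⟨L, hL⟩ := exists_isRevCholesky hY
  have hZ : (congrInv L X).PosSemidef := posSemidef_congrInv hX
  have h_trace : (Y⁻¹ * X).trace = ∑ i, hZ.1.eigenvalues i := by
    simpa [hL.trace_inv_mul] using hZ.1.trace_eq_sum_eigenvalues
  have : Nonempty (Fin N) := ⟨⟨0, hN⟩⟩
  obtain ⟨i₀, hi₀⟩ := Finite.exists_max hZ.1.eigenvalues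
  rw [h_trace, hL.genSpectrum_eq, hZ.1.spectrum_real_eq_range_eigenvalues]
  refine ⟨hZ.1.eigenvalues i₀, ⟨Set.mem_range_self i₀, Set.forall_mem_range.2 hi₀⟩,
    Finset.single_le_sum (fun i _ => hZ.eigenvalues_nonneg i) (Finset.mem_univ i₀), ?_⟩
  simpa using Finset.sum_le_card_nsmul Finset.univ hZ.1.eigenvalues _ fun i _ => hi₀ i

theorem inv_mem_genSpectrum {μ : ℝ} (hμ : μ ≠ 0) :
    μ⁻¹ ∈ genSpectrum Y X ↔ μ ∈ genSpectrum X Y := by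
  simp only [mem_genSpectrum_iff]
  refine exists_congr fun v => and_congr_right fun _ => ?_
  rw [eq_inv_smul_iff₀ hμ, eq_comm]

theorem neg_mem_genSpectrum_neg {μ : ℝ} : -μ ∈ genSpectrum (-X) Y ↔ μ ∈ genSpectrum X Y := by
  simp only [mem_genSpectrum_iff]
  refine exists_congr fun v => and_congr_right fun _ => ?_
  rw [Matrix.neg_mulVec, neg_smul, neg_inj]

theorem pos_of_mem_genSpectrum (hX : X.PosDef) (hY : Y.PosDef) {μ : ℝ}
    (hμ : μ ∈ genSpectrum X Y) : 0 < μ := by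
  obtain ⟨v, hv, h_eig⟩ := mem_genSpectrum_iff.1 hμ
  have hX_pos := hX.dotProduct_mulVec_pos hv
  rw [h_eig, dotProduct_smul, smul_eq_mul] at hX_pos
  exact pos_of_mul_pos_left hX_pos (hY.dotProduct_mulVec_pos hv).le

end Spectrum

/-! ### Sparse linear algebra programs -/

/-- The registers `t i` hold the vector `v`. -/
def HoldsVec {ι : Type} (mem : List ℝ) (t : ι → ℕ) (v : ι → ℝ) : Prop :=
  ∀ i, Holds mem (t i) (v i)

theorem HoldsVec.mono {ι : Type} {mem mem' : List ℝ} {t : ι → ℕ} {v : ι → ℝ}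
    (h : HoldsVec mem t v) (hm : mem <+: mem') : HoldsVec mem' t v := fun i => (h i).mono hm

/-- The registers `t i j` hold the matrix `X`. -/
def HoldsMat {ι κ : Type} (mem : List ℝ) (t : ι → κ → ℕ) (X : Matrix ι κ ℝ) : Prop :=
  ∀ i j, Holds mem (t i j) (X i j)

theorem HoldsMat.mono {ι κ : Type} {mem mem' : List ℝ} {t : ι → κ → ℕ} {X : Matrix ι κ ℝ}
    (h : HoldsMat mem t X) (hm : mem <+: mem') : HoldsMat mem' t X :=
  fun i j => (h i j).mono hm

theorem HoldsMat.append {ι κ : Type} {mem : List ℝ} {t : ι → κ → ℕ} {X : Matrix ι κ ℝ}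
    (h : HoldsMat mem t X) (l : List ℝ) : HoldsMat (mem ++ l) t X :=
  h.mono (List.prefix_append _ _)

namespace Frag

variable {ι : Type} {mem : List ℝ}

/-- Evaluates the sum of the products of the registers `t i` and `u i`, `i ∈ s`. -/
def dot (s : Finset ι) (t u : ι → ℕ) : Frag ℕ := sum s fun i => .reg (t i) * .reg (u i)

theorem Computes.dot {s : Finset ι} {t u : ι → ℕ} {v w : ι → ℝ}
    (ht : ∀ i ∈ s, Holds mem (t i) (v i)) (hu : ∀ i ∈ s, Holds mem (u i) (w i)) :
    (Frag.dot s t u).Computes mem (1 + 2 * s.card) fun a m => Holds m a (∑ i ∈ s, v i * w i) :=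
  Computes.sum (c := 1) (fun i hi => .mul (.reg (ht i hi)) (.reg (hu i hi))) fun _ _ => le_rfl

theorem Computes.seqTab_vec {N : ℕ} {ord : Equiv.Perm (Fin N)} {f : Fin N → (Fin N → ℕ) → Frag ℕ}
    {c : Fin N → ℕ} {v : Fin N → ℝ}
    (h : ∀ i t m, mem <+: m → (∀ j, ord.symm j < ord.symm i → Holds m (t j) (v j)) →
      (f i t).Computes m (c i) fun a m => Holds m a (v i)) :
    (Frag.seqTab ord f).Computes mem (∑ i, c i) fun t m => HoldsVec m t v :=
  Computes.seqTab (P := fun i a m => Holds m a (v i)) (fun _ _ _ _ hm h => h.mono hm) h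

theorem Computes.tab_vec {N : ℕ} {f : Fin N → Frag ℕ} {c : ℕ} {v : Fin N → ℝ}
    (h : ∀ i m, mem <+: m → (f i).Computes m c fun a m => Holds m a (v i)) :
    (Frag.tab f).Computes mem (N * c) fun t m => HoldsVec m t v :=
  Computes.tab (P := fun i a m => Holds m a (v i)) (fun _ _ _ _ hm h => h.mono hm) h

theorem Computes.tab_mat {M N : ℕ} {f : Fin M → Frag (Fin N → ℕ)} {c : ℕ}
    {X : Matrix (Fin M) (Fin N) ℝ}
    (h : ∀ i m, mem <+: m → (f i).Computes m c fun t m => HoldsVec m t (X i)) :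
    (Frag.tab f).Computes mem (M * c) fun t m => HoldsMat m t X :=
  Computes.tab (P := fun i t m => HoldsVec m t (X i)) (fun _ _ _ _ hm h => h.mono hm) h

end Frag

/-- The registers `t i j`, where `(i, j)` is on the diagonal or a position of the pattern, hold the
entries of `X`. -/
def HoldsPat {N : ℕ} (P : Pattern N) (mem : List ℝ) (t : Fin N → Fin N → ℕ)
    (X : Matrix (Fin N) (Fin N) ℝ) : Prop :=
  ∀ i, ∀ j ∈ insert i (P.lo i), Holds mem (t i j) (X i j)

section HoldsPat

variable {N : ℕ} {P : Pattern N} {mem mem' : List ℝ} {t : Fin N → Fin N → ℕ}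
  {X : Matrix (Fin N) (Fin N) ℝ}

theorem HoldsMat.holdsPat (h : HoldsMat mem t X) : HoldsPat P mem t X := fun i j _ => h i j

theorem HoldsPat.mono (h : HoldsPat P mem t X) (hm : mem <+: mem') : HoldsPat P mem' t X :=
  fun i j hj => (h i j hj).mono hm

theorem HoldsPat.diag (h : HoldsPat P mem t X) (i : Fin N) : Holds mem (t i i) (X i i) :=
  h i i (Finset.mem_insert_self i _)

theorem HoldsPat.of_mem (h : HoldsPat P mem t X) {i j : Fin N} (hj : j ∈ P.lo i) :
    Holds mem (t i j) (X i j) := h i j (Finset.mem_insert_of_mem hj)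

end HoldsPat

namespace Pattern

variable {N : ℕ} {P : Pattern N} {mem : List ℝ} {t : Fin N → Fin N → ℕ}
  {X L : Matrix (Fin N) (Fin N) ℝ}

theorem sum_add_mul_card_up_le (a b : ℕ) :
    ∑ i, (a + b * (P.up i).card) ≤ (a + 4 * b) * N :=
  calc ∑ i, (a + b * (P.up i).card) = N * a + b * ∑ i, (P.up i).card := by
        simp [Finset.sum_add_distrib, Finset.mul_sum]
    _ ≤ N * a + b * (4 * N) := by gcongr; exact sum_card_up_le
    _ = (a + 4 * b) * N := by ring

variable (P) in
/-- Computes the entries on the diagonal and in the pattern. -/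
def buildMat (e : Fin N → Fin N → Expr) : Frag (Fin N → Fin N → ℕ) :=
  Frag.tab fun i => Frag.tabOn (insert i (P.lo i)) fun j => Frag.expr (e i j)

theorem buildMat_computes {e : Fin N → Fin N → Expr} {c : ℕ}
    (h : ∀ i, ∀ j ∈ insert i (P.lo i), (e i j).Denotes mem (X i j))
    (hc : ∀ i j, (e i j).size ≤ c) :
    (P.buildMat e).Computes mem (5 * c * N) fun t m => HoldsPat P m t X := by
  refine (Frag.Computes.tab (c := c * 5)
    (P := fun i (t : Fin N → ℕ) m => ∀ j ∈ insert i (P.lo i), Holds m (t j) (X i j))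
    (fun _ _ _ _ hm h j hj => (h j hj).mono hm) fun i m hm => ?_).mono_cost (by lia)
  refine (Frag.Computes.tabOn (P := fun j a m => Holds m a (X i j))
    (fun _ _ _ _ hm h => h.mono hm) fun j hj m' hm' =>
      .expr_le ((h i j hj).mono (hm.trans hm')) (hc i j)).mono_cost ?_
  exact Nat.mul_le_mul_left _ ((Finset.card_insert_le _ _).trans (Nat.succ_le_succ (P.card_le i)))

variable (P) in
/-- Computes row `i` of the reverse Cholesky factor of the matrix in the registers `t`, given the
later rows in the registers `T` and a zero in register `z`. -/
def cholRow (t : Fin N → Fin N → ℕ) (z : ℕ) (i : Fin N) (T : Fin N → Fin N → ℕ) :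
    Frag (Fin N → ℕ) := do
  let s ← Frag.dot (P.up i) (fun k => T k i) fun k => T k i
  let d ← Frag.expr (.un .sqrt (.reg (t i i) - .reg s))
  let r ← Frag.tabOn (P.lo i) fun j => do
    let s ← Frag.dot (P.up i) (fun k => T k i) fun k => T k j
    Frag.expr ((.reg (t i j) - .reg s) / .reg d)
  pure fun j => if j = i then d else if j ∈ P.lo i then r j else z

theorem cholRow_computes {T : Fin N → Fin N → ℕ} {z : ℕ} {i : Fin N} (ht : HoldsPat P mem t X)
    (hz : Holds mem z 0) (hT : ∀ k ∈ P.up i, HoldsVec mem (T k) (P.cholRec X k)) :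
    (P.cholRow t z i T).Computes mem (15 + 10 * (P.up i).card)
      fun r m => HoldsVec m r (P.cholRec X i) := by
  refine ((Frag.Computes.dot (fun k hk => hT k hk i) fun k hk => hT k hk i).bind
    (c₂ := 2 + 4 * (3 + 2 * (P.up i).card)) fun s m₁ hm₁ hs =>
      (Frag.Computes.expr_le (.sqrt (.sub (.reg ((ht.diag i).mono hm₁)) (.reg hs))) le_rfl).bind
        fun d m₂ hm₂ hd => ?_).mono_cost (by lia)
  rw [← cholRec_diag] at hd
  refine ((Frag.Computes.tabOn (s := P.lo i) (c := 3 + 2 * (P.up i).card)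
    (P := fun j a m => j ∈ P.lo i → Holds m a (P.cholRec X i j))
    (fun _ _ _ _ hm h hj => (h hj).mono hm) fun j hj m₃ hm₃ => ?_).bind
      fun r m₃ hm₃ hr =>
        .pure (P := fun r m => HoldsVec m r (P.cholRec X i)) fun j => ?_).mono_cost ?_
  · have hm := hm₁.trans (hm₂.trans hm₃)
    refine ((Frag.Computes.dot (fun k hk => (hT k hk i).mono hm) fun k hk =>
      (hT k hk j).mono hm).bind (c₂ := 2) fun s m₄ hm₄ hs => .expr_le
        ((Expr.Denotes.div (.sub (.reg ((ht.of_mem hj).mono (hm.trans hm₄))) (.reg hs))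
          (.reg (hd.mono (hm₃.trans hm₄)))).congr (cholRec_of_mem hj).symm)
            le_rfl).mono (by lia) fun a m _ ha _ => ha
  · split_ifs with hji hj
    · exact hji ▸ hd.mono hm₃
    · exact hr j hj hj
    · rw [cholRec_eq_zero hji hj]
      exact hz.mono (hm₁.trans (hm₂.trans hm₃))
  · rw [add_zero, mul_comm]
    exact Nat.mul_le_mul_right _ (P.card_le i)

variable (P) in
/-- Computes the reverse Cholesky factor of the matrix in the registers `t`. -/
def chol (t : Fin N → Fin N → ℕ) : Frag (Fin N → Fin N → ℕ) := do
  let z ← Frag.const 0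
  Frag.seqTab Fin.revPerm (P.cholRow t z)

theorem chol_computes (h : HoldsPat P mem t X) :
    (P.chol t).Computes mem (55 * N + 1) fun T m => HoldsMat m T (Matrix.of (P.cholRec X)) := by
  refine ((Frag.Computes.const 0).bind fun z m hm hz => Frag.Computes.seqTab
    (P := fun i t m => HoldsVec m t (P.cholRec X i)) (fun _ _ _ _ hm h => h.mono hm)
    fun i T m' hm' hT => cholRow_computes (h.mono (hm.trans hm'))
      (by simpa using hz.mono hm') fun k hk => hT k ?_).mono_cost ?_
  · simpa [Fin.revPerm] using lt_of_mem_up hk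
  · have := sum_add_mul_card_up_le (P := P) 15 10
    lia

theorem Conforms.transpose_mulVec_apply (hX : P.Conforms X) (hL : IsRevCholesky X L)
    (w : Fin N → ℝ) (j : Fin N) :
    L.transpose.mulVec w j = L j j * w j + ∑ i ∈ P.up j, L i j * w i := by
  simp only [Matrix.mulVec, dotProduct, Matrix.transpose_apply]
  refine sum_eq_add_sum_up fun i hij hi => ?_
  rw [hX.revCholesky_apply_eq_zero hL hij.symm fun hj => hi (mem_up.2 hj), zero_mul]

theorem Conforms.revCholesky_mulVec_apply (hX : P.Conforms X) (hL : IsRevCholesky X L)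
    (x : Fin N → ℝ) (i : Fin N) :
    L.mulVec x i = L i i * x i + ∑ j ∈ P.lo i, L i j * x j := by
  simp only [Matrix.mulVec, dotProduct]
  exact sum_eq_add_sum_lo fun j hji hj => by
    rw [hX.revCholesky_apply_eq_zero hL hji hj, zero_mul]

variable (P) in
/-- Solves `Lᵀ w = f`. -/
def solveTranspose (T : Fin N → Fin N → ℕ) (f : Fin N → ℕ) : Frag (Fin N → ℕ) :=
  Frag.seqTab Fin.revPerm fun j w => do
    let s ← Frag.dot (P.up j) (fun i => T i j) w
    Frag.expr ((.reg (f j) - .reg s) / .reg (T j j))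

variable (P) in
/-- Solves `L x = f`. -/
def solveLower (T : Fin N → Fin N → ℕ) (f : Fin N → ℕ) : Frag (Fin N → ℕ) :=
  Frag.seqTab (Equiv.refl _) fun i x => do
    let s ← Frag.dot (P.lo i) (T i) x
    Frag.expr ((.reg (f i) - .reg s) / .reg (T i i))

variable (P) in
/-- Solves `Lᵀ L x = f`. -/
def solveVec (T : Fin N → Fin N → ℕ) (f : Fin N → ℕ) : Frag (Fin N → ℕ) := do
  let w ← P.solveTranspose T f
  P.solveLower T w

section Solve

variable {T : Fin N → Fin N → ℕ} {f : Fin N → ℕ} {v w x : Fin N → ℝ}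

theorem solveTranspose_computes (hX : P.Conforms X) (hL : IsRevCholesky X L)
    (hT : HoldsMat mem T L) (hf : HoldsVec mem f (L.transpose.mulVec w)) :
    (P.solveTranspose T f).Computes mem (11 * N) fun t m => HoldsVec m t w := by
  refine (Frag.Computes.seqTab_vec (c := fun j => 3 + 2 * (P.up j).card)
    fun j t m hm ht => ?_).mono_cost (sum_add_mul_card_up_le 3 2)
  have h_later : ∀ i ∈ P.up j, Holds m (t i) (w i) := fun i hi =>
    ht i (by simpa [Fin.revPerm] using lt_of_mem_up hi)
  have h_eq : (L.transpose.mulVec w j - ∑ i ∈ P.up j, L i j * w i) / L j j = w j := by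
    rw [hX.transpose_mulVec_apply hL, add_sub_cancel_right,
      mul_div_cancel_left₀ _ (hL.2.1 j).ne']
  exact ((Frag.Computes.dot (fun i _ => (hT i j).mono hm) h_later).bind (c₂ := 2)
    fun s m₁ hm₁ hs => .expr_le ((Expr.Denotes.div (.sub (.reg ((hf j).mono (hm.trans hm₁)))
      (.reg hs)) (.reg ((hT j j).mono (hm.trans hm₁)))).congr h_eq) le_rfl).mono_cost (by lia)

theorem solveLower_computes (hX : P.Conforms X) (hL : IsRevCholesky X L)
    (hT : HoldsMat mem T L) (hf : HoldsVec mem f (L.mulVec x)) :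
    (P.solveLower T f).Computes mem (11 * N) fun t m => HoldsVec m t x := by
  refine (Frag.Computes.seqTab_vec (c := fun _ => 11) fun i t m hm ht => ?_).mono_cost
    (by simp [mul_comm])
  have h_earlier : ∀ j ∈ P.lo i, Holds m (t j) (x j) := fun j hj => ht j (P.lt_of_mem hj)
  have h_eq : (L.mulVec x i - ∑ j ∈ P.lo i, L i j * x j) / L i i = x i := by
    rw [hX.revCholesky_mulVec_apply hL, add_sub_cancel_right,
      mul_div_cancel_left₀ _ (hL.2.1 i).ne']
  refine ((Frag.Computes.dot (fun j _ => (hT i j).mono hm) h_earlier).bind (c₂ := 2)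
    fun s m₁ hm₁ hs => .expr_le ((Expr.Denotes.div (.sub (.reg ((hf i).mono (hm.trans hm₁)))
      (.reg hs)) (.reg ((hT i i).mono (hm.trans hm₁)))).congr h_eq) le_rfl).mono_cost ?_
  have := P.card_le i
  lia

theorem solveVec_computes (hX : P.Conforms X) (hL : IsRevCholesky X L)
    (hT : HoldsMat mem T L) (hf : HoldsVec mem f v) :
    (P.solveVec T f).Computes mem (22 * N) fun t m => HoldsVec m t (X⁻¹.mulVec v) := by
  have h_unit : IsUnit X.det := (Matrix.isUnit_iff_isUnit_det _).1 hL.posDef.isUnit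
  have h_rhs : L.transpose.mulVec (L.mulVec (X⁻¹.mulVec v)) = v := by
    rw [Matrix.mulVec_mulVec, ← hL.2.2, Matrix.mulVec_mulVec, Matrix.mul_nonsing_inv _ h_unit,
      Matrix.one_mulVec]
  exact ((solveTranspose_computes hX hL hT (h_rhs.symm ▸ hf)).bind fun w m hm hw =>
    solveLower_computes hX hL (hT.mono hm) hw).mono_cost (by lia)

end Solve

variable (P) in
/-- Computes `f - X w`, with `X` in the registers `t`. -/
def residual (t : Fin N → Fin N → ℕ) (f w : Fin N → ℕ) : Frag (Fin N → ℕ) :=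
  Frag.seqTab (Equiv.refl _) fun i _ => do
    let s₁ ← Frag.dot (P.lo i) (t i) w
    let s₂ ← Frag.dot (P.up i) (fun k => t k i) w
    Frag.expr (.reg (f i) - (.reg (t i i) * .reg (w i) + (.reg s₁ + .reg s₂)))

theorem residual_computes {f w : Fin N → ℕ} {v u : Fin N → ℝ} (hX : P.Conforms X)
    (ht : HoldsPat P mem t X) (hf : HoldsVec mem f v) (hw : HoldsVec mem w u) :
    (P.residual t f w).Computes mem (22 * N) fun r m => HoldsVec m r (v - X.mulVec u) := by
  refine (Frag.Computes.seqTab_vec (c := fun i => 14 + 2 * (P.up i).card)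
    fun i r m hm _ => ?_).mono_cost (sum_add_mul_card_up_le 14 2)
  rw [Pi.sub_apply, hX.mulVec_apply]
  refine ((Frag.Computes.dot (fun k hk => (ht.of_mem hk).mono hm) fun k _ => (hw k).mono hm).bind
    fun s₁ m₁ hm₁ hs₁ => (Frag.Computes.dot
      (fun k hk => (ht.of_mem (mem_up.1 hk)).mono (hm.trans hm₁))
      fun k _ => (hw k).mono (hm.trans hm₁)).bind (c₂ := 4) fun s₂ m₂ hm₂ hs₂ => ?_).mono_cost ?_
  · have hm' := hm.trans (hm₁.trans hm₂)
    exact .expr_le (.sub (.reg ((hf i).mono hm')) (.add (.mul (.reg ((ht.diag i).mono hm'))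
      (.reg ((hw i).mono hm'))) (.add (.reg (hs₁.mono hm₂)) (.reg hs₂)))) le_rfl
  · have := P.card_le i
    lia

end Pattern

/-! ### Input and output layout -/

theorem getElem?_flatten_ofFn {m n : ℕ} (f : Fin m → List ℝ) (hf : ∀ i, (f i).length = n)
    (i : Fin m) {j : ℕ} (hj : j < n) :
    (List.ofFn f).flatten[(i : ℕ) * n + j]? = (f i)[j]? := by
  induction m with
  | zero => exact i.elim0
  | succ m ih =>
    rw [List.ofFn_succ, List.flatten_cons]
    induction i using Fin.cases with
    | zero => simp [List.getElem?_append_left, hf, hj]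
    | succ i =>
      have h_index : ((i.succ : Fin (m + 1)) : ℕ) * n + j = n + ((i : ℕ) * n + j) := by
        rw [Fin.val_succ]
        ring
      rw [h_index, List.getElem?_append_right (by simp [hf]), hf, Nat.add_sub_cancel_left,
        ih (fun i => f i.succ) (fun i => hf _) i]

theorem length_flatten_ofFn {m n : ℕ} (f : Fin m → List ℝ) (hf : ∀ i, (f i).length = n) :
    (List.ofFn f).flatten.length = m * n := by
  simp [List.length_flatten, List.map_ofFn, List.sum_ofFn, hf]

theorem length_matList {M N : ℕ} (X : Matrix (Fin M) (Fin N) ℝ) : (matList X).length = M * N :=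
  length_flatten_ofFn _ fun i => by simp

theorem getElem?_matList {M N : ℕ} (X : Matrix (Fin M) (Fin N) ℝ) (i : Fin M) (j : Fin N) :
    (matList X)[(i : ℕ) * N + j]? = some (X i j) := by
  rw [matList, getElem?_flatten_ofFn _ (fun i => by simp) i j.2]
  simp

theorem Holds.append_right {mem l : List ℝ} {i o : ℕ} {v : ℝ} (h : Holds mem i v)
    (ho : o = l.length + i) : Holds (l ++ mem) o v := by
  unfold Holds at *
  rw [ho, List.getElem?_append_right (by lia), Nat.add_sub_cancel_left, h]

/-- The address of the entry `(i, j)` of a matrix with `N` columns that is stored row by row,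
starting at `o`. -/
def matAddr {M N : ℕ} (o : ℕ) (i : Fin M) (j : Fin N) : ℕ := o + ((i : ℕ) * N + j)

theorem holdsMat_matList {M N o : ℕ} (l : List ℝ) (X : Matrix (Fin M) (Fin N) ℝ)
    (ho : o = l.length) : HoldsMat (l ++ matList X) (matAddr o) X := fun i j =>
  Holds.append_right (getElem?_matList X i j) (by rw [ho, matAddr])

/-- The addresses of the entries of a matrix, row by row. -/
def addrList {M N : ℕ} (t : Fin M → Fin N → ℕ) : List ℕ :=
  (List.ofFn fun i => List.ofFn (t i)).flatten

theorem HoldsVec.map_ofFn {N : ℕ} {mem : List ℝ} {t : Fin N → ℕ} {v : Fin N → ℝ}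
    (h : HoldsVec mem t v) : (List.ofFn t).map (reg mem) = List.ofFn v := by
  rw [List.map_ofFn]
  exact congrArg List.ofFn (funext fun i => (h i).reg_eq)

theorem map_flatten_ofFn {J : ℕ} {mem : List ℝ} {f : Fin J → List ℕ} {g : Fin J → List ℝ}
    (h : ∀ j, (f j).map (reg mem) = g j) :
    (List.ofFn f).flatten.map (reg mem) = (List.ofFn g).flatten := by
  rw [List.map_flatten, List.map_ofFn]
  exact congrArg (fun l => (List.ofFn l).flatten) (funext h)

theorem HoldsMat.map_addrList {M N : ℕ} {mem : List ℝ} {t : Fin M → Fin N → ℕ}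
    {X : Matrix (Fin M) (Fin N) ℝ} (h : HoldsMat mem t X) :
    (addrList t).map (reg mem) = matList X :=
  map_flatten_ofFn fun i => HoldsVec.map_ofFn (h i)

/-! ### Bounding the largest generalised eigenvalue -/

theorem two_mul_mul_inv_pow_le_one (N : ℕ) {D : ℕ} (hD : 0 < D) :
    2 * (N : ℝ) * ((D : ℝ) / (D + 1)) ^ (2 * N * D) ≤ 1 := by
  have h_bernoulli : 1 + ((2 * N * D : ℕ) : ℝ) * (1 / D) ≤ (1 + 1 / (D : ℝ)) ^ (2 * N * D) :=
    one_add_mul_le_pow (le_trans (by norm_num) (by positivity : (0 : ℝ) ≤ 1 / D)) _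
  have h_exponent : ((2 * N * D : ℕ) : ℝ) * (1 / D) = 2 * N := by
    push_cast
    field_simp
  have h_base : (D : ℝ) / (D + 1) = (1 + 1 / (D : ℝ))⁻¹ := by field_simp
  rw [h_base, inv_pow, ← div_eq_mul_inv, div_le_one (by positivity)]
  linarith

namespace Pattern

variable {N : ℕ} {P : Pattern N} {X Y : Matrix (Fin N) (Fin N) ℝ} {tX tY : Fin N → Fin N → ℕ}
  {mem : List ℝ}

variable (P) in
/-- Multiplies the value of register `t` by that of register `r`, at most `k` times, as long as the
matrix `t Y - X` remains positive definite. Register `z` holds zero. -/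
def search (X Y : Fin N → Fin N → ℕ) (z r : ℕ) : ℕ → ℕ → Frag ℕ
  | 0, t => pure t
  | k + 1, t => do
    let t' ← Frag.bin .mul t r
    let T ← P.buildMat fun i j => .reg t' * .reg (Y i j) - .reg (X i j)
    let L ← P.chol T
    let d ← Frag.prod Finset.univ fun i => L i i
    Frag.ifLt z d (search X Y z r k t') (pure t)

theorem search_computes (hX : P.Conforms X) (hY : P.Conforms Y) (hYp : Y.PosDef) {lam q : ℝ}
    (hlam : IsGreatest (genSpectrum X Y) lam) {z r : ℕ} (k : ℕ) :
    ∀ {mem : List ℝ} {t : ℕ} {v : ℝ}, HoldsMat mem tX X → HoldsMat mem tY Y → Holds mem z 0 →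
    Holds mem r q → Holds mem t v → lam < v → v * q ^ k ≤ lam →
    (P.search tX tY z r k t).Computes mem ((66 * N + 4) * k)
      fun a m => ∃ v, Holds m a v ∧ lam < v ∧ v * q ≤ lam := by
  induction k with
  | zero =>
    intro mem t v _ _ _ _ _ hlt hle
    exact absurd hlt (by simpa using hle)
  | succ k ih =>
    intro mem t v htX htY hz hr ht hlt hle
    have h_test : 0 < ∏ i, P.cholRec ((v * q) • Y - X) i i ↔ lam < v * q := by
      rw [← ((hY.smul _).sub hX).posDef_iff, posDef_smul_sub_iff hX.1 hYp, ← hlam.lt_iff]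
    refine ((Frag.Computes.bin .mul ht hr).bind fun t' m₁ hm₁ ht' =>
      (buildMat_computes (P := P) (X := (v * q) • Y - X) (c := 2) (fun i j _ =>
        .sub (.mul (.reg ht') (.reg ((htY i j).mono hm₁))) (.reg ((htX i j).mono hm₁)))
        fun _ _ => le_rfl).bind fun T m₂ hm₂ hT => (chol_computes hT).bind fun L m₃ hm₃ hL =>
      (Frag.Computes.prod (s := Finset.univ) fun i _ => hL i i).bind
        fun d m₄ hm₄ hd => ?_).mono_cost
        (c₁ := 1 + (5 * 2 * N + (55 * N + 1 + (1 + (Finset.univ : Finset (Fin N)).card +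
          ((66 * N + 4) * k + 1))))) ?_
    · have hm := hm₁.trans (hm₂.trans (hm₃.trans hm₄))
      refine Frag.Computes.ifLt (hz.mono hm) hd (fun hpos => ?_) fun hneg => ?_
      · exact ih (htX.mono hm) (htY.mono hm) (hz.mono hm) (hr.mono hm)
          (ht'.mono (hm₂.trans (hm₃.trans hm₄))) (h_test.1 hpos)
          (by simpa only [BinOp.eval, mul_assoc, ← pow_succ'] using hle)
      · exact (Frag.Computes.pure (P := fun a m => ∃ v, Holds m a v ∧ lam < v ∧ v * q ≤ lam)
          ⟨v, ht.mono hm, hlt, not_lt.1 fun h => hneg (h_test.2 h)⟩).mono_cost (Nat.zero_le _)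
    · rw [Finset.card_univ, Fintype.card_fin]
      lia

variable (P) in
/-- Computes the trace of `Y⁻¹ X` for symmetric `X` and positive definite `Y`. -/
def traceInvMul (X Y : Fin N → Fin N → ℕ) : Frag ℕ := do
  let L ← P.chol Y
  let x ← Frag.tab fun i => P.solveVec L (X i)
  Frag.sum Finset.univ fun i => .reg (x i i)

theorem traceInvMul_computes (hN : 0 < N) (hX : X.IsSymm) (hY : P.Conforms Y) (hYp : Y.PosDef)
    (htX : HoldsMat mem tX X) (htY : HoldsMat mem tY Y) :
    (P.traceInvMul tX tY).Computes mem (80 * N ^ 2) fun a m => Holds m a (Y⁻¹ * X).trace := by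
  have h_trace : ∑ i, Y⁻¹.mulVec (X i) i = (Y⁻¹ * X).trace := by
    simp only [Matrix.trace, Matrix.diag, Matrix.mul_apply, Matrix.mulVec, dotProduct]
    exact Finset.sum_congr rfl fun i _ => Finset.sum_congr rfl fun k _ => by rw [hX.apply]
  rw [← h_trace]
  refine ((chol_computes htY.holdsPat).bind fun L m₁ hm₁ hL =>
    (Frag.Computes.tab_mat (X := Matrix.of fun i => Y⁻¹.mulVec (X i)) fun i m hm =>
      solveVec_computes hY (hY.isRevCholesky_cholRec_of_posDef hYp) (hL.mono hm)
        ((htX.mono (hm₁.trans hm)) i)).bind fun x m₂ _ hx =>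
    Frag.Computes.sum (c := 0) (fun i _ => .reg (hx i i)) fun _ _ => le_rfl).mono_cost ?_
  rw [Finset.card_univ, Fintype.card_fin]
  nlinarith

variable (P) in
/-- An upper bound of the largest generalised eigenvalue of a definite pencil with relative
accuracy `1 / D`. -/
def lamMax (D : ℕ) (X Y : Fin N → Fin N → ℕ) : Frag ℕ := do
  let s ← P.traceInvMul X Y
  let t ← Frag.expr (.reg s + .reg s)
  let r ← Frag.const (D / (D + 1))
  let z ← Frag.const 0
  P.search X Y z r (2 * N * D) t

theorem lamMax_computes (hN : 0 < N) (hX : P.Conforms X) (hY : P.Conforms Y) (hXp : X.PosDef)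
    (hYp : Y.PosDef) {D : ℕ} (hD : 0 < D) (htX : HoldsMat mem tX X) (htY : HoldsMat mem tY Y) :
    (P.lamMax D tX tY).Computes mem ((84 + 140 * D) * N ^ 2) fun a m => ∃ v, Holds m a v ∧
      ∃ lam, IsGreatest (genSpectrum X Y) lam ∧ lam < v ∧ v ≤ (1 + 1 / (D : ℝ)) * lam := by
  obtain ⟨lam, hlam, h_le_trace, h_trace_le⟩ := exists_isGreatest_genSpectrum hN hXp.posSemidef hYp
  have hpos := pos_of_mem_genSpectrum hXp hYp hlam.1
  set q : ℝ := (D : ℝ) / (D + 1) with hq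
  have h_steps : ((Y⁻¹ * X).trace + (Y⁻¹ * X).trace) * q ^ (2 * N * D) ≤ lam :=
    calc _ = 2 * (Y⁻¹ * X).trace * q ^ (2 * N * D) := by ring
      _ ≤ 2 * (N * lam) * q ^ (2 * N * D) := by gcongr
      _ = lam * (2 * N * q ^ (2 * N * D)) := by ring
      _ ≤ lam := mul_le_of_le_one_right hpos.le (two_mul_mul_inv_pow_le_one N hD)
  refine ((traceInvMul_computes hN hX.1 hY hYp htX htY).bind fun s m₁ hm₁ hs =>
    (Frag.Computes.expr_le (c := 1) (.add (.reg hs) (.reg hs)) le_rfl).bind fun t m₂ hm₂ ht =>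
    (Frag.Computes.const (D / (D + 1))).bind fun r m₃ hm₃ hr =>
    (Frag.Computes.const 0).bind fun z m₄ hm₄ hz => ?_).mono
    (c₁ := 80 * N ^ 2 + (1 + (1 + (1 + (66 * N + 4) * (2 * N * D)))))
    (P' := fun a m => ∃ v, Holds m a v ∧ lam < v ∧ v * q ≤ lam) ?_ ?_
  · have hm := hm₁.trans (hm₂.trans (hm₃.trans hm₄))
    exact search_computes hX hY hYp hlam _ (htX.mono hm) (htY.mono hm) (by simpa using hz)
      (by simpa [hq] using hr.mono hm₄) (ht.mono (hm₃.trans hm₄)) (by linarith) h_steps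
  · have hND : N * D ≤ N ^ 2 * D := Nat.mul_le_mul_right _ (Nat.le_self_pow two_ne_zero N)
    nlinarith
  · rintro a m _ ⟨v, hv, hlt, hle⟩
    refine ⟨v, hv, lam, hlam, hlt, ?_⟩
    rw [hq, mul_div_assoc', div_le_iff₀ (by positivity)] at hle
    have h_factor : (1 + 1 / (D : ℝ)) * lam = lam * (D + 1) / D := by field_simp
    rwa [h_factor, le_div_iff₀ (by exact_mod_cast hD)]

end Pattern

/-! ### Enclosing the spectrum of a definite pencil -/

section Enclosure

variable {N : ℕ} {X Y : Matrix (Fin N) (Fin N) ℝ} {δ a b : ℝ}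

theorem IsEnclosure.pos (hX : X.PosDef) (hY : Y.PosDef) (hδ : δ < 1)
    (h : IsEnclosure δ (genSpectrum X Y) a b) : 0 < a := by
  obtain ⟨-, -, ⟨s, hs, hsa⟩, -⟩ := h
  have hs_pos := pos_of_mem_genSpectrum hX hY hs
  rw [abs_of_pos hs_pos] at hsa
  have := neg_abs_le (a - s)
  nlinarith

theorem IsEnclosure.neg (h : IsEnclosure δ (genSpectrum X Y) a b) :
    IsEnclosure δ (genSpectrum (-X) Y) (-b) (-a) := by
  obtain ⟨hab, h_subset, ⟨s, hs, hsa⟩, ⟨t, ht, htb⟩⟩ := h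
  refine ⟨neg_lt_neg hab, fun μ hμ => ?_, ⟨-t, neg_mem_genSpectrum_neg.2 ht, ?_⟩,
    ⟨-s, neg_mem_genSpectrum_neg.2 hs, ?_⟩⟩
  · have := h_subset (neg_mem_genSpectrum_neg.1 (by simpa using hμ : -(-μ) ∈ genSpectrum (-X) Y))
    exact ⟨by linarith [this.2], by linarith [this.1]⟩
  · rwa [← neg_add', abs_neg, abs_neg, ← sub_eq_add_neg]
  · rwa [← neg_add', abs_neg, abs_neg, ← sub_eq_add_neg]

theorem IsEnclosure.of_neg (h : IsEnclosure δ (genSpectrum (-X) Y) a b) :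
    IsEnclosure δ (genSpectrum X Y) (-b) (-a) := by
  simpa using h.neg

theorem isEnclosure_of_isGreatest (hX : X.PosDef) (hY : Y.PosDef) {κ lam μ v w : ℝ}
    (hκδ : κ ≤ δ) (hlam : IsGreatest (genSpectrum X Y) lam) (hv : lam < v)
    (hvκ : v ≤ (1 + κ) * lam) (hμ : IsGreatest (genSpectrum Y X) μ) (hw : μ < w)
    (hwκ : w ≤ (1 + κ) * μ) : IsEnclosure δ (genSpectrum X Y) (1 / w) v := by
  have hlam_pos := pos_of_mem_genSpectrum hX hY hlam.1
  have hμ_pos := pos_of_mem_genSpectrum hY hX hμ.1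
  have hw_pos : 0 < w := hμ_pos.trans hw
  have hκ : 0 < κ := pos_of_mul_pos_left (by linarith : 0 < κ * lam) hlam_pos.le
  have hμ_inv : μ⁻¹ ∈ genSpectrum X Y := (inv_mem_genSpectrum hμ_pos.ne').2 hμ.1
  rw [one_div]
  have hwμ : w⁻¹ < μ⁻¹ := inv_strictAnti₀ hμ_pos hw
  refine ⟨(hwμ.trans_le (hlam.2 hμ_inv)).trans hv, fun s hs => ⟨?_, (hlam.2 hs).trans hv.le⟩,
    ⟨μ⁻¹, hμ_inv, ?_⟩, ⟨lam, hlam.1, ?_⟩⟩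
  · have hs_pos := pos_of_mem_genSpectrum hX hY hs
    exact inv_le_of_inv_le₀ hs_pos ((hμ.2 ((inv_mem_genSpectrum hs_pos.ne').2 hs)).trans hw.le)
  · rw [abs_of_neg (sub_neg.2 hwμ), abs_of_pos (inv_pos.2 hμ_pos), neg_sub]
    have h_relative : μ⁻¹ - w⁻¹ = (w - μ) / w * μ⁻¹ := by field_simp
    rw [h_relative]
    refine mul_le_mul_of_nonneg_right ?_ (inv_pos.2 hμ_pos).le
    rw [div_le_iff₀ hw_pos]
    linarith [mul_le_mul hκδ hw.le hμ_pos.le (hκ.le.trans hκδ)]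
  · rw [abs_of_pos (sub_pos.2 hv), abs_of_pos hlam_pos]
    nlinarith

end Enclosure

namespace Pattern

variable {N : ℕ} {P : Pattern N} {X Y : Matrix (Fin N) (Fin N) ℝ} {tX tY : Fin N → Fin N → ℕ}
  {mem : List ℝ}

variable (P) in
/-- Encloses the spectrum of a definite pencil with relative accuracy `1 / D`; the smallest
eigenvalue of the pencil `(X, Y)` is the inverse of the largest one of `(Y, X)`. -/
def enclose (D : ℕ) (X Y : Fin N → Fin N → ℕ) : Frag (ℕ × ℕ) := do
  let v ← P.lamMax D X Y
  let w ← P.lamMax D Y X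
  let a ← Frag.expr (.const 1 / .reg w)
  pure (a, v)

theorem enclose_computes (hN : 0 < N) (hX : P.Conforms X) (hY : P.Conforms Y) (hXp : X.PosDef)
    (hYp : Y.PosDef) {D : ℕ} (hD : 0 < D) {δ : ℝ} (hδ : 1 / (D : ℝ) ≤ δ)
    (htX : HoldsMat mem tX X) (htY : HoldsMat mem tY Y) :
    (P.enclose D tX tY).Computes mem ((170 + 280 * D) * N ^ 2) fun t m =>
      ∃ a b, Holds m t.1 a ∧ Holds m t.2 b ∧ IsEnclosure δ (genSpectrum X Y) a b := by
  refine ((lamMax_computes hN hX hY hXp hYp hD htX htY).bind fun v m₁ hm₁ hv =>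
    (lamMax_computes hN hY hX hYp hXp hD (htY.mono hm₁) (htX.mono hm₁)).bind (c₂ := 2)
    fun w m₂ hm₂ hw => ?_).mono_cost (by nlinarith)
  obtain ⟨v', hv', lam, hlam, hlt_v, hv_le⟩ := hv
  obtain ⟨w', hw', μ, hμ, hlt_w, hw_le⟩ := hw
  exact (Frag.Computes.expr_le (.div (.const 1) (.reg hw')) le_rfl).bind
    fun a m₃ hm₃ ha => .pure ⟨1 / w', v', by simpa using ha, hv'.mono (hm₂.trans hm₃),
      isEnclosure_of_isGreatest hXp hYp hδ hlam hlt_v hv_le hμ hlt_w hw_le⟩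

end Pattern

/-- Negates a matrix. -/
def negMat {M N : ℕ} (t : Fin M → Fin N → ℕ) : Frag (Fin M → Fin N → ℕ) :=
  Frag.tab fun i => Frag.tab fun j => Frag.expr (.neg (.reg (t i j)))

theorem negMat_computes {M N : ℕ} {mem : List ℝ} {t : Fin M → Fin N → ℕ}
    {X : Matrix (Fin M) (Fin N) ℝ} (h : HoldsMat mem t X) :
    (negMat t).Computes mem (M * (N * 2)) fun t m => HoldsMat m t (-X) :=
  Frag.Computes.tab_mat fun i _ hm => Frag.Computes.tab_vec (v := (-X) i) fun j _ hm' =>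
    .expr_le (Expr.Denotes.neg (.reg ((h i j).mono (hm.trans hm')))) le_rfl

/-! ### The shift parameters -/

section Shifts

variable {a b c d : ℝ}

theorem adiGamma_eq (ha : 0 < a) (hab : a < b) (hcd : c < d) (hd : d < 0) :
    adiGamma a b c d = (a - c) * (b - d) / ((b - c) * (a - d)) := by
  rw [adiGamma, abs_of_neg (by linarith : c - a < 0), abs_of_neg (by linarith : d - b < 0),
    abs_of_neg (by linarith : c - b < 0), abs_of_neg (by linarith : d - a < 0)]
  ring

theorem adiGamma_sub_one (ha : 0 < a) (hab : a < b) (hcd : c < d) (hd : d < 0) :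
    adiGamma a b c d - 1 = (b - a) * (d - c) / ((b - c) * (a - d)) := by
  have hbc : 0 < b - c := by linarith
  have had : 0 < a - d := by linarith
  rw [adiGamma_eq ha hab hcd hd]
  field_simp
  ring

theorem one_lt_adiGamma (ha : 0 < a) (hab : a < b) (hcd : c < d) (hd : d < 0) :
    1 < adiGamma a b c d := by
  rw [← sub_pos, adiGamma_sub_one ha hab hcd hd]
  exact div_pos (mul_pos (by linarith) (by linarith)) (mul_pos (by linarith) (by linarith))

theorem adiGamma_le (ha : 0 < a) (hab : a < b) (hcd : c < d) (hd : d < 0) :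
    adiGamma a b c d ≤ b / a := by
  have hbc : 0 < b - c := by linarith
  have had : 0 < a - d := by linarith
  rw [adiGamma_eq ha hab hcd hd, mul_div_mul_comm]
  calc (a - c) / (b - c) * ((b - d) / (a - d)) ≤ 1 * (b / a) := by
        refine mul_le_mul ((div_le_one hbc).2 (by linarith)) ?_
          (div_nonneg (by linarith) had.le) zero_le_one
        rw [div_le_div_iff₀ had ha]
        nlinarith
    _ = b / a := one_mul _

theorem one_lt_adiAlpha (h : 1 < adiGamma a b c d) : 1 < adiAlpha a b c d := by
  have := Real.sqrt_nonneg (adiGamma a b c d ^ 2 - adiGamma a b c d)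
  rw [adiAlpha]
  linarith

theorem adiAlpha_sub_one_sq (h : 1 < adiGamma a b c d) :
    (adiAlpha a b c d - 1) ^ 2 = 4 * adiAlpha a b c d * (adiGamma a b c d - 1) := by
  have h_sqrt := Real.sq_sqrt (by nlinarith : 0 ≤ adiGamma a b c d ^ 2 - adiGamma a b c d)
  rw [adiAlpha]
  linear_combination 4 * h_sqrt

theorem adiAlpha_mul_adiDn_mem_Icc (h : 1 < adiAlpha a b c d) (J i : ℕ) :
    adiAlpha a b c d * adiDn a b c d J i ∈ Set.Icc 1 (adiAlpha a b c d) := by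
  have hα : 0 < adiAlpha a b c d := by linarith
  rw [adiDn, jacobiDn]
  set k := adiModulus a b c d
  set s := Real.sin (jacobiAm ((2 * (i : ℝ) + 1) / (2 * (J : ℝ)) * ellK k) k)
  have hs : s ^ 2 ≤ 1 := Real.sin_sq_le_one _
  have hk : k ^ 2 = 1 - 1 / adiAlpha a b c d ^ 2 :=
    Real.sq_sqrt (sub_nonneg.2 ((div_le_one (by positivity)).2 (by nlinarith)))
  constructor
  · rw [← div_le_iff₀' hα]
    refine Real.le_sqrt_of_sq_le ?_
    rw [div_pow, one_pow]
    nlinarith [sq_nonneg k, sq_nonneg s]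
  · refine mul_le_of_le_one_right hα.le (Real.sqrt_le_iff.2 ⟨zero_le_one, ?_⟩)
    nlinarith [mul_nonneg (sq_nonneg k) (sq_nonneg s)]

theorem affine_neg_of_mem_Icc {u v x y z : ℝ} (hx : u * x + v < 0) (hy : u * y + v < 0)
    (hz : z ∈ Set.Icc x y) : u * z + v < 0 := by
  rcases le_total 0 u with hu | hu
  · linarith [mul_le_mul_of_nonneg_left hz.2 hu]
  · linarith [mul_le_mul_of_nonpos_left hz.1 hu]

theorem adiMobius_num_adiAlpha_neg (ha : 0 < a) (hab : a < b) (hcd : c < d) (hd : d < 0) :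
    a * ((adiAlpha a b c d - 1) ^ 2 * (b - c)) +
      c * (2 * (adiAlpha a b c d + adiAlpha a b c d) * (b - a)) < 0 := by
  have hγ := one_lt_adiGamma ha hab hcd hd
  have hα := one_lt_adiAlpha hγ
  have hba : 0 < b - a := by linarith
  have hbc : 0 < b - c := by linarith
  have had : 0 < a - d := by linarith
  rw [adiAlpha_sub_one_sq hγ, adiGamma_sub_one ha hab hcd hd]
  have h_eq : a * (4 * adiAlpha a b c d * ((b - a) * (d - c) / ((b - c) * (a - d))) * (b - c)) +
      c * (2 * (adiAlpha a b c d + adiAlpha a b c d) * (b - a)) =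
        4 * adiAlpha a b c d * (b - a) * (d * (a - c)) / (a - d) := by
    field_simp
    ring
  rw [h_eq]
  exact div_neg_of_neg_of_pos (mul_neg_of_pos_of_neg (by positivity)
    (mul_neg_of_neg_of_pos hd (by linarith))) had

theorem adiMobius_neg (ha : 0 < a) (hab : a < b) (hcd : c < d) (hd : d < 0) {z : ℝ}
    (hz : z ∈ Set.Icc 1 (adiAlpha a b c d)) : adiMobius a b c d z < 0 := by
  have hα := one_lt_adiAlpha (one_lt_adiGamma ha hab hcd hd)
  have h_at_alpha := adiMobius_num_adiAlpha_neg ha hab hcd hd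
  obtain ⟨hz₁, hzα⟩ := hz
  rw [adiMobius]
  set α := adiAlpha a b c d
  have hbc : 0 < b - c := by linarith
  have hba : 0 < b - a := by linarith
  have h_at_one : c * (2 * (1 + α) * (b - a)) < 0 :=
    mul_neg_of_neg_of_pos (by linarith) (by positivity)
  refine div_neg_of_neg_of_pos ?_ ?_
  · have h_affine := affine_neg_of_mem_Icc
      (u := a * ((α - 1) * (b - c)) + c * (2 * (b - a)))
      (v := -(a * ((α - 1) * (b - c))) + c * (2 * α * (b - a)))
      (by linarith) (by linarith) ⟨hz₁, hzα⟩
    linarith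
  · have h_left : 0 ≤ (z - 1) * (α - 1) * (b - c) :=
      mul_nonneg (mul_nonneg (by linarith) (by linarith)) hbc.le
    have h_right : 0 < 2 * (z + α) * (b - a) := mul_pos (by linarith) hba
    linarith

theorem adiMobius_pos (ha : 0 < a) (hab : a < b) (hcd : c < d) (hd : d < 0) {z : ℝ}
    (hz : z ∈ Set.Icc 1 (adiAlpha a b c d)) : 0 < adiMobius a b c d (-z) := by
  have hα := one_lt_adiAlpha (one_lt_adiGamma ha hab hcd hd)
  obtain ⟨hz₁, hzα⟩ := hz
  rw [adiMobius]
  set α := adiAlpha a b c d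
  have hbc : 0 < b - c := by linarith
  have hba : 0 < b - a := by linarith
  have h_left : (-z - 1) * (α - 1) * (b - c) < 0 :=
    mul_neg_of_neg_of_pos (mul_neg_of_neg_of_pos (by linarith) (by linarith)) hbc
  have h_right : 0 ≤ 2 * (-z + α) * (b - a) := mul_nonneg (by linarith) hba.le
  refine div_pos_of_neg_of_neg (by nlinarith) ?_
  have h_eq : (-z - 1) * (α - 1) * (b - c) + 2 * (-z + α) * (b - a) =
      -((z - 1) * ((α - 1) * (b - c) + 2 * (b - a)) + 2 * (α - 1) * (a - c)) := by ring
  rw [h_eq, neg_lt_zero]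
  exact add_pos_of_nonneg_of_pos
    (mul_nonneg (by linarith) (add_nonneg (mul_nonneg (by linarith) hbc.le) (by linarith)))
    (mul_pos (by linarith) (by linarith))

theorem adiShiftP_pos (ha : 0 < a) (hab : a < b) (hcd : c < d) (hd : d < 0) (J i : ℕ) :
    0 < adiShiftP a b c d J i :=
  adiMobius_pos ha hab hcd hd
    (adiAlpha_mul_adiDn_mem_Icc (one_lt_adiAlpha (one_lt_adiGamma ha hab hcd hd)) J i)

theorem adiShiftQ_neg (ha : 0 < a) (hab : a < b) (hcd : c < d) (hd : d < 0) (J i : ℕ) :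
    adiShiftQ a b c d J i < 0 :=
  adiMobius_neg ha hab hcd hd
    (adiAlpha_mul_adiDn_mem_Icc (one_lt_adiAlpha (one_lt_adiGamma ha hab hcd hd)) J i)

theorem one_le_adiCount (ha : 0 < a) (hab : a < b) (hcd : c < d) (hd : d < 0) {ε : ℝ}
    (hε₀ : 0 < ε) (hε₁ : ε < 1) : 1 ≤ adiCount a b c d ε := by
  rw [adiCount, Nat.one_le_ceil_iff]
  have hγ := one_lt_adiGamma ha hab hcd hd
  refine div_pos (mul_pos (Real.log_pos (by linarith)) (Real.log_pos ?_)) (by positivity)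
  rw [lt_div_iff₀ hε₀]
  linarith

end Shifts

/-! ### The precomputation -/

/-- Computes the number of iterations, and registers for `α`, the modulus `k` and `K(k)`. -/
def params (a b c d e : ℕ) : Frag (ℕ × ℕ × ℕ × ℕ) := do
  let g ← Frag.expr ((.reg c - .reg a : Expr).abs * (.reg d - .reg b : Expr).abs /
    ((.reg c - .reg b : Expr).abs * (.reg d - .reg a : Expr).abs))
  let π ← Frag.expr (.const 2 * .un .ellK (.const 0))
  let x ← Frag.expr (.un .log (.const 16 * .reg g) * .un .log (.const 4 / .reg e) /
    (.reg π * .reg π))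
  let J ← Frag.ceil x
  let α ← Frag.expr (.const (-1) + .const 2 * .reg g +
    .const 2 * .un .sqrt (.reg g * .reg g - .reg g))
  let k ← Frag.expr (.un .sqrt (.const 1 - .const 1 / (.reg α * .reg α)))
  let κ ← Frag.un .ellK k
  pure (J, α, k, κ)

theorem ellK_zero : ellK 0 = Real.pi / 2 := by
  simp [ellK, ellF]

section Denotes

variable {mem : List ℝ} {a b c d e g α π : ℕ} {va vb vc vd ve : ℝ}

theorem adiGamma_denotes (ha : Holds mem a va) (hb : Holds mem b vb) (hc : Holds mem c vc)
    (hd : Holds mem d vd) :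
    ((.reg c - .reg a : Expr).abs * (.reg d - .reg b : Expr).abs /
      ((.reg c - .reg b : Expr).abs * (.reg d - .reg a : Expr).abs)).Denotes mem
        (adiGamma va vb vc vd) :=
  .div (.mul (.abs (.sub (.reg hc) (.reg ha))) (.abs (.sub (.reg hd) (.reg hb))))
    (.mul (.abs (.sub (.reg hc) (.reg hb))) (.abs (.sub (.reg hd) (.reg ha))))

theorem pi_denotes : (.const 2 * .un .ellK (.const 0) : Expr).Denotes mem Real.pi :=
  Expr.Denotes.congr (.mul (.const 2) (.un .ellK (.const 0))) (by
    simp only [UnOp.eval, Rat.cast_zero, ellK_zero, Rat.cast_ofNat]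
    ring)

theorem adiCount_denotes (hg : Holds mem g (adiGamma va vb vc vd)) (he : Holds mem e ve)
    (hπ : Holds mem π Real.pi) :
    (.un .log (.const 16 * .reg g) * .un .log (.const 4 / .reg e) /
      (.reg π * .reg π) : Expr).Denotes mem
        (Real.log (16 * adiGamma va vb vc vd) * Real.log (4 / ve) / Real.pi ^ 2) :=
  Expr.Denotes.congr (.div (.mul (.un .log (.mul (.const 16) (.reg hg)))
    (.un .log (.div (.const 4) (.reg he)))) (.mul (.reg hπ) (.reg hπ))) (by
      simp only [UnOp.eval, pow_two, Rat.cast_ofNat])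

theorem adiAlpha_denotes (hg : Holds mem g (adiGamma va vb vc vd)) :
    (.const (-1) + .const 2 * .reg g +
      .const 2 * .un .sqrt (.reg g * .reg g - .reg g) : Expr).Denotes mem
        (adiAlpha va vb vc vd) :=
  Expr.Denotes.congr (.add (.add (.const (-1)) (.mul (.const 2) (.reg hg)))
    (.mul (.const 2) (.sqrt (.sub (.mul (.reg hg) (.reg hg)) (.reg hg))))) (by
      rw [adiAlpha, pow_two]
      push_cast
      rfl)

theorem adiModulus_denotes (hα : Holds mem α (adiAlpha va vb vc vd)) :
    (.un .sqrt (.const 1 - .const 1 / (.reg α * .reg α)) : Expr).Denotes mem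
      (adiModulus va vb vc vd) :=
  Expr.Denotes.congr (.sqrt (.sub (.const 1) (.div (.const 1) (.mul (.reg hα) (.reg hα))))) (by
    rw [adiModulus, pow_two, Rat.cast_one])

end Denotes

theorem params_computes {mem : List ℝ} {a b c d e : ℕ} {va vb vc vd ve : ℝ}
    (ha : Holds mem a va) (hb : Holds mem b vb) (hc : Holds mem c vc) (hd : Holds mem d vd)
    (he : Holds mem e ve) :
    (params a b c d e).Computes mem (60 + adiCount va vb vc vd ve) fun t m =>
      t.1 = adiCount va vb vc vd ve ∧ Holds m t.2.1 (adiAlpha va vb vc vd) ∧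
      Holds m t.2.2.1 (adiModulus va vb vc vd) ∧
      Holds m t.2.2.2 (ellK (adiModulus va vb vc vd)) := by
  refine ((Frag.Computes.expr_le (c := 19) (adiGamma_denotes ha hb hc hd)
      (Nat.le_of_ble_eq_true rfl)).bind fun g m₁ hm₁ hg =>
    (Frag.Computes.expr_le (c := 4) pi_denotes (Nat.le_of_ble_eq_true rfl)).bind
      fun π m₂ hm₂ hπ =>
    (Frag.Computes.expr_le (c := 9) (adiCount_denotes (hg.mono hm₂) (he.mono (hm₁.trans hm₂)) hπ)
      (Nat.le_of_ble_eq_true rfl)).bind fun x m₃ hm₃ hx =>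
    (Frag.Computes.ceil hx).bind fun J m₄ hm₄ hJ =>
    (Frag.Computes.expr_le (c := 10) (adiAlpha_denotes (hg.mono (hm₂.trans (hm₃.trans hm₄))))
      (Nat.le_of_ble_eq_true rfl)).bind fun α _ _ hα =>
    (Frag.Computes.expr_le (c := 6) (adiModulus_denotes hα) (Nat.le_of_ble_eq_true rfl)).bind
      fun k m₆ hm₆ hk => (Frag.Computes.un .ellK hk).bind fun κ m₇ hm₇ hκ =>
    .pure ⟨hJ, hα.mono (hm₆.trans hm₇), hk.mono hm₇, hκ⟩).mono_cost ?_
  rw [adiCount]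
  lia

/-- The Möbius transformation `T`, as an expression. -/
def mobiusExpr (a b c α z : Expr) : Expr :=
  (a * ((z - .const 1) * (α - .const 1) * (b - c)) + c * (.const 2 * (z + α) * (b - a))) /
    ((z - .const 1) * (α - .const 1) * (b - c) + .const 2 * (z + α) * (b - a))

theorem mobiusExpr_denotes {mem : List ℝ} {ea eb ec eα ez : Expr} {a b c d z : ℝ}
    (ha : ea.Denotes mem a) (hb : eb.Denotes mem b) (hc : ec.Denotes mem c)
    (hα : eα.Denotes mem (adiAlpha a b c d)) (hz : ez.Denotes mem z) :
    (mobiusExpr ea eb ec eα ez).Denotes mem (adiMobius a b c d z) := by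
  have h_left := ((hz.sub (.const 1)).mul (hα.sub (.const 1))).mul (hb.sub hc)
  have h_right := ((Expr.Denotes.const 2).mul (hz.add hα)).mul (hb.sub ha)
  refine (((ha.mul h_left).add (hc.mul h_right)).div (h_left.add h_right)).congr ?_
  rw [adiMobius]
  push_cast
  rfl

/-- Computes the shifts with index `i`. -/
def shifts (a b c α k κ J i : ℕ) : Frag (ℕ × ℕ) := do
  let x ← Frag.expr (.reg α *
    .bin .dn (.const ((2 * i + 1) / (2 * J)) * .reg κ) (.reg k))
  let p ← Frag.expr (mobiusExpr (.reg a) (.reg b) (.reg c) (.reg α) (.neg (.reg x)))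
  let q ← Frag.expr (mobiusExpr (.reg a) (.reg b) (.reg c) (.reg α) (.reg x))
  pure (p, q)

theorem shifts_computes {mem : List ℝ} {a b c α k κ J i : ℕ} {va vb vc vd : ℝ}
    (ha : Holds mem a va) (hb : Holds mem b vb) (hc : Holds mem c vc)
    (hα : Holds mem α (adiAlpha va vb vc vd)) (hk : Holds mem k (adiModulus va vb vc vd))
    (hκ : Holds mem κ (ellK (adiModulus va vb vc vd))) :
    (shifts a b c α k κ J i).Computes mem 100 fun t m =>
      Holds m t.1 (adiShiftP va vb vc vd J i) ∧ Holds m t.2 (adiShiftQ va vb vc vd J i) := by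
  have h_point : (.reg α * .bin .dn (.const ((2 * i + 1) / (2 * J)) * .reg κ) (.reg k) :
      Expr).Denotes mem (adiAlpha va vb vc vd * adiDn va vb vc vd J i) :=
    Expr.Denotes.congr (.mul (.reg hα)
      (.bin .dn (.mul (.const ((2 * i + 1) / (2 * J))) (.reg hκ)) (.reg hk))) (by
        simp only [BinOp.eval, adiDn]
        push_cast
        rfl)
  refine ((Frag.Computes.expr_le (c := 4) h_point le_rfl).bind fun x m₁ hm₁ hx =>
    (Frag.Computes.expr_le (c := 48) (v := adiShiftP va vb vc vd J i)
      (mobiusExpr_denotes (.reg (ha.mono hm₁)) (.reg (hb.mono hm₁)) (.reg (hc.mono hm₁))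
        (.reg (hα.mono hm₁)) (.neg (.reg hx))) ?_).bind fun p m₂ hm₂ hp =>
    (Frag.Computes.expr_le (c := 48) (v := adiShiftQ va vb vc vd J i)
      (mobiusExpr_denotes (.reg (ha.mono (hm₁.trans hm₂))) (.reg (hb.mono (hm₁.trans hm₂)))
        (.reg (hc.mono (hm₁.trans hm₂))) (.reg (hα.mono (hm₁.trans hm₂))) (.reg (hx.mono hm₂)))
      ?_).bind fun q m₃ hm₃ hq => .pure ⟨hp.mono hm₃, hq⟩).mono_cost (by simp)
  all_goals exact Nat.le_of_ble_eq_true rfl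

section Coefficients

variable {M N : ℕ}

/-- The coefficient matrices of a Sylvester equation `A U C - D U B = F` with sparsity patterns `Px`
and `Py`, for which `A`, `D`, `C` and `-B` are positive definite. -/
structure IsSparseDefinite (Px : Pattern M) (Py : Pattern N) (A : Matrix (Fin M) (Fin M) ℝ)
    (B C : Matrix (Fin N) (Fin N) ℝ) (D : Matrix (Fin M) (Fin M) ℝ) : Prop where
  conforms_A : Px.Conforms A
  conforms_neg_B : Py.Conforms (-B)
  conforms_C : Py.Conforms C
  conforms_D : Px.Conforms D
  posDef_A : A.PosDef
  posDef_neg_B : (-B).PosDef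
  posDef_C : C.PosDef
  posDef_D : D.PosDef

/-- The registers `tA`, `tB`, `tC`, `tD` hold the coefficient matrices `A`, `B`, `C`, `D`. -/
structure HoldsCoeffs (mem : List ℝ) (tA : Fin M → Fin M → ℕ) (tB tC : Fin N → Fin N → ℕ)
    (tD : Fin M → Fin M → ℕ) (A : Matrix (Fin M) (Fin M) ℝ) (B C : Matrix (Fin N) (Fin N) ℝ)
    (D : Matrix (Fin M) (Fin M) ℝ) : Prop where
  A : HoldsMat mem tA A
  B : HoldsMat mem tB B
  C : HoldsMat mem tC C
  D : HoldsMat mem tD D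

variable {Px : Pattern M} {Py : Pattern N} {A D : Matrix (Fin M) (Fin M) ℝ}
  {B C : Matrix (Fin N) (Fin N) ℝ}

theorem HoldsCoeffs.mono {mem mem' : List ℝ} {tA tD : Fin M → Fin M → ℕ}
    {tB tC : Fin N → Fin N → ℕ} (h : HoldsCoeffs mem tA tB tC tD A B C D) (hm : mem <+: mem') :
    HoldsCoeffs mem' tA tB tC tD A B C D :=
  ⟨h.A.mono hm, h.B.mono hm, h.C.mono hm, h.D.mono hm⟩

namespace IsSparseDefinite

variable (h : IsSparseDefinite Px Py A B C D)
include h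

theorem conforms_sub_smul (t : ℝ) : Px.Conforms (A - t • D) :=
  h.conforms_A.sub (h.conforms_D.smul t)

theorem conforms_smul_sub (t : ℝ) : Py.Conforms (t • C - B) := by
  simpa only [sub_eq_add_neg] using (h.conforms_C.smul t).add h.conforms_neg_B

theorem posDef_sub_smul {t : ℝ} (ht : t < 0) : (A - t • D).PosDef := by
  rw [sub_eq_add_neg, ← neg_smul]
  exact h.posDef_A.add (h.posDef_D.smul (neg_pos.2 ht))

theorem posDef_smul_sub {t : ℝ} (ht : 0 < t) : (t • C - B).PosDef := by
  rw [sub_eq_add_neg]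
  exact (h.posDef_C.smul ht).add h.posDef_neg_B

end IsSparseDefinite

variable (Px Py) in
/-- The result of the precomputation for given spectral bounds `a`, `b`, `c`, `d`. -/
def adiData (A : Matrix (Fin M) (Fin M) ℝ) (B C : Matrix (Fin N) (Fin N) ℝ)
    (D : Matrix (Fin M) (Fin M) ℝ) (ε a b c d : ℝ) : ADIData M N where
  a := a
  b := b
  c := c
  d := d
  J := adiCount a b c d ε
  p j := adiShiftP a b c d (adiCount a b c d ε) j
  q j := adiShiftQ a b c d (adiCount a b c d ε) j
  L j := Matrix.of (Px.cholRec (A - adiShiftQ a b c d (adiCount a b c d ε) j • D))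
  R j := Matrix.of (Py.cholRec (adiShiftP a b c d (adiCount a b c d ε) j • C - B))

theorem IsSparseDefinite.isPrecomputation_adiData (h : IsSparseDefinite Px Py A B C D)
    {δ ε a b c d : ℝ} (hδ : δ < 1) (hab : IsEnclosure δ (genSpectrum A D) a b)
    (hcd : IsEnclosure δ (genSpectrum B C) c d) :
    (adiData Px Py A B C D ε a b c d).IsPrecomputation δ ε A B C D := by
  have ha : 0 < a := hab.pos h.posDef_A h.posDef_D hδ
  have hd : d < 0 := neg_pos.1 (hcd.neg.pos h.posDef_neg_B h.posDef_C hδ)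
  exact
    { encl_left := hab
      encl_right := hcd
      count := rfl
      shift_p _ := rfl
      shift_q _ := rfl
      chol_left j := (h.conforms_sub_smul _).isRevCholesky_cholRec_of_posDef
        (h.posDef_sub_smul (adiShiftQ_neg ha hab.1 hcd.1 hd _ j))
      chol_right j := (h.conforms_smul_sub _).isRevCholesky_cholRec_of_posDef
        (h.posDef_smul_sub (adiShiftP_pos ha hab.1 hcd.1 hd _ j)) }

end Coefficients

section Precomputation

variable {M N : ℕ} (Px : Pattern M) (Py : Pattern N)

/-- Encloses the generalised spectra of `(A, D)` and `(B, C)` to relative accuracy `1 / s`. -/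
def bounds (s : ℕ) (tA : Fin M → Fin M → ℕ) (tB tC : Fin N → Fin N → ℕ)
    (tD : Fin M → Fin M → ℕ) : Frag (ℕ × ℕ × ℕ × ℕ) := do
  let (a, b) ← Px.enclose s tA tD
  let tB' ← negMat tB
  let (d', c') ← Py.enclose s tB' tC
  let c ← Frag.expr (.neg (.reg c'))
  let d ← Frag.expr (.neg (.reg d'))
  pure (a, b, c, d)

/-- The reverse Cholesky factors of `A - q D` and `p C - B`. -/
def factors (tA : Fin M → Fin M → ℕ) (tB tC : Fin N → Fin N → ℕ) (tD : Fin M → Fin M → ℕ)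
    (p q : ℕ) : Frag ((Fin M → Fin M → ℕ) × (Fin N → Fin N → ℕ)) := do
  let tX ← Px.buildMat fun i j => .reg (tA i j) - .reg q * .reg (tD i j)
  let L ← Px.chol tX
  let tY ← Py.buildMat fun i j => .reg p * .reg (tC i j) - .reg (tB i j)
  let R ← Py.chol tY
  pure (L, R)

/-- The addresses of the shifts and factors for one iteration, in the order `p, q, L, R`. -/
abbrev StepAddr (M N : ℕ) : Type := ℕ × ℕ × (Fin M → Fin M → ℕ) × (Fin N → Fin N → ℕ)

/-- The registers `r` hold the shifts and factors for iteration `j`. -/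
structure HoldsStep (mem : List ℝ) (r : StepAddr M N) (S : ADIData M N) (j : Fin S.J) : Prop where
  p : Holds mem r.1 (S.p j)
  q : Holds mem r.2.1 (S.q j)
  L : HoldsMat mem r.2.2.1 (S.L j)
  R : HoldsMat mem r.2.2.2 (S.R j)

theorem HoldsStep.mono {mem mem' : List ℝ} {r : StepAddr M N} {S : ADIData M N} {j : Fin S.J}
    (h : HoldsStep mem r S j) (hm : mem <+: mem') : HoldsStep mem' r S j :=
  ⟨h.p.mono hm, h.q.mono hm, h.L.mono hm, h.R.mono hm⟩

/-- The addresses of the precomputed data, in the order of `ADIData.toList`. -/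
def adiAddrList {J : ℕ} (a b c d : ℕ) (r : Fin J → StepAddr M N) : List ℕ :=
  [a, b, c, d] ++ List.ofFn (fun j => (r j).1) ++ List.ofFn (fun j => (r j).2.1) ++
    (List.ofFn fun j => addrList (r j).2.2.1).flatten ++
    (List.ofFn fun j => addrList (r j).2.2.2).flatten

/-- The precomputation for the matrices `A, B, C, D` and the tolerance in the given registers, with
relative accuracy `1 / s`. -/
def preFrag (s : ℕ) (tA : Fin M → Fin M → ℕ) (tB tC : Fin N → Fin N → ℕ)
    (tD : Fin M → Fin M → ℕ) (e : ℕ) : Frag (List ℕ) := do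
  let (a, b, c, d) ← bounds Px Py s tA tB tC tD
  let (J, α, k, κ) ← params a b c d e
  let r : Fin J → StepAddr M N ← Frag.tab fun i => do
    let (p, q) ← shifts a b c α k κ J i
    let (L, R) ← factors Px Py tA tB tC tD p q
    pure (p, q, L, R)
  pure (adiAddrList a b c d r)

variable {Px Py} {A D : Matrix (Fin M) (Fin M) ℝ} {B C : Matrix (Fin N) (Fin N) ℝ}
  {mem : List ℝ} {tA tD : Fin M → Fin M → ℕ} {tB tC : Fin N → Fin N → ℕ}

theorem bounds_computes (hM : 0 < M) (hN : 0 < N) (h : IsSparseDefinite Px Py A B C D) {s : ℕ}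
    (hs : 0 < s) {δ : ℝ} (hδ : 1 / (s : ℝ) ≤ δ) (ht : HoldsCoeffs mem tA tB tC tD A B C D) :
    (bounds Px Py s tA tB tC tD).Computes mem
      ((170 + 280 * s) * M ^ 2 + (172 + 280 * s) * N ^ 2 + 4) fun t m =>
        ∃ a b c d, Holds m t.1 a ∧ Holds m t.2.1 b ∧ Holds m t.2.2.1 c ∧ Holds m t.2.2.2 d ∧
          IsEnclosure δ (genSpectrum A D) a b ∧ IsEnclosure δ (genSpectrum B C) c d := by
  refine ((Pattern.enclose_computes hM h.conforms_A h.conforms_D h.posDef_A h.posDef_D hs hδ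
      ht.A ht.D).bind fun t₁ m₁ hm₁ ht₁ =>
    (negMat_computes (ht.B.mono hm₁)).bind fun tB' m₂ hm₂ htB' =>
    (Pattern.enclose_computes hN h.conforms_neg_B h.conforms_C h.posDef_neg_B h.posDef_C hs hδ
      htB' (ht.C.mono (hm₁.trans hm₂))).bind (c₂ := 4) fun t₂ m₃ hm₃ ht₂ => ?_).mono_cost (by
        nlinarith)
  obtain ⟨a, b, ha, hb, hab⟩ := ht₁
  obtain ⟨d', c', hd, hc, hcd⟩ := ht₂
  exact (Frag.Computes.expr_le (c := 2) (.neg (.reg hc)) le_rfl).bind fun _ m₄ hm₄ hc =>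
    (Frag.Computes.expr_le (c := 2) (.neg (.reg (hd.mono hm₄))) le_rfl).bind fun _ m₅ hm₅ hd =>
      .pure ⟨a, b, -c', -d', ha.mono (hm₂.trans (hm₃.trans (hm₄.trans hm₅))),
        hb.mono (hm₂.trans (hm₃.trans (hm₄.trans hm₅))), hc.mono hm₅, hd, hab, hcd.of_neg⟩

theorem factors_computes (ht : HoldsCoeffs mem tA tB tC tD A B C D) {p q : ℕ} {vp vq : ℝ}
    (hp : Holds mem p vp) (hq : Holds mem q vq) :
    (factors Px Py tA tB tC tD p q).Computes mem (65 * (M + N) + 2) fun t m =>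
      HoldsMat m t.1 (Matrix.of (Px.cholRec (A - vq • D))) ∧
        HoldsMat m t.2 (Matrix.of (Py.cholRec (vp • C - B))) := by
  refine ((Pattern.buildMat_computes (P := Px) (X := A - vq • D) (c := 2) (fun i j _ =>
      .sub (.reg (ht.A i j)) (.mul (.reg hq) (.reg (ht.D i j)))) fun _ _ => le_rfl).bind
    fun tX m₁ hm₁ htX => (Pattern.chol_computes htX).bind fun L m₂ hm₂ hL =>
    (Pattern.buildMat_computes (P := Py) (X := vp • C - B) (c := 2) (fun i j _ =>
      have hm := hm₁.trans hm₂
      .sub (.mul (.reg (hp.mono hm)) (.reg ((ht.C i j).mono hm))) (.reg ((ht.B i j).mono hm)))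
      fun _ _ => le_rfl).bind
    fun tY m₃ hm₃ htY => (Pattern.chol_computes htY).bind fun R m₄ hm₄ hR =>
    .pure ⟨hL.mono (hm₃.trans hm₄), hR⟩).mono_cost (by lia)

theorem map_adiAddrList {S : ADIData M N} {a b c d : ℕ} {r : Fin S.J → StepAddr M N}
    (ha : Holds mem a S.a) (hb : Holds mem b S.b) (hc : Holds mem c S.c) (hd : Holds mem d S.d)
    (hr : ∀ j, HoldsStep mem (r j) S j) :
    (adiAddrList a b c d r).map (reg mem) = S.toList := by
  rw [adiAddrList, ADIData.toList]
  simp only [List.map_append, List.map_cons, List.map_nil, ha.reg_eq, hb.reg_eq, hc.reg_eq,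
    hd.reg_eq]
  rw [HoldsVec.map_ofFn fun j => (hr j).p, HoldsVec.map_ofFn fun j => (hr j).q,
    map_flatten_ofFn fun j => (hr j).L.map_addrList,
    map_flatten_ofFn fun j => (hr j).R.map_addrList]

theorem preFrag_computes (hM : 0 < M) (hN : 0 < N) (h : IsSparseDefinite Px Py A B C D) {s : ℕ}
    (hs : 0 < s) {δ : ℝ} (hsδ : 1 / (s : ℝ) ≤ δ) (hδ : δ < 1) {ε : ℝ} {e : ℕ}
    (ht : HoldsCoeffs mem tA tB tC tD A B C D) (he : Holds mem e ε) :
    ∃ S : ADIData M N, S.IsPrecomputation δ ε A B C D ∧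
      (preFrag Px Py s tA tB tC tD e).Computes mem
        ((170 + 280 * s) * M ^ 2 + (172 + 280 * s) * N ^ 2 + 64 + S.J * (103 + 65 * (M + N)))
        fun l m => l.map (reg m) = S.toList := by
  suffices ∃ S : ADIData M N, S.IsPrecomputation δ ε A B C D ∧
      (preFrag Px Py s tA tB tC tD e).Computes mem
        ((170 + 280 * s) * M ^ 2 + (172 + 280 * s) * N ^ 2 + 4 +
          (60 + S.J + S.J * (102 + 65 * (M + N))))
        fun l m => l.map (reg m) = S.toList from
    this.imp fun S hS => hS.imp_right fun hS => hS.mono_cost (by lia)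
  refine (bounds_computes hM hN h hs hsδ ht).exists_bind fun t₁ m₁ hm₁ ht₁ => ?_
  obtain ⟨a, b, c, d, ha, hb, hc, hd, hab, hcd⟩ := ht₁
  refine ⟨adiData Px Py A B C D ε a b c d, h.isPrecomputation_adiData hδ hab hcd, ?_⟩
  refine (params_computes ha hb hc hd (he.mono hm₁)).bind fun t₂ m₂ hm₂ ht₂ => ?_
  obtain ⟨J, α, k, κ⟩ := t₂
  obtain ⟨rfl, hα, hk, hκ⟩ := ht₂
  refine ((Frag.Computes.tab
    (P := fun j r m => HoldsStep m r (adiData Px Py A B C D ε a b c d) j)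
    (fun _ _ _ _ hm h => h.mono hm)
    fun j m hm => ((shifts_computes (ha.mono (hm₂.trans hm)) (hb.mono (hm₂.trans hm))
        (hc.mono (hm₂.trans hm)) (hα.mono hm) (hk.mono hm) (hκ.mono hm)).bind
      fun _ m₃ hm₃ hpq => (factors_computes (ht.mono (hm₁.trans (hm₂.trans (hm.trans hm₃))))
        hpq.1 hpq.2).bind fun _ m₄ hm₄ hLR =>
        .pure ⟨hpq.1.mono hm₄, hpq.2.mono hm₄, hLR.1, hLR.2⟩).mono_cost (by lia)).bind
    fun r m₃ hm₃ hr => .pure ?_)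
  exact map_adiAddrList (ha.mono (hm₂.trans hm₃)) (hb.mono (hm₂.trans hm₃))
    (hc.mono (hm₂.trans hm₃)) (hd.mono (hm₂.trans hm₃)) hr

end Precomputation

/-! ### The solve -/

theorem HoldsMat.transpose {ι κ : Type} {mem : List ℝ} {t : ι → κ → ℕ} {X : Matrix ι κ ℝ}
    (h : HoldsMat mem t X) : HoldsMat mem (flip t) X.transpose := fun j i => h i j

theorem mul_row_eq_mulVec {M N : ℕ} {X : Matrix (Fin N) (Fin N) ℝ} (hX : X.IsSymm)
    (W : Matrix (Fin M) (Fin N) ℝ) (r : Fin M) : (W * X) r = X.mulVec (W r) := by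
  rw [Matrix.mul_apply_eq_vecMul, ← Matrix.mulVec_transpose, hX.eq]

namespace Pattern

variable {M N : ℕ} {P : Pattern N} {X L : Matrix (Fin N) (Fin N) ℝ}
  {F W : Matrix (Fin M) (Fin N) ℝ} {mem : List ℝ} {t : Fin N → Fin N → ℕ}
  {f w : Fin M → Fin N → ℕ}

variable (P) in
/-- Computes `F - W X`. -/
def residualRows (t : Fin N → Fin N → ℕ) (f w : Fin M → Fin N → ℕ) : Frag (Fin M → Fin N → ℕ) :=
  Frag.tab fun r => P.residual t (f r) (w r)

variable (P) in
/-- Computes `F X⁻¹` from the reverse Cholesky factor of `X` in the registers `t`. -/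
def solveRows (t : Fin N → Fin N → ℕ) (f : Fin M → Fin N → ℕ) : Frag (Fin M → Fin N → ℕ) :=
  Frag.tab fun r => P.solveVec t (f r)

theorem residualRows_computes (hX : P.Conforms X) (ht : HoldsPat P mem t X) (hf : HoldsMat mem f F)
    (hw : HoldsMat mem w W) :
    (P.residualRows t f w).Computes mem (M * (22 * N)) fun u m => HoldsMat m u (F - W * X) := by
  refine Frag.Computes.tab_mat fun r m hm => ?_
  have h_row : (F - W * X) r = F r - X.mulVec (W r) := by rw [← mul_row_eq_mulVec hX.1]; rfl
  rw [h_row]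
  exact residual_computes hX (ht.mono hm) (fun c => (hf r c).mono hm) fun c => (hw r c).mono hm

theorem solveRows_computes (hX : P.Conforms X) (hL : IsRevCholesky X L) (ht : HoldsMat mem t L)
    (hf : HoldsMat mem f F) :
    (P.solveRows t f).Computes mem (M * (22 * N)) fun u m => HoldsMat m u (F * X⁻¹) := by
  refine Frag.Computes.tab_mat fun r m hm => ?_
  rw [mul_row_eq_mulVec (by rw [Matrix.IsSymm, Matrix.transpose_nonsing_inv, hX.1.eq])]
  exact solveVec_computes hX hL (ht.mono hm) fun c => (hf r c).mono hm

end Pattern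

theorem adiStep_eq {M N : ℕ} {A D : Matrix (Fin M) (Fin M) ℝ} {B C : Matrix (Fin N) (Fin N) ℝ}
    {F W : Matrix (Fin M) (Fin N) ℝ} {s t : ℝ} (h : IsUnit (s • C - B)) :
    adiStep A B C D F s t W =
      (A - t • D)⁻¹ * (F - (F - (A - s • D) * W) * (s • C - B)⁻¹ * (t • C - B)) := by
  have h_inv : (B - s • C)⁻¹ = -(s • C - B)⁻¹ := by
    rw [← neg_sub (s • C) B]
    refine Matrix.inv_eq_right_inv ?_
    rw [Matrix.neg_mul, Matrix.mul_neg, neg_neg]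
    exact Matrix.mul_nonsing_inv _ ((Matrix.isUnit_iff_isUnit_det _).1 h)
  simp only [adiStep]
  rw [h_inv, Matrix.mul_neg, Matrix.neg_mul, ← neg_sub (t • C) B, Matrix.mul_neg, neg_neg]

section Solve

variable {M N : ℕ} (Px : Pattern M) (Py : Pattern N)

/-- One ADI step. The operations from the left act on the columns, that is, on the rows of the
transposed table. -/
def stepFrag (tA : Fin M → Fin M → ℕ) (tB tC : Fin N → Fin N → ℕ) (tD : Fin M → Fin M → ℕ)
    (tF : Fin M → Fin N → ℕ) (r : StepAddr M N) (W : Fin M → Fin N → ℕ) :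
    Frag (Fin M → Fin N → ℕ) := do
  let (p, q, L, R) := r
  let tX ← Px.buildMat fun i j => .reg (tA i j) - .reg p * .reg (tD i j)
  let Q ← Px.residualRows tX (flip tF) (flip W)
  let V ← Py.solveRows R (flip Q)
  let tY ← Py.buildMat fun i j => .reg q * .reg (tC i j) - .reg (tB i j)
  let G ← Py.residualRows tY tF V
  let W' ← Px.solveRows L (flip G)
  pure (flip W')

/-- The solve with `J` iterations. -/
def solveFrag (J : ℕ) (tA : Fin M → Fin M → ℕ) (tB tC : Fin N → Fin N → ℕ)
    (tD : Fin M → Fin M → ℕ) (tF : Fin M → Fin N → ℕ) (r : Fin J → StepAddr M N) :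
    Frag (List ℕ) := do
  let z ← Frag.const 0
  let K ← Py.chol tC
  let W ← Fin.foldlM J (fun W j => stepFrag Px Py tA tB tC tD tF (r j) W) fun _ _ => z
  let U ← Py.solveRows K W
  pure (addrList U)

variable {Px Py} {A D : Matrix (Fin M) (Fin M) ℝ} {B C : Matrix (Fin N) (Fin N) ℝ}
  {F : Matrix (Fin M) (Fin N) ℝ} {mem : List ℝ} {tA tD : Fin M → Fin M → ℕ}
  {tB tC : Fin N → Fin N → ℕ} {tF : Fin M → Fin N → ℕ} {δ ε : ℝ} {S : ADIData M N}

theorem stepFrag_computes (h : IsSparseDefinite Px Py A B C D)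
    (hS : S.IsPrecomputation δ ε A B C D) (ht : HoldsCoeffs mem tA tB tC tD A B C D)
    (htF : HoldsMat mem tF F) {j : Fin S.J} {r : StepAddr M N} (hr : HoldsStep mem r S j)
    {tW : Fin M → Fin N → ℕ} {W : Matrix (Fin M) (Fin N) ℝ} (htW : HoldsMat mem tW W) :
    (stepFrag Px Py tA tB tC tD tF r tW).Computes mem (10 * (M + N) + 88 * (M * N))
      fun t m => HoldsMat m t (adiStep A B C D F (S.p j) (S.q j) W) := by
  have h_transpose : (F.transpose - W.transpose * (A - S.p j • D)).transpose =
      F - (A - S.p j • D) * W := by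
    rw [Matrix.transpose_sub, Matrix.transpose_mul, Matrix.transpose_transpose,
      Matrix.transpose_transpose, (h.conforms_sub_smul _).1.eq]
  rw [adiStep_eq (hS.chol_right j).posDef.isUnit, ← h_transpose]
  refine ((Pattern.buildMat_computes (P := Px) (c := 2) (X := A - S.p j • D) (fun i l _ =>
      .sub (.reg (ht.A i l)) (.mul (.reg hr.p) (.reg (ht.D i l)))) fun _ _ => le_rfl).bind
    fun tX m₁ hm₁ htX => (Pattern.residualRows_computes (h.conforms_sub_smul _) htX
      (htF.mono hm₁).transpose (htW.mono hm₁).transpose).bind fun tQ m₂ hm₂ htQ =>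
    (Pattern.solveRows_computes (h.conforms_smul_sub _) (hS.chol_right j)
      (hr.R.mono (hm₁.trans hm₂)) htQ.transpose).bind fun tV m₃ hm₃ htV =>
    have hm₁₃ := hm₁.trans (hm₂.trans hm₃)
    (Pattern.buildMat_computes (P := Py) (c := 2) (X := S.q j • C - B) (fun i l _ =>
      .sub (.mul (.reg (hr.q.mono hm₁₃)) (.reg ((ht.C i l).mono hm₁₃)))
        (.reg ((ht.B i l).mono hm₁₃))) fun _ _ => le_rfl).bind
    fun tY m₄ hm₄ htY => (Pattern.residualRows_computes (h.conforms_smul_sub _) htY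
      (htF.mono (hm₁₃.trans hm₄)) (htV.mono hm₄)).bind fun tG m₅ hm₅ htG =>
    (Pattern.solveRows_computes (h.conforms_sub_smul _) (hS.chol_left j)
      (hr.L.mono (hm₁₃.trans (hm₄.trans hm₅))) htG.transpose).bind fun tW' m₆ _ htW' =>
    .pure ?_).mono_cost (by lia)
  simpa [Matrix.transpose_nonsing_inv, (h.conforms_sub_smul _).1.eq] using htW'.transpose

theorem solveFrag_computes (h : IsSparseDefinite Px Py A B C D)
    (hS : S.IsPrecomputation δ ε A B C D) (ht : HoldsCoeffs mem tA tB tC tD A B C D)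
    (htF : HoldsMat mem tF F) {r : Fin S.J → StepAddr M N} (hr : ∀ j, HoldsStep mem (r j) S j) :
    (solveFrag Px Py S.J tA tB tC tD tF r).Computes mem
      (S.J * (10 * (M + N) + 88 * (M * N)) + 55 * N + 22 * (M * N) + 2)
      fun l m => l.map (reg m) = matList (adiSolution A B C D F S) := by
  refine ((Frag.Computes.const 0).bind fun z m₁ hm₁ hz =>
    (Pattern.chol_computes (P := Py) (ht.C.mono hm₁).holdsPat).bind fun K m₂ hm₂ hK =>
    (Frag.Computes.foldlM_foldl (g := fun W j => adiStep A B C D F (S.p j) (S.q j) W)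
      (x := (0 : Matrix (Fin M) (Fin N) ℝ)) (fun t W m => HoldsMat m t W)
      (fun _ _ => by simpa using hz.mono hm₂) fun j _ _ m hm hW =>
        have hm' := hm₁.trans (hm₂.trans hm)
        stepFrag_computes h hS (ht.mono hm') (htF.mono hm') ((hr j).mono hm') hW).bind
    fun W m₃ hm₃ hW => (Pattern.solveRows_computes h.conforms_C
      (h.conforms_C.isRevCholesky_cholRec_of_posDef h.posDef_C) (hK.mono hm₃) hW).bind
    fun U m₄ _ hU => .pure hU.map_addrList).mono_cost (by lia)

end Solve

/-! ### Integrals of polynomials -/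

section PolyInt

variable {α β : ℝ}

theorem intervalIntegrable_eval (q : ℝ[X]) (α β : ℝ) :
    IntervalIntegrable (fun t => q.eval t) MeasureTheory.volume α β :=
  q.continuous.intervalIntegrable α β

/-- The integral of a polynomial from `α` to `β`, as a linear functional. -/
def polyInt (α β : ℝ) : ℝ[X] →ₗ[ℝ] ℝ where
  toFun q := ∫ t in α..β, q.eval t
  map_add' q r := by
    simp only [eval_add]
    exact intervalIntegral.integral_add (intervalIntegrable_eval q α β)
      (intervalIntegrable_eval r α β)
  map_smul' c q := by
    simp only [eval_smul, smul_eq_mul, RingHom.id_apply]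
    exact intervalIntegral.integral_const_mul c _

theorem polyInt_apply (α β : ℝ) (q : ℝ[X]) : polyInt α β q = ∫ t in α..β, q.eval t := rfl

theorem polyInt_derivative (α β : ℝ) (q : ℝ[X]) :
    polyInt α β (derivative q) = q.eval β - q.eval α :=
  intervalIntegral.integral_eq_sub_of_hasDerivAt (fun t _ => q.hasDerivAt t)
    (intervalIntegrable_eval _ α β)

theorem polyInt_sq_nonneg (h : α ≤ β) (q : ℝ[X]) : 0 ≤ polyInt α β (q ^ 2) :=
  intervalIntegral.integral_nonneg h fun t _ => by rw [eval_pow]; positivity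

theorem polyInt_le_of_eval_le {M : ℝ} (h : α ≤ β) {q : ℝ[X]}
    (hq : ∀ t ∈ Set.Icc α β, q.eval t ≤ M) : polyInt α β q ≤ (β - α) * M := by
  have hle := intervalIntegral.integral_mono_on h (intervalIntegrable_eval q α β)
    (intervalIntegrable_const (c := M)) hq
  rwa [intervalIntegral.integral_const, smul_eq_mul] at hle

theorem eq_zero_of_polyInt_sq_eq_zero (h : α < β) {q : ℝ[X]} (hq : polyInt α β (q ^ 2) = 0) :
    q = 0 := by
  have hroot : ∀ t ∈ Set.Ioo α β, q.eval t = 0 := by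
    by_contra! hc
    obtain ⟨t, ht, hne⟩ := hc
    refine (intervalIntegral.integral_pos h (q ^ 2).continuous.continuousOn
      (fun s _ => by rw [eval_pow]; positivity) ⟨t, Set.Ioo_subset_Icc_self ht, ?_⟩).ne' hq
    rw [eval_pow]
    positivity
  exact eq_zero_of_infinite_isRoot q ((Set.Ioo_infinite h).mono hroot)

theorem sq_integral_abs_le (h : α < β) (q : ℝ[X]) :
    (∫ t in α..β, |q.eval t|) ^ 2 ≤ (β - α) * polyInt α β (q ^ 2) := by
  set I := ∫ t in α..β, |q.eval t| with hI
  have hlen : 0 < β - α := sub_pos.2 h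
  set mean := I / (β - α)
  have mean_mul : mean * (β - α) = I := div_mul_cancel₀ _ hlen.ne'
  have habs : IntervalIntegrable (fun t => |q.eval t|) MeasureTheory.volume α β :=
    q.continuous.abs.intervalIntegrable α β
  have variance_nonneg : 0 ≤ ∫ t in α..β,
      ((q ^ 2).eval t - 2 * mean * |q.eval t| + mean ^ 2) := by
    refine intervalIntegral.integral_nonneg h.le fun t _ => ?_
    rw [eval_pow, ← sq_abs (q.eval t)]
    nlinarith [sq_nonneg (|q.eval t| - mean)]
  rw [intervalIntegral.integral_add ((intervalIntegrable_eval _ α β).sub (habs.const_mul _))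
    intervalIntegrable_const,
    intervalIntegral.integral_sub (intervalIntegrable_eval _ α β) (habs.const_mul _),
    intervalIntegral.integral_const_mul, intervalIntegral.integral_const, ← hI, ← polyInt_apply,
    smul_eq_mul] at variance_nonneg
  have hscaled := mul_nonneg hlen.le variance_nonneg
  have hexpand : (β - α) * (polyInt α β (q ^ 2) - 2 * mean * I + (β - α) * mean ^ 2) =
      (β - α) * polyInt α β (q ^ 2) - 2 * (mean * (β - α)) * I + (mean * (β - α)) ^ 2 := by ring
  rw [hexpand, mean_mul] at hscaled
  linarith

end PolyInt

/-! ### Affine reparametrisation -/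

section Affine

variable {α β : ℝ}

/-- The affine map from `[α, β]` to `[-1, 1]`. -/
def toRef (α β : ℝ) : ℝ[X] := C (2 / (β - α)) * X - C ((α + β) / (β - α))

/-- The affine map from `[-1, 1]` to `[α, β]`. -/
def fromRef (α β : ℝ) : ℝ[X] := C ((β - α) / 2) * X + C ((α + β) / 2)

theorem eval_toRef (α β t : ℝ) : (toRef α β).eval t = (2 * t - α - β) / (β - α) := by
  simp only [toRef, eval_sub, eval_mul, eval_C, eval_X]
  ring

theorem eval_fromRef (α β t : ℝ) : (fromRef α β).eval t = (β - α) / 2 * t + (α + β) / 2 := by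
  simp only [fromRef, eval_add, eval_mul, eval_C, eval_X]

theorem derivative_fromRef (α β : ℝ) : derivative (fromRef α β) = C ((β - α) / 2) := by
  simp [fromRef]

theorem natDegree_toRef (h : α < β) : (toRef α β).natDegree = 1 := by
  rw [toRef, sub_eq_add_neg, ← C_neg]
  exact natDegree_linear (div_pos two_pos (sub_pos.2 h)).ne'

theorem natDegree_comp_fromRef_le (α β : ℝ) (q : ℝ[X]) :
    (q.comp (fromRef α β)).natDegree ≤ q.natDegree :=
  natDegree_comp_le.trans ((Nat.mul_le_mul_left _ natDegree_linear_le).trans (mul_one _).le)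

theorem toRef_comp_fromRef (h : α < β) : (toRef α β).comp (fromRef α β) = X := by
  have hlen : β - α ≠ 0 := (sub_pos.2 h).ne'
  refine Polynomial.funext fun t => ?_
  rw [eval_comp, eval_toRef, eval_fromRef, eval_X]
  field_simp
  ring

theorem polyInt_eq_comp_fromRef (h : α < β) (q : ℝ[X]) :
    polyInt α β q = (β - α) / 2 * polyInt (-1) 1 (q.comp (fromRef α β)) := by
  have hlen : (β - α) / 2 ≠ 0 := (half_pos (sub_pos.2 h)).ne'
  simp only [polyInt_apply, eval_comp, eval_fromRef]
  rw [intervalIntegral.integral_comp_mul_add (fun t => q.eval t) hlen, smul_eq_mul,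
    mul_inv_cancel_left₀ hlen]
  congr 1 <;> ring

end Affine

/-! ### Orthogonality of the integrated Legendre polynomials -/

section Bubble

variable {α β : ℝ}

theorem polyInt_iterate_derivative_mul {g : ℝ[X]} {k : ℕ}
    (hα : ∀ i < k, (derivative^[i] g).eval α = 0) (hβ : ∀ i < k, (derivative^[i] g).eval β = 0)
    {q : ℝ[X]} (hq : derivative^[k] q = 0) : polyInt α β (derivative^[k] g * q) = 0 := by
  induction k generalizing q with
  | zero => simp only [Function.iterate_zero, id] at hq; rw [hq, mul_zero, map_zero]
  | succ k ih =>
    have integrated := ih (fun i hi => hα i (hi.trans k.lt_succ_self))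
      (fun i hi => hβ i (hi.trans k.lt_succ_self)) (q := derivative q) (by
        rwa [Function.iterate_succ_apply] at hq)
    have byParts := polyInt_derivative α β (derivative^[k] g * q)
    rw [derivative_mul, map_add, integrated, add_zero, eval_mul, eval_mul, hα k k.lt_succ_self,
      hβ k k.lt_succ_self] at byParts
    rw [Function.iterate_succ_apply', byParts]
    ring

theorem polyInt_bubbleW_mul {k : ℕ} {q : ℝ[X]} (hq : q.natDegree < k) :
    polyInt (-1) 1 (bubbleW k * q) = 0 := by
  have vanish : ∀ t : ℝ, t ^ 2 = 1 → ∀ i < k,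
      (derivative^[i] ((X ^ 2 - 1 : ℝ[X]) ^ (k + 1))).eval t = 0 := by
    intro t ht i hi
    obtain ⟨r, hr⟩ := pow_sub_dvd_iterate_derivative_pow (X ^ 2 - 1 : ℝ[X]) (k + 1) i
    rw [hr, eval_mul, eval_pow]
    simp [ht, zero_pow (show k + 1 - i ≠ 0 by lia)]
  rw [bubbleW, neg_mul, mul_assoc, map_neg, ← smul_eq_C_mul, map_smul,
    polyInt_iterate_derivative_mul (vanish (-1) (by norm_num)) (vanish 1 (by norm_num))
      (iterate_derivative_eq_zero hq), smul_zero, neg_zero]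

theorem natDegree_bubbleW (k : ℕ) : (bubbleW k).natDegree = k + 2 := by
  have hmonic : ((X ^ 2 - 1 : ℝ[X]) ^ (k + 1)).Monic :=
    (monic_X_pow_sub_C (1 : ℝ) two_ne_zero).pow (k + 1)
  have hdeg : ((X ^ 2 - 1 : ℝ[X]) ^ (k + 1)).natDegree = 2 * k + 2 := by
    rw [natDegree_pow, show (X ^ 2 - 1 : ℝ[X]).natDegree = 2 from
      natDegree_X_pow_sub_C (r := (1 : ℝ))]
    ring
  have hscale : (1 / (2 ^ (k + 1) * ((k + 1).factorial : ℝ))) ≠ 0 := by positivity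
  rw [bubbleW, natDegree_neg, natDegree_C_mul hscale]
  refine le_antisymm ((natDegree_iterate_derivative _ _).trans (by lia))
    (le_natDegree_of_ne_zero ?_)
  rw [coeff_iterate_derivative, show k + 2 + k = 2 * k + 2 by ring, ← hdeg,
    hmonic.coeff_natDegree, nsmul_eq_mul, mul_one, hdeg]
  have hne : (2 * k + 2).descFactorial k ≠ 0 := by
    rw [Ne, Nat.descFactorial_eq_zero_iff_lt]
    lia
  exact_mod_cast hne

theorem polyInt_bubble_mul (h : α < β) {k : ℕ} {q : ℝ[X]} (hq : q.natDegree < k) :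
    polyInt α β ((bubbleW k).comp (toRef α β) * q) = 0 := by
  rw [polyInt_eq_comp_fromRef h, mul_comp, comp_assoc, toRef_comp_fromRef h, comp_X,
    polyInt_bubbleW_mul ((natDegree_comp_fromRef_le α β q).trans_lt hq), mul_zero]

theorem eval_bubble_eq_zero_of_endpoint (h : α < β) (k : ℕ) {t : ℝ} (ht : t = α ∨ t = β) :
    ((bubbleW k).comp (toRef α β)).eval t = 0 := by
  have hlen : β - α ≠ 0 := (sub_pos.2 h).ne'
  rw [eval_comp, eval_toRef]
  refine bubbleW_eval_of_sq_eq_one k ?_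
  rcases ht with rfl | rfl <;>
  · field_simp
    ring

theorem polyInt_derivative_bubble_mul (h : α < β) {k : ℕ} {q : ℝ[X]} (hq : q.natDegree < k) :
    polyInt α β (derivative ((bubbleW k).comp (toRef α β)) * q) = 0 := by
  have byParts := polyInt_derivative α β ((bubbleW k).comp (toRef α β) * q)
  rw [derivative_mul, map_add, eval_mul, eval_mul,
    eval_bubble_eq_zero_of_endpoint h k (.inl rfl), eval_bubble_eq_zero_of_endpoint h k (.inr rfl),
    polyInt_bubble_mul h ((natDegree_derivative_le q).trans_lt (by lia))] at byParts
  linarith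

end Bubble

/-! ### Markov and inverse inequalities -/

section Inverse

variable {n : ℕ} {v : ℝ[X]} {α β M : ℝ}

theorem abs_derivative_eval_one_le_of_abs_le_one (hd : v.natDegree ≤ n)
    (hv : ∀ x ∈ Set.Icc (-1 : ℝ) 1, |v.eval x| ≤ 1) : |(derivative v).eval 1| ≤ (n : ℝ) ^ 2 := by
  have upper : ∀ w : ℝ[X], w.natDegree ≤ n → (∀ x ∈ Set.Icc (-1 : ℝ) 1, |w.eval x| ≤ 1) →
      (derivative w).eval 1 ≤ (n : ℝ) ^ 2 := fun w hwd hw => by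
    have extremal := Polynomial.Chebyshev.eval_iterate_derivative_le_of_forall_abs_le_one
      (k := 1) le_rfl (natDegree_le_iff_degree_le.1 hwd) hw
    simp only [Function.iterate_one, Polynomial.Chebyshev.derivative_T_eval_one] at extremal
    exact_mod_cast extremal
  have lower := upper (-v) (by rwa [natDegree_neg]) fun x hx => by
    rw [eval_neg, abs_neg]; exact hv x hx
  rw [derivative_neg, eval_neg] at lower
  exact abs_le.2 ⟨by linarith, upper v hd hv⟩

theorem abs_derivative_eval_one_le (hd : v.natDegree ≤ n)
    (hM : ∀ x ∈ Set.Icc (-1 : ℝ) 1, |v.eval x| ≤ M) :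
    |(derivative v).eval 1| ≤ (n : ℝ) ^ 2 * M := by
  rcases ((abs_nonneg _).trans (hM 1 ⟨by norm_num, le_rfl⟩)).eq_or_lt with rfl | hpos
  · have hv : v = 0 := eq_zero_of_infinite_isRoot v ((Set.Icc_infinite (by norm_num)).mono
      fun x hx => abs_nonpos_iff.1 (hM x hx))
    simp [hv]
  · have scaled := abs_derivative_eval_one_le_of_abs_le_one (v := C (1 / M) * v)
      ((natDegree_C_mul_le _ _).trans hd) fun x hx => by
        rw [eval_mul, eval_C, abs_mul, abs_of_pos (one_div_pos.2 hpos), one_div_mul_eq_div,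
          div_le_one hpos]
        exact hM x hx
    rwa [derivative_C_mul, eval_mul, eval_C, abs_mul, abs_of_pos (one_div_pos.2 hpos),
      one_div_mul_eq_div, div_le_iff₀ hpos] at scaled

theorem abs_derivative_eval_right_le (hd : v.natDegree ≤ n) (h : α < β)
    (hM : ∀ x ∈ Set.Icc α β, |v.eval x| ≤ M) :
    |(derivative v).eval β| ≤ 2 * (n : ℝ) ^ 2 / (β - α) * M := by
  have hlen : 0 < β - α := sub_pos.2 h
  have onRef := abs_derivative_eval_one_le (v := v.comp (fromRef α β)) (M := M)
    ((natDegree_comp_fromRef_le α β v).trans hd) fun x hx => by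
      rw [eval_comp, eval_fromRef]
      exact hM _ (by constructor <;> nlinarith [hx.1, hx.2])
  rw [derivative_comp, derivative_fromRef, eval_mul, eval_C, eval_comp, eval_fromRef,
    show (β - α) / 2 * 1 + (α + β) / 2 = β by ring, abs_mul, abs_of_pos (half_pos hlen)] at onRef
  rw [div_mul_eq_mul_div, le_div_iff₀ hlen]
  linarith

/-- At a point `x` the longer one of the two intervals `[α, x]` and `[x, β]` is at least half as
long as `[α, β]`, hence the end-point estimate costs at most a factor two. -/
theorem abs_derivative_eval_le (hd : v.natDegree ≤ n) (h : α < β)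
    (hM : ∀ x ∈ Set.Icc α β, |v.eval x| ≤ M) {x : ℝ} (hx : x ∈ Set.Icc α β) :
    |(derivative v).eval x| ≤ 4 * (n : ℝ) ^ 2 / (β - α) * M := by
  have hlen : 0 < β - α := sub_pos.2 h
  have hM0 : 0 ≤ M := (abs_nonneg _).trans (hM x hx)
  have half_le : ∀ l : ℝ, (β - α) / 2 ≤ l →
      2 * (n : ℝ) ^ 2 / l * M ≤ 4 * (n : ℝ) ^ 2 / (β - α) * M := fun l hl => by
    refine mul_le_mul_of_nonneg_right ?_ hM0
    rw [div_le_div_iff₀ (by linarith) hlen]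
    nlinarith [sq_nonneg (n : ℝ)]
  rcases le_total ((α + β) / 2) x with hmid | hmid
  · exact (abs_derivative_eval_right_le hd (by linarith : α < x) fun y hy =>
      hM y ⟨hy.1, hy.2.trans hx.2⟩).trans (half_le _ (by linarith))
  · have reflected := abs_derivative_eval_right_le (v := v.comp (-X)) (n := n) (M := M)
      (natDegree_comp_le.trans (by rwa [natDegree_neg, natDegree_X, mul_one]))
      (by linarith : -β < -x) fun y hy => by
        rw [eval_comp, eval_neg, eval_X]
        exact hM _ ⟨by linarith [hy.2, hx.1], by linarith [hy.1]⟩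
    rw [derivative_comp, eval_mul, eval_comp] at reflected
    simp only [derivative_neg, derivative_X, eval_neg, eval_one, eval_X, neg_neg, neg_mul,
      one_mul, abs_neg] at reflected
    exact reflected.trans (half_le _ (by linarith))

theorem exists_derivative_eq (hd : v.natDegree ≤ n) :
    ∃ V : ℝ[X], derivative V = v ∧ V.natDegree ≤ n + 1 := by
  refine ⟨∑ i ∈ Finset.range (n + 1), C (v.coeff i / (i + 1)) * X ^ (i + 1), ?_, ?_⟩
  · rw [derivative_sum]
    conv_rhs => rw [v.as_sum_range_C_mul_X_pow' (Nat.lt_succ_of_le hd)]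
    refine Finset.sum_congr rfl fun i _ => ?_
    rw [derivative_C_mul_X_pow]
    push_cast
    rw [div_mul_cancel₀ _ (by positivity)]
  · refine natDegree_sum_le_of_forall_le _ _ fun i hi => ?_
    exact (natDegree_C_mul_X_pow_le _ _).trans (by have := Finset.mem_range.1 hi; lia)

/-- Markov's inequality for the antiderivative of `v` that vanishes at `α`. -/
theorem abs_eval_le_integral (hd : v.natDegree ≤ n) (h : α < β) {x : ℝ}
    (hx : x ∈ Set.Icc α β) :
    |v.eval x| ≤ 4 * ((n : ℝ) + 1) ^ 2 / (β - α) * ∫ t in α..β, |v.eval t| := by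
  obtain ⟨V, hV, hVd⟩ := exists_derivative_eq hd
  have markov := abs_derivative_eval_le (v := V - C (V.eval α)) (n := n + 1)
    (by rwa [natDegree_sub_C]) h (M := ∫ t in α..β, |v.eval t|) (fun y hy => ?_) hx
  · rw [derivative_sub, derivative_C, sub_zero, hV] at markov
    exact_mod_cast markov
  · rw [eval_sub, eval_C, ← polyInt_derivative, hV, polyInt_apply]
    exact (intervalIntegral.abs_integral_le_integral_abs hy.1).trans
      (intervalIntegral.integral_mono_interval le_rfl hy.1 hy.2
        (Filter.Eventually.of_forall fun t => abs_nonneg _)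
        (v.continuous.abs.intervalIntegrable α β))

theorem polyInt_derivative_sq_le (hd : v.natDegree ≤ n) (h : α < β) :
    polyInt α β (derivative v ^ 2) ≤
      256 * ((n : ℝ) + 1) ^ 8 / (β - α) ^ 2 * polyInt α β (v ^ 2) := by
  have hlen : 0 < β - α := sub_pos.2 h
  set I := ∫ t in α..β, |v.eval t|
  have hI0 : 0 ≤ I := intervalIntegral.integral_nonneg h.le fun t _ => abs_nonneg _
  set c := 4 * ((n : ℝ) + 1) ^ 2 / (β - α) with hc
  have hc0 : 0 ≤ c := by positivity
  have pointwise : ∀ t ∈ Set.Icc α β, (derivative v ^ 2).eval t ≤ (c * (c * I)) ^ 2 := by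
    intro t ht
    rw [eval_pow, ← sq_abs]
    refine pow_le_pow_left₀ (abs_nonneg _) ?_ 2
    refine (abs_derivative_eval_le hd h (fun x hx => abs_eval_le_integral hd h hx) ht).trans ?_
    refine mul_le_mul_of_nonneg_right ?_ (mul_nonneg hc0 hI0)
    rw [hc]
    gcongr
    linarith
  calc polyInt α β (derivative v ^ 2) ≤ (β - α) * (c * (c * I)) ^ 2 :=
        polyInt_le_of_eval_le h.le pointwise
    _ = (β - α) * c ^ 4 * I ^ 2 := by ring
    _ ≤ (β - α) * c ^ 4 * ((β - α) * polyInt α β (v ^ 2)) :=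
      mul_le_mul_of_nonneg_left (sq_integral_abs_le h v) (by positivity)
    _ = _ := by rw [hc]; field_simp; ring

end Inverse

/-! ### The finite element matrices -/

theorem BC.firstHat_add_le {bc : BC} {n i : ℕ} (h : i < bc.numHats n) : bc.firstHat + i ≤ n := by
  cases bc <;> simp only [BC.numHats, BC.firstHat] at * <;> lia

namespace Mesh

variable {a b : ℝ} {n : ℕ} (x : Mesh a b n) (bc : BC)

theorem node_lt_node {i j : ℕ} (hij : i < j) (hj : j ≤ n) : x.node i < x.node j := by
  induction j with
  | zero => lia
  | succ j ih =>
    have last_lt := x.node_lt j hj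
    rcases (Nat.lt_succ_iff.1 hij).lt_or_eq with hlt | rfl
    · exact (ih hlt (by lia)).trans last_lt
    · exact last_lt

theorem node_le_node {i j : ℕ} (hij : i ≤ j) (hj : j ≤ n) : x.node i ≤ x.node j :=
  hij.eq_or_lt.elim (fun h => h ▸ le_rfl) fun h => (x.node_lt_node h hj).le

/-- The polynomial with which the hat function `j` coincides on element `e`. -/
def hatPoly (j e : ℕ) : ℝ[X] :=
  if e + 1 = j then C (1 / (x.node (e + 1) - x.node e)) * (X - C (x.node e))
  else if e = j then C (1 / (x.node (e + 1) - x.node e)) * (C (x.node (e + 1)) - X)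
  else 0

/-- The polynomial with which the basis function `i` coincides on element `e`. -/
def basisPoly (i e : ℕ) : ℝ[X] :=
  if i < bc.numHats n then x.hatPoly (bc.firstHat + i) e
  else if e = (i - bc.numHats n) % n then
    (bubbleW ((i - bc.numHats n) / n)).comp (toRef (x.node e) (x.node (e + 1)))
  else 0

section BasisPoly

variable {x bc} {i e : ℕ}

theorem hatPoly_eq_zero {j : ℕ} (hself : e ≠ j) (hsucc : e + 1 ≠ j) : x.hatPoly j e = 0 := by
  rw [hatPoly, if_neg hsucc, if_neg hself]

theorem basisPoly_of_lt (hi : i < bc.numHats n) :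
    x.basisPoly bc i e = x.hatPoly (bc.firstHat + i) e :=
  if_pos hi

theorem basisPoly_of_eq_mod (hi : bc.numHats n ≤ i) (he : e = (i - bc.numHats n) % n) :
    x.basisPoly bc i e =
      (bubbleW ((i - bc.numHats n) / n)).comp (toRef (x.node e) (x.node (e + 1))) := by
  rw [basisPoly, if_neg hi.not_gt, if_pos he]

theorem basisPoly_of_ne_mod (hi : bc.numHats n ≤ i) (he : e ≠ (i - bc.numHats n) % n) :
    x.basisPoly bc i e = 0 := by
  rw [basisPoly, if_neg hi.not_gt, if_neg he]

end BasisPoly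

section Element

variable {e : ℕ} {t : ℝ}

theorem hat_succ_eq (hl : x.node e ≤ t) (hr : t ≤ x.node (e + 1)) :
    x.hat (e + 1) t = (t - x.node e) / (x.node (e + 1) - x.node e) := by
  rw [hat, if_pos ⟨by lia, by simpa using hl, hr⟩, Nat.add_sub_cancel]

theorem hat_self_eq (he : e < n) (hl : x.node e ≤ t) (hr : t ≤ x.node (e + 1)) :
    x.hat e t = (x.node (e + 1) - t) / (x.node (e + 1) - x.node e) := by
  unfold hat
  split_ifs with onPrevious onElement
  · have prev_lt := x.node_lt (e - 1) (by lia)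
    rw [Nat.sub_add_cancel onPrevious.1] at prev_lt
    rw [le_antisymm onPrevious.2.2 hl, div_self (sub_pos.2 prev_lt).ne',
      div_self (sub_pos.2 (x.node_lt e he)).ne']
  · rfl
  · exact (onElement ⟨he, hl, hr⟩).elim

theorem hat_eq_zero {j : ℕ} (hj : j ≤ n) (he : e < n) (hne : e ≠ j) (hne_succ : e + 1 ≠ j)
    (hl : x.node e ≤ t) (hr : t ≤ x.node (e + 1)) : x.hat j t = 0 := by
  unfold hat
  rcases lt_or_gt_of_ne hne_succ with hlt | hgt
  · have before := x.node_le_node (show e + 1 ≤ j - 1 by lia) (by lia)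
    have peak := x.node_lt_node (show j - 1 < j by lia) hj
    split_ifs with left right
    · rw [le_antisymm (hr.trans before) left.2.1, sub_self, zero_div]
    · linarith [right.2.1]
    · rfl
  · have after := x.node_le_node (show j + 1 ≤ e by lia) he.le
    have peak := x.node_lt_node (show j < j + 1 by lia) (by lia)
    split_ifs with left right
    · linarith [left.2.2]
    · rw [le_antisymm right.2.2 (after.trans hl), sub_self, zero_div]
    · rfl

theorem hat_eq_eval_hatPoly {j : ℕ} (hj : j ≤ n) (he : e < n) (hl : x.node e ≤ t)
    (hr : t ≤ x.node (e + 1)) : x.hat j t = (x.hatPoly j e).eval t := by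
  unfold hatPoly
  split_ifs with hsucc hself
  · subst hsucc
    rw [x.hat_succ_eq hl hr]
    simp only [eval_mul, eval_C, eval_sub, eval_X]
    ring
  · subst hself
    rw [x.hat_self_eq he hl hr]
    simp only [eval_mul, eval_C, eval_sub, eval_X]
    ring
  · rw [x.hat_eq_zero hj he hself hsucc hl hr, eval_zero]

theorem bubble_eq_ite {k e' : ℕ} (he : e < n) (he' : e' < n) (hl : x.node e ≤ t)
    (hr : t ≤ x.node (e + 1)) : x.bubble k e' t = if e = e' then
      ((bubbleW k).comp (toRef (x.node e) (x.node (e + 1)))).eval t else 0 := by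
  have formula : ((bubbleW k).comp (toRef (x.node e') (x.node (e' + 1)))).eval t =
      (bubbleW k).eval ((2 * t - x.node e' - x.node (e' + 1)) /
        (x.node (e' + 1) - x.node e')) := by
    rw [eval_comp, eval_toRef]
  unfold bubble
  by_cases hee : e = e'
  · subst hee
    rw [if_pos ⟨hl, hr⟩, if_pos rfl, formula]
  · rw [if_neg hee]
    split_ifs with onElement
    · rw [← formula]
      refine eval_bubble_eq_zero_of_endpoint (x.node_lt e' he') k ?_
      rcases lt_or_gt_of_ne hee with hlt | hgt
      · exact .inl (le_antisymm (hr.trans (x.node_le_node hlt he'.le)) onElement.1)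
      · exact .inr (le_antisymm onElement.2 ((x.node_le_node hgt he.le).trans hl))
    · rfl

theorem basis_eq_eval_basisPoly {i : ℕ} (he : e < n) (hl : x.node e ≤ t)
    (hr : t ≤ x.node (e + 1)) : x.basis bc i t = (x.basisPoly bc i e).eval t := by
  unfold basis basisPoly
  split_ifs with isHat onElement
  · exact x.hat_eq_eval_hatPoly (BC.firstHat_add_le isHat) he hl hr
  · rw [x.bubble_eq_ite he (Nat.mod_lt _ (by lia)) hl hr, if_pos onElement]
  · rw [x.bubble_eq_ite he (Nat.mod_lt _ (by lia)) hl hr, if_neg onElement, eval_zero]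

theorem deriv_basis_eq_eval {i : ℕ} (he : e < n) (ht : t ∈ Set.Ioo (x.node e) (x.node (e + 1))) :
    deriv (x.basis bc i) t = (derivative (x.basisPoly bc i e)).eval t := by
  rw [← Polynomial.deriv]
  refine Filter.EventuallyEq.deriv_eq ?_
  filter_upwards [Ioo_mem_nhds ht.1 ht.2] with s hs
  exact x.basis_eq_eval_basisPoly bc he hs.1.le hs.2.le

end Element

theorem integral_eq_sum_polyInt {g : ℝ → ℝ} {q : ℕ → ℝ[X]}
    (h : ∀ e < n, ∀ t ∈ Set.Ioo (x.node e) (x.node (e + 1)), g t = (q e).eval t) :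
    ∫ t in a..b, g t = ∑ e ∈ Finset.range n, polyInt (x.node e) (x.node (e + 1)) (q e) := by
  have eqOn : ∀ e < n, Set.EqOn (fun t => (q e).eval t) g
      (Set.uIoo (x.node e) (x.node (e + 1))) := fun e he t ht => by
    rw [Set.uIoo_of_lt (x.node_lt e he)] at ht
    exact (h e he t ht).symm
  have additive := intervalIntegral.sum_integral_adjacent_intervals (f := g) (a := x.node) (n := n)
    (μ := MeasureTheory.volume)
    fun e he => (intervalIntegrable_eval (q e) _ _).congr_uIoo (eqOn e he)
  rw [x.node_zero, x.node_last] at additive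
  rw [← additive]
  exact Finset.sum_congr rfl fun e he =>
    (intervalIntegral.integral_congr_uIoo (eqOn e (Finset.mem_range.1 he))).symm

theorem mass_apply (p : ℕ) (i j : Fin (bc.dof n p)) : x.mass bc p i j =
    ∑ e ∈ Finset.range n, polyInt (x.node e) (x.node (e + 1))
      (x.basisPoly bc i e * x.basisPoly bc j e) := by
  refine x.integral_eq_sum_polyInt fun e he t ht => ?_
  rw [eval_mul, x.basis_eq_eval_basisPoly bc he ht.1.le ht.2.le,
    x.basis_eq_eval_basisPoly bc he ht.1.le ht.2.le]

theorem stiffness_apply (p : ℕ) (i j : Fin (bc.dof n p)) : x.stiffness bc p i j =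
    ∑ e ∈ Finset.range n, polyInt (x.node e) (x.node (e + 1))
      (derivative (x.basisPoly bc i e) * derivative (x.basisPoly bc j e)) := by
  refine x.integral_eq_sum_polyInt fun e he t ht => ?_
  rw [eval_mul, x.deriv_basis_eq_eval bc he ht, x.deriv_basis_eq_eval bc he ht]

theorem mass_isSymm (p : ℕ) : (x.mass bc p).IsSymm := by
  ext i j
  simp only [Matrix.transpose_apply, mass, Matrix.of_apply, mul_comm]

theorem stiffness_isSymm (p : ℕ) : (x.stiffness bc p).IsSymm := by
  ext i j
  simp only [Matrix.transpose_apply, stiffness, Matrix.of_apply, mul_comm]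

theorem natDegree_hatPoly_le (j e : ℕ) : (x.hatPoly j e).natDegree ≤ 1 := by
  unfold hatPoly
  split_ifs
  · exact (natDegree_C_mul_le _ _).trans (natDegree_X_sub_C_le _)
  · refine (natDegree_C_mul_le _ _).trans ?_
    rw [← natDegree_neg, neg_sub]
    exact natDegree_X_sub_C_le _
  · rw [natDegree_zero]
    exact zero_le_one

theorem natDegree_basisPoly_of_eq_mod {i e : ℕ} (he : e < n) (hi : bc.numHats n ≤ i)
    (hei : e = (i - bc.numHats n) % n) :
    (x.basisPoly bc i e).natDegree = (i - bc.numHats n) / n + 2 := by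
  rw [basisPoly_of_eq_mod hi hei, natDegree_comp, natDegree_toRef (x.node_lt e he),
    natDegree_bubbleW, mul_one]

theorem natDegree_basisPoly_le {i e : ℕ} (he : e < n) (hi : bc.numHats n ≤ i) :
    (x.basisPoly bc i e).natDegree ≤ (i - bc.numHats n) / n + 2 := by
  rcases eq_or_ne e ((i - bc.numHats n) % n) with onElement | offElement
  · rw [natDegree_basisPoly_of_eq_mod x bc he hi onElement]
  · rw [basisPoly_of_ne_mod hi offElement, natDegree_zero]
    exact Nat.zero_le _

theorem eval_hatPoly_node {j e : ℕ} (he : e < n) :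
    (x.hatPoly j e).eval (x.node e) = if e = j then 1 else 0 := by
  have hlen : x.node (e + 1) - x.node e ≠ 0 := (sub_pos.2 (x.node_lt e he)).ne'
  unfold hatPoly
  split_ifs with hsucc hself hself
  · lia
  · simp
  · simp [hlen]
  · exact eval_zero

theorem eval_hatPoly_node_succ {j e : ℕ} (he : e < n) :
    (x.hatPoly j e).eval (x.node (e + 1)) = if e + 1 = j then 1 else 0 := by
  have hlen : x.node (e + 1) - x.node e ≠ 0 := (sub_pos.2 (x.node_lt e he)).ne'
  unfold hatPoly
  split_ifs <;> simp [hlen]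

/-- The polynomial with which the finite element function with coefficients `v` coincides on
element `e`. -/
def elemPoly {p : ℕ} (v : Fin (bc.dof n p) → ℝ) (e : ℕ) : ℝ[X] :=
  ∑ i, v i • x.basisPoly bc i e

theorem dotProduct_mulVec_eq_sum_polyInt {N : ℕ} {q : Fin N → ℕ → ℝ[X]}
    {G : Matrix (Fin N) (Fin N) ℝ}
    (hG : ∀ i j, G i j = ∑ e ∈ Finset.range n, polyInt (x.node e) (x.node (e + 1))
      (q i e * q j e)) (v : Fin N → ℝ) :
    v ⬝ᵥ G.mulVec v = ∑ e ∈ Finset.range n, polyInt (x.node e) (x.node (e + 1))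
      ((∑ i, v i • q i e) ^ 2) := by
  simp only [dotProduct, Matrix.mulVec, hG, pow_two, map_sum, smul_mul_smul_comm,
    map_smul, smul_eq_mul, Finset.mul_sum, Finset.sum_mul]
  rw [Finset.sum_comm' (t' := Finset.univ) (s' := fun _ => Finset.range n) (by simp),
    Finset.sum_comm]
  refine Finset.sum_congr rfl fun i _ => ?_
  rw [Finset.sum_comm]
  exact Finset.sum_congr rfl fun e _ => Finset.sum_congr rfl fun j _ => by ring

theorem mass_quadratic {p : ℕ} (v : Fin (bc.dof n p) → ℝ) : v ⬝ᵥ (x.mass bc p).mulVec v =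
    ∑ e ∈ Finset.range n, polyInt (x.node e) (x.node (e + 1)) (x.elemPoly bc v e ^ 2) :=
  x.dotProduct_mulVec_eq_sum_polyInt (x.mass_apply bc p) v

theorem stiffness_quadratic {p : ℕ} (v : Fin (bc.dof n p) → ℝ) :
    v ⬝ᵥ (x.stiffness bc p).mulVec v = ∑ e ∈ Finset.range n,
      polyInt (x.node e) (x.node (e + 1)) (derivative (x.elemPoly bc v e) ^ 2) := by
  rw [x.dotProduct_mulVec_eq_sum_polyInt (q := fun i e => derivative (x.basisPoly bc i e))
    (x.stiffness_apply bc p) v]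
  simp only [elemPoly, derivative_sum, derivative_smul]

end Mesh

/-! ### The sparsity pattern of the finite element matrices -/

/-- Unknown `j < i` is coupled with unknown `i`: the supports of the two basis functions share an
element on which they are not orthogonal. Here `f` is the index of the first hat function, `H` the
number of hat functions and `n` the number of elements. Hat functions are coupled with their
neighbours, bubbles of index at most one with the hats of their element, and bubbles on the same
element if their indices differ by at most two. -/
def Coupled (f H n i j : ℕ) : Prop :=
  j < i ∧ ((i < H ∧ j + 1 = i) ∨
    (H ≤ i ∧ j < H ∧ (i - H) / n ≤ 1 ∧ (f + j = (i - H) % n ∨ f + j = (i - H) % n + 1)) ∨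
    (H ≤ j ∧ (j - H) % n = (i - H) % n ∧ (i - H) / n ≤ (j - H) / n + 2))

theorem div_lt_div_of_mod_eq {n r s : ℕ} (h : r < s) (hm : r % n = s % n) : r / n < s / n := by
  have hr := Nat.div_add_mod r n
  have hs := Nat.div_add_mod s n
  exact Nat.lt_of_mul_lt_mul_left (a := n) (by lia)

namespace Coupled

variable {f H n i j k : ℕ}

theorem eq_sub_one_of_lt (h : Coupled f H n i j) (hi : i < H) : j = i - 1 := by
  obtain ⟨hlt, h⟩ := h
  lia

theorem mem_of_ge (h : Coupled f H n i j) (hi : H ≤ i) :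
    j ∈ ({(i - H) % n - f, (i - H) % n + 1 - f, H + (n * ((i - H) / n - 1) + (i - H) % n),
      H + (n * ((i - H) / n - 2) + (i - H) % n)} : Finset ℕ) := by
  obtain ⟨hlt, hats | hatBubble | ⟨hj, sameElement, close⟩⟩ := h
  · lia
  · simp only [Finset.mem_insert, Finset.mem_singleton]
    lia
  · have hdiv := div_lt_div_of_mod_eq (by lia : j - H < i - H) sameElement
    have hdecomp := Nat.div_add_mod (j - H) n
    simp only [Finset.mem_insert, Finset.mem_singleton]
    rcases (by lia : (j - H) / n = (i - H) / n - 1 ∨ (j - H) / n = (i - H) / n - 2) with h | h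
    · exact .inr (.inr (.inl (by rw [← h, ← sameElement, hdecomp]; lia)))
    · exact .inr (.inr (.inr (by rw [← h, ← sameElement, hdecomp]; lia)))

theorem clique (hi : Coupled f H n k i) (hj : Coupled f H n k j) (hji : j < i) :
    Coupled f H n i j := by
  obtain ⟨hik, hi⟩ := hi
  obtain ⟨_, hj⟩ := hj
  refine ⟨hji, ?_⟩
  rcases hi with hats | hatBubble | ⟨hiH, sameElement, _⟩
  · rcases hj with hj | hj | hj <;> lia
  · rcases hj with hj | hj | hj <;> lia
  · have hdiv := div_lt_div_of_mod_eq (by lia : i - H < k - H) sameElement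
    rcases hj with hj | ⟨_, hjH, _, hadj⟩ | ⟨hjH, sameElement', _⟩
    · lia
    · exact .inr (.inl ⟨hiH, hjH, by lia, by rwa [sameElement]⟩)
    · exact .inr (.inr ⟨hjH, sameElement'.trans sameElement.symm, by lia⟩)

end Coupled

open Classical in
/-- The sparsity pattern of the finite element matrices. -/
def femPattern (bc : BC) (n p : ℕ) : Pattern (bc.dof n p) where
  lo i := Finset.univ.filter fun j => Coupled bc.firstHat (bc.numHats n) n i j
  lt_of_mem h := (Finset.mem_filter.1 h).2.1
  card_le i := by
    rcases lt_or_ge (i : ℕ) (bc.numHats n) with hi | hi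
    · refine (Finset.card_le_card_of_injOn (t := ({(i : ℕ) - 1} : Finset ℕ)) Fin.val
        (fun j hj => ?_) Fin.val_injective.injOn).trans (by simp)
      simp [(Finset.mem_filter.1 hj).2.eq_sub_one_of_lt hi]
    · exact (Finset.card_le_card_of_injOn Fin.val
        (fun j hj => (Finset.mem_filter.1 hj).2.mem_of_ge hi)
        Fin.val_injective.injOn).trans Finset.card_le_four
  clique hi hj hji := Finset.mem_filter.2 ⟨Finset.mem_univ _,
    (Finset.mem_filter.1 hi).2.clique (Finset.mem_filter.1 hj).2 hji⟩

theorem mem_femPattern {bc : BC} {n p : ℕ} {i j : Fin (bc.dof n p)} :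
    j ∈ (femPattern bc n p).lo i ↔ Coupled bc.firstHat (bc.numHats n) n i j := by
  simp [femPattern]

namespace Mesh

variable {a b : ℝ} {n p : ℕ} (x : Mesh a b n) (bc : BC)

section Uncoupled

variable {x bc} {e i j : ℕ}

theorem basisPoly_eq_zero_or_of_hats (hi : i < bc.numHats n) (hji : j < i) (hne : j + 1 ≠ i) :
    x.basisPoly bc i e = 0 ∨ x.basisPoly bc j e = 0 := by
  rw [basisPoly_of_lt hi, basisPoly_of_lt (hji.trans hi)]
  by_cases hadj : e = bc.firstHat + i ∨ e + 1 = bc.firstHat + i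
  · exact .inr (hatPoly_eq_zero (by lia) (by lia))
  · exact .inl (hatPoly_eq_zero (by lia) (by lia))

theorem basisPoly_eq_zero_or_natDegree_lt (he : e < n) (hi : bc.numHats n ≤ i)
    (hei : e = (i - bc.numHats n) % n) (hji : j < i)
    (h : ¬ Coupled bc.firstHat (bc.numHats n) n i j) :
    x.basisPoly bc j e = 0 ∨ (x.basisPoly bc j e).natDegree < (i - bc.numHats n) / n := by
  rcases lt_or_ge j (bc.numHats n) with hj | hj
  · rw [basisPoly_of_lt hj]
    by_cases low : (i - bc.numHats n) / n ≤ 1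
    · exact .inl (hatPoly_eq_zero
        (fun hself => h ⟨hji, .inr (.inl ⟨hi, hj, low, by lia⟩)⟩)
        (fun hsucc => h ⟨hji, .inr (.inl ⟨hi, hj, low, by lia⟩)⟩))
    · exact .inr ((x.natDegree_hatPoly_le _ _).trans_lt (not_le.1 low))
  · by_cases hej : e = (j - bc.numHats n) % n
    · refine .inr ((x.natDegree_basisPoly_le bc he hj).trans_lt (not_le.1 fun close => ?_))
      exact h ⟨hji, .inr (.inr ⟨hj, hej.symm.trans hei, close⟩)⟩
    · exact .inl (basisPoly_of_ne_mod hj hej)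

theorem basisPoly_eq_zero_or_bubble_of_not_coupled (he : e < n) (hji : j < i)
    (h : ¬ Coupled bc.firstHat (bc.numHats n) n i j) :
    x.basisPoly bc i e = 0 ∨ x.basisPoly bc j e = 0 ∨
      ∃ k, x.basisPoly bc i e = (bubbleW k).comp (toRef (x.node e) (x.node (e + 1))) ∧
        (x.basisPoly bc j e).natDegree < k := by
  rcases lt_or_ge i (bc.numHats n) with hi | hi
  · exact (basisPoly_eq_zero_or_of_hats hi hji fun hne => h ⟨hji, .inl ⟨hi, hne⟩⟩).imp_right .inl
  · by_cases hei : e = (i - bc.numHats n) % n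
    · exact .inr ((basisPoly_eq_zero_or_natDegree_lt he hi hei hji h).imp_right fun hdeg =>
        ⟨_, basisPoly_of_eq_mod hi hei, hdeg⟩)
    · exact .inl (basisPoly_of_ne_mod hi hei)

theorem polyInt_basisPoly_mul_eq_zero (he : e < n) (hji : j < i)
    (h : ¬ Coupled bc.firstHat (bc.numHats n) n i j) :
    polyInt (x.node e) (x.node (e + 1)) (x.basisPoly bc i e * x.basisPoly bc j e) = 0 := by
  rcases basisPoly_eq_zero_or_bubble_of_not_coupled (x := x) he hji h with
    hzero | hzero | ⟨k, bubble, hdeg⟩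
  · rw [hzero, zero_mul, map_zero]
  · rw [hzero, mul_zero, map_zero]
  · rw [bubble, polyInt_bubble_mul (x.node_lt e he) hdeg]

theorem polyInt_derivative_basisPoly_mul_eq_zero (he : e < n) (hji : j < i)
    (h : ¬ Coupled bc.firstHat (bc.numHats n) n i j) :
    polyInt (x.node e) (x.node (e + 1))
      (derivative (x.basisPoly bc i e) * derivative (x.basisPoly bc j e)) = 0 := by
  rcases basisPoly_eq_zero_or_bubble_of_not_coupled (x := x) he hji h with
    hzero | hzero | ⟨k, bubble, hdeg⟩
  · rw [hzero, derivative_zero, zero_mul, map_zero]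
  · rw [hzero, derivative_zero, mul_zero, map_zero]
  · rw [bubble, polyInt_derivative_bubble_mul (x.node_lt e he)
      ((natDegree_derivative_le _).trans_lt (by lia))]

end Uncoupled

theorem mass_conforms (p : ℕ) : (femPattern bc n p).Conforms (x.mass bc p) := by
  refine ⟨x.mass_isSymm bc p, fun i j hji hj => ?_⟩
  rw [mass_apply]
  exact Finset.sum_eq_zero fun e he => polyInt_basisPoly_mul_eq_zero (Finset.mem_range.1 he) hji
    fun h => hj (mem_femPattern.2 h)

theorem stiffness_conforms (p : ℕ) : (femPattern bc n p).Conforms (x.stiffness bc p) := by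
  refine ⟨x.stiffness_isSymm bc p, fun i j hji hj => ?_⟩
  rw [stiffness_apply]
  exact Finset.sum_eq_zero fun e he => polyInt_derivative_basisPoly_mul_eq_zero
    (Finset.mem_range.1 he) hji fun h => hj (mem_femPattern.2 h)

theorem screened_conforms (ω : ℝ) (p : ℕ) :
    (femPattern bc n p).Conforms (x.screened bc ω p) :=
  (x.stiffness_conforms bc p).add ((x.mass_conforms bc p).smul _)

/-! ### Linear independence of the basis -/

section LinearIndependence

variable {x bc} {i : ℕ}

theorem exists_functional_of_hat (hn : 0 < n) (hi : i < bc.numHats n) :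
    ∃ e < n, ∃ φ : ℝ[X] →ₗ[ℝ] ℝ,
      φ (x.basisPoly bc i e) ≠ 0 ∧ ∀ j < i, φ (x.basisPoly bc j e) = 0 := by
  have hle := BC.firstHat_add_le hi
  rcases Nat.eq_zero_or_pos (bc.firstHat + i) with hfirst | hpos
  · refine ⟨0, hn, leval (x.node 0), ?_, fun j hj => by lia⟩
    rw [basisPoly_of_lt hi, leval_apply, x.eval_hatPoly_node hn, if_pos hfirst.symm]
    exact one_ne_zero
  · have he : bc.firstHat + i - 1 < n := by lia
    refine ⟨_, he, leval (x.node (bc.firstHat + i - 1 + 1)), ?_, fun j hj => ?_⟩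
    · rw [basisPoly_of_lt hi, leval_apply, x.eval_hatPoly_node_succ he, if_pos (by lia)]
      exact one_ne_zero
    · rw [basisPoly_of_lt (hj.trans hi), leval_apply, x.eval_hatPoly_node_succ he,
        if_neg (by lia)]

theorem exists_functional_of_bubble (hn : 0 < n) (hi : bc.numHats n ≤ i) :
    ∃ e < n, ∃ φ : ℝ[X] →ₗ[ℝ] ℝ,
      φ (x.basisPoly bc i e) ≠ 0 ∧ ∀ j < i, φ (x.basisPoly bc j e) = 0 := by
  have he : (i - bc.numHats n) % n < n := Nat.mod_lt _ hn
  have hdeg := x.natDegree_basisPoly_of_eq_mod bc he hi rfl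
  refine ⟨_, he, lcoeff ℝ ((i - bc.numHats n) / n + 2), ?_, fun j hji => ?_⟩
  · rw [lcoeff_apply, ← hdeg, coeff_natDegree, Ne, leadingCoeff_eq_zero]
    intro hzero
    rw [hzero, natDegree_zero] at hdeg
    exact Nat.succ_ne_zero _ hdeg.symm
  · rw [lcoeff_apply]
    rcases lt_or_ge j (bc.numHats n) with hj | hj
    · rw [basisPoly_of_lt hj]
      exact coeff_eq_zero_of_natDegree_lt ((x.natDegree_hatPoly_le _ _).trans_lt (by lia))
    · by_cases hej : (i - bc.numHats n) % n = (j - bc.numHats n) % n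
      · have hdiv := div_lt_div_of_mod_eq (by lia : j - bc.numHats n < i - bc.numHats n) hej.symm
        exact coeff_eq_zero_of_natDegree_lt
          ((x.natDegree_basisPoly_le bc he hj).trans_lt (by lia))
      · rw [basisPoly_of_ne_mod hj hej, coeff_zero]

/-- The basis is triangular with respect to the functionals of `exists_functional_of_hat` and
`exists_functional_of_bubble`, so the coefficients vanish one after the other from the last one. -/
theorem eq_zero_of_elemPoly_eq_zero (hn : 0 < n) {v : Fin (bc.dof n p) → ℝ}
    (h : ∀ e < n, x.elemPoly bc v e = 0) : v = 0 := by
  refine funext fun i => wellFounded_gt.induction (C := fun i => v i = 0) i fun i later => ?_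
  obtain ⟨e, he, φ, hne, hlt⟩ := (lt_or_ge (i : ℕ) (bc.numHats n)).elim
    (exists_functional_of_hat (x := x) hn) (exists_functional_of_bubble hn)
  have hsum : ∑ j, v j * φ (x.basisPoly bc j e) = 0 := by
    simpa only [elemPoly, map_sum, map_smul, smul_eq_mul, map_zero] using congrArg φ (h e he)
  rw [Finset.sum_eq_single i (fun j _ hji => ?_) (by simp)] at hsum
  · exact (mul_eq_zero.1 hsum).resolve_right hne
  · rcases lt_or_gt_of_ne hji with hlt_i | hgt_i
    · rw [hlt j hlt_i, mul_zero]
    · rw [later j hgt_i, zero_mul]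

end LinearIndependence

end Mesh

/-! ### Bounds of the generalised eigenvalues -/

theorem abs_eval_sub_le_integral {α β t : ℝ} (V : ℝ[X]) (hl : α ≤ t) (hr : t ≤ β) :
    |V.eval t - V.eval α| ≤ ∫ s in α..β, |(derivative V).eval s| := by
  rw [← polyInt_derivative, polyInt_apply]
  exact (intervalIntegral.abs_integral_le_integral_abs hl).trans
    (intervalIntegral.integral_mono_interval le_rfl hl hr
      (Filter.Eventually.of_forall fun t => abs_nonneg _)
      ((derivative V).continuous.abs.intervalIntegrable α β))

/-- A lower bound of the generalised eigenvalues of the screened Laplacian on `[a, b]`: the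
Poincaré constant for Dirichlet conditions and the screening term for Neumann conditions. -/
def BC.eigLower (bc : BC) (a b ω : ℝ) : ℝ :=
  match bc with
  | .dirichlet => 1 / (b - a) ^ 2
  | .neumann => ω ^ 2 / 2

theorem BC.eigLower_pos {bc : BC} {a b ω : ℝ} (hab : a < b) (hω : bc = BC.neumann → ω ≠ 0) :
    0 < bc.eigLower a b ω := by
  cases bc with
  | dirichlet => exact one_div_pos.2 (pow_pos (sub_pos.2 hab) 2)
  | neumann => exact half_pos (sq_pos_of_ne_zero (hω rfl))

namespace Mesh

variable {a b : ℝ} {n : ℕ} (x : Mesh a b n) (bc : BC) {p : ℕ}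

theorem lt (x : Mesh a b n) (hn : 0 < n) : a < b := by
  have hlt := x.node_lt_node hn le_rfl
  rwa [x.node_zero, x.node_last] at hlt

theorem sum_length : ∑ e ∈ Finset.range n, (x.node (e + 1) - x.node e) = b - a := by
  rw [Finset.sum_range_sub, x.node_zero, x.node_last]

theorem mass_posDef (hn : 0 < n) : (x.mass bc p).PosDef := by
  refine Matrix.PosDef.of_dotProduct_mulVec_pos ?_ fun v hv => ?_
  · rw [Matrix.IsHermitian, Matrix.conjTranspose_eq_transpose_of_trivial, x.mass_isSymm]
  · rw [star_trivial, x.mass_quadratic]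
    have nonneg : ∀ e ∈ Finset.range n, 0 ≤ polyInt (x.node e) (x.node (e + 1))
        (x.elemPoly bc v e ^ 2) := fun e he =>
      polyInt_sq_nonneg (x.node_lt e (Finset.mem_range.1 he)).le _
    refine lt_of_le_of_ne (Finset.sum_nonneg nonneg) fun hzero => hv ?_
    refine eq_zero_of_elemPoly_eq_zero (x := x) hn fun e he => ?_
    exact eq_zero_of_polyInt_sq_eq_zero (x.node_lt e he)
      ((Finset.sum_eq_zero_iff_of_nonneg nonneg).1 hzero.symm e (Finset.mem_range.2 he))

theorem stiffness_nonneg (v : Fin (bc.dof n p) → ℝ) : 0 ≤ v ⬝ᵥ (x.stiffness bc p).mulVec v := by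
  rw [x.stiffness_quadratic]
  exact Finset.sum_nonneg fun e he =>
    polyInt_sq_nonneg (x.node_lt e (Finset.mem_range.1 he)).le _

section Poincare

theorem eval_elemPoly (v : Fin (bc.dof n p) → ℝ) (e : ℕ) (t : ℝ) :
    (x.elemPoly bc v e).eval t = ∑ i, v i * (x.basisPoly bc i e).eval t := by
  simp [elemPoly, eval_finsetSum]

theorem eval_elemPoly_succ (v : Fin (bc.dof n p) → ℝ) {e : ℕ} (he : e + 1 < n) :
    (x.elemPoly bc v (e + 1)).eval (x.node (e + 1)) =
      (x.elemPoly bc v e).eval (x.node (e + 1)) := by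
  rw [eval_elemPoly, eval_elemPoly]
  refine Finset.sum_congr rfl fun i _ => ?_
  rw [← x.basis_eq_eval_basisPoly bc (by lia : e < n) (x.node_lt e (by lia)).le le_rfl,
    ← x.basis_eq_eval_basisPoly bc he le_rfl (x.node_lt (e + 1) he).le]

theorem eval_elemPoly_dirichlet_zero (hn : 0 < n) (v : Fin (BC.dirichlet.dof n p) → ℝ) :
    (x.elemPoly .dirichlet v 0).eval (x.node 0) = 0 := by
  rw [eval_elemPoly]
  refine Finset.sum_eq_zero fun i _ => mul_eq_zero_of_right _ ?_
  rcases lt_or_ge (i : ℕ) (BC.dirichlet.numHats n) with hi | hi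
  · rw [basisPoly_of_lt hi, x.eval_hatPoly_node hn, if_neg (by simp only [BC.firstHat]; lia)]
  · by_cases onElement : 0 = (i - BC.dirichlet.numHats n) % n
    · rw [basisPoly_of_eq_mod hi onElement,
        eval_bubble_eq_zero_of_endpoint (x.node_lt 0 hn) _ (.inl rfl)]
    · rw [basisPoly_of_ne_mod hi onElement, eval_zero]

/-- The total variation on element `e` of the finite element function with coefficients `v`. -/
def elemVariation (v : Fin (bc.dof n p) → ℝ) (e : ℕ) : ℝ :=
  ∫ s in x.node e..x.node (e + 1), |(derivative (x.elemPoly bc v e)).eval s|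

theorem elemVariation_nonneg (v : Fin (bc.dof n p) → ℝ) {e : ℕ} (he : e < n) :
    0 ≤ x.elemVariation bc v e :=
  intervalIntegral.integral_nonneg (x.node_lt e he).le fun _ _ => abs_nonneg _

theorem abs_eval_elemPoly_dirichlet_le_sum (v : Fin (BC.dirichlet.dof n p) → ℝ) {e : ℕ}
    (he : e < n) {t : ℝ} (ht : t ∈ Set.Icc (x.node e) (x.node (e + 1))) :
    |(x.elemPoly .dirichlet v e).eval t| ≤
      ∑ e' ∈ Finset.range (e + 1), x.elemVariation .dirichlet v e' := by
  induction e generalizing t with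
  | zero =>
    have variation := abs_eval_sub_le_integral (x.elemPoly .dirichlet v 0) ht.1 ht.2
    rw [x.eval_elemPoly_dirichlet_zero he, sub_zero] at variation
    simpa only [zero_add, Finset.sum_range_one, elemVariation] using variation
  | succ e ih =>
    have variation := abs_eval_sub_le_integral (x.elemPoly .dirichlet v (e + 1)) ht.1 ht.2
    rw [x.eval_elemPoly_succ _ v he] at variation
    have previous := ih (by lia) (Set.right_mem_Icc.2 (x.node_lt e (by lia)).le)
    have triangle := abs_sub_abs_le_abs_sub ((x.elemPoly .dirichlet v (e + 1)).eval t)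
      ((x.elemPoly .dirichlet v e).eval (x.node (e + 1)))
    rw [Finset.sum_range_succ, elemVariation]
    linarith

theorem sq_sum_elemVariation_le (hn : 0 < n) (v : Fin (bc.dof n p) → ℝ) :
    (∑ e ∈ Finset.range n, x.elemVariation bc v e) ^ 2 ≤
      (b - a) * (v ⬝ᵥ (x.stiffness bc p).mulVec v) := by
  have length_pos : ∀ e ∈ Finset.range n, 0 < x.node (e + 1) - x.node e := fun e he =>
    sub_pos.2 (x.node_lt e (Finset.mem_range.1 he))
  have sedrakyan := Finset.sq_sum_div_le_sum_sq_div (Finset.range n) (x.elemVariation bc v)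
    length_pos
  rw [x.sum_length, div_le_iff₀ (sub_pos.2 (x.lt hn)), mul_comm] at sedrakyan
  rw [x.stiffness_quadratic]
  refine sedrakyan.trans (mul_le_mul_of_nonneg_left (Finset.sum_le_sum fun e he => ?_)
    (sub_pos.2 (x.lt hn)).le)
  rw [div_le_iff₀' (length_pos e he)]
  exact sq_integral_abs_le (x.node_lt e (Finset.mem_range.1 he)) _

theorem mass_le_stiffness (hn : 0 < n) (v : Fin (BC.dirichlet.dof n p) → ℝ) :
    v ⬝ᵥ (x.mass .dirichlet p).mulVec v ≤
      (b - a) ^ 2 * (v ⬝ᵥ (x.stiffness .dirichlet p).mulVec v) := by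
  set V := ∑ e ∈ Finset.range n, x.elemVariation .dirichlet v e
  have elementwise : ∀ e ∈ Finset.range n,
      polyInt (x.node e) (x.node (e + 1)) (x.elemPoly .dirichlet v e ^ 2) ≤
        (x.node (e + 1) - x.node e) * V ^ 2 := by
    intro e he
    have hen := Finset.mem_range.1 he
    refine polyInt_le_of_eval_le (x.node_lt e hen).le fun t ht => ?_
    rw [eval_pow, ← sq_abs]
    refine pow_le_pow_left₀ (abs_nonneg _)
      ((x.abs_eval_elemPoly_dirichlet_le_sum v hen ht).trans ?_) 2
    exact Finset.sum_le_sum_of_subset_of_nonneg (Finset.range_subset_range.2 hen)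
      fun i hi _ => x.elemVariation_nonneg _ v (Finset.mem_range.1 hi)
  calc v ⬝ᵥ (x.mass .dirichlet p).mulVec v
      ≤ ∑ e ∈ Finset.range n, (x.node (e + 1) - x.node e) * V ^ 2 := by
        rw [x.mass_quadratic]
        exact Finset.sum_le_sum elementwise
    _ = (b - a) * V ^ 2 := by rw [← Finset.sum_mul, x.sum_length]
    _ ≤ (b - a) * ((b - a) * (v ⬝ᵥ (x.stiffness .dirichlet p).mulVec v)) :=
      mul_le_mul_of_nonneg_left (x.sq_sum_elemVariation_le _ hn v) (sub_pos.2 (x.lt hn)).le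
    _ = _ := by ring

end Poincare

theorem screened_quadratic (ω : ℝ) (v : Fin (bc.dof n p) → ℝ) :
    v ⬝ᵥ (x.screened bc ω p).mulVec v = v ⬝ᵥ (x.stiffness bc p).mulVec v +
      ω ^ 2 / 2 * (v ⬝ᵥ (x.mass bc p).mulVec v) := by
  rw [screened, Matrix.add_mulVec, dotProduct_add, Matrix.smul_mulVec, dotProduct_smul,
    smul_eq_mul]

theorem eigLower_mul_mass_le_screened (hn : 0 < n) (ω : ℝ) (v : Fin (bc.dof n p) → ℝ) :
    bc.eigLower a b ω * (v ⬝ᵥ (x.mass bc p).mulVec v) ≤ v ⬝ᵥ (x.screened bc ω p).mulVec v := by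
  have mass_nonneg : 0 ≤ v ⬝ᵥ (x.mass bc p).mulVec v := by
    simpa using (x.mass_posDef bc hn).posSemidef.dotProduct_mulVec_nonneg v
  rw [x.screened_quadratic]
  cases bc with
  | dirichlet =>
    have hab : 0 < b - a := sub_pos.2 (x.lt hn)
    refine le_trans ?_ (le_add_of_nonneg_right (mul_nonneg (by positivity) mass_nonneg))
    rw [BC.eigLower, one_div_mul_eq_div, div_le_iff₀' (by positivity)]
    exact x.mass_le_stiffness hn v
  | neumann => exact le_add_of_nonneg_left (x.stiffness_nonneg .neumann v)

theorem screened_posDef (hn : 0 < n) {ω : ℝ} (hω : bc = BC.neumann → ω ≠ 0) :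
    (x.screened bc ω p).PosDef := by
  refine Matrix.PosDef.of_dotProduct_mulVec_pos ?_ fun v hv => ?_
  · rw [Matrix.IsHermitian, Matrix.conjTranspose_eq_transpose_of_trivial,
      (x.screened_conforms bc ω p).1]
  · have mass_pos := (x.mass_posDef bc hn (p := p)).dotProduct_mulVec_pos hv
    rw [star_trivial] at *
    exact (mul_pos (BC.eigLower_pos (x.lt hn) hω) mass_pos).trans_le
      (x.eigLower_mul_mass_le_screened bc hn ω v)

theorem natDegree_elemPoly_le (hp : 1 ≤ p) (v : Fin (bc.dof n p) → ℝ) {e : ℕ} (he : e < n) :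
    (x.elemPoly bc v e).natDegree ≤ p := by
  refine natDegree_sum_le_of_forall_le _ _ fun i _ => (natDegree_smul_le _ _).trans ?_
  rcases lt_or_ge (i : ℕ) (bc.numHats n) with hi | hi
  · rw [basisPoly_of_lt hi]
    exact (x.natDegree_hatPoly_le _ _).trans hp
  · have hlt : (i : ℕ) < bc.numHats n + n * (p - 1) := i.2
    have hdiv : ((i : ℕ) - bc.numHats n) / n < p - 1 := Nat.div_lt_of_lt_mul (by lia)
    exact (x.natDegree_basisPoly_le bc he hi).trans (by lia)

theorem QuasiUniform.mul_le_mul_length {x : Mesh a b n} {ρ : ℝ} (h : x.QuasiUniform ρ) {e : ℕ}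
    (he : e < n) : ρ * (b - a) ≤ n * (x.node (e + 1) - x.node e) := by
  have hsum := Finset.sum_le_sum fun j hj => h e he j (Finset.mem_range.1 hj)
  rwa [← Finset.mul_sum, x.sum_length, Finset.sum_const, Finset.card_range, nsmul_eq_mul] at hsum

theorem stiffness_le_mass (hn : 0 < n) (hp : 1 ≤ p) {ρ : ℝ} (hρ : 0 < ρ) (h : x.QuasiUniform ρ)
    (v : Fin (bc.dof n p) → ℝ) : v ⬝ᵥ (x.stiffness bc p).mulVec v ≤
      256 * ((p : ℝ) + 1) ^ 8 * (n : ℝ) ^ 2 / (ρ * (b - a)) ^ 2 *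
        (v ⬝ᵥ (x.mass bc p).mulVec v) := by
  rw [x.mass_quadratic, x.stiffness_quadratic, Finset.mul_sum]
  refine Finset.sum_le_sum fun e he => ?_
  have hen := Finset.mem_range.1 he
  have hlt := x.node_lt e hen
  have : 0 < x.node (e + 1) - x.node e := sub_pos.2 hlt
  have : 0 < b - a := sub_pos.2 (x.lt hn)
  refine (polyInt_derivative_sq_le (x.natDegree_elemPoly_le bc hp v hen) hlt).trans
    (mul_le_mul_of_nonneg_right ?_ (polyInt_sq_nonneg hlt.le _))
  rw [div_le_div_iff₀ (by positivity) (by positivity), mul_assoc _ ((n : ℝ) ^ 2), ← mul_pow]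
  exact mul_le_mul_of_nonneg_left
    (pow_le_pow_left₀ (by positivity) (h.mul_le_mul_length hen) 2) (by positivity)

theorem mem_Icc_of_mem_genSpectrum (hn : 0 < n) (hp : 1 ≤ p) {ρ ω : ℝ} (hρ : 0 < ρ)
    (h : x.QuasiUniform ρ) {μ : ℝ} (hμ : μ ∈ genSpectrum (x.screened bc ω p) (x.mass bc p)) :
    μ ∈ Set.Icc (bc.eigLower a b ω)
      (256 * ((p : ℝ) + 1) ^ 8 * (n : ℝ) ^ 2 / (ρ * (b - a)) ^ 2 + ω ^ 2 / 2) := by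
  obtain ⟨v, hv, eigen⟩ := mem_genSpectrum_iff.1 hμ
  have mass_pos := (x.mass_posDef bc hn (p := p)).dotProduct_mulVec_pos hv
  rw [star_trivial] at mass_pos
  have rayleigh : v ⬝ᵥ (x.screened bc ω p).mulVec v = μ * (v ⬝ᵥ (x.mass bc p).mulVec v) := by
    rw [eigen, dotProduct_smul, smul_eq_mul]
  have lower := x.eigLower_mul_mass_le_screened bc hn ω v
  have upper := x.stiffness_le_mass bc hn hp hρ h v
  rw [rayleigh] at lower
  rw [x.screened_quadratic] at rayleigh
  refine ⟨le_of_mul_le_mul_right lower mass_pos, le_of_mul_le_mul_right ?_ mass_pos⟩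
  rw [← rayleigh, add_mul]
  linarith

end Mesh

/-! ### The programs -/

section Layout

variable {M N : ℕ}

/-- The number of entries of the four coefficient matrices. -/
def coeffLength (M N : ℕ) : ℕ := M * M + N * N + N * N + M * M

theorem HoldsCoeffs.of_matList (A D : Matrix (Fin M) (Fin M) ℝ) (B C : Matrix (Fin N) (Fin N) ℝ) :
    HoldsCoeffs (matList A ++ matList B ++ matList C ++ matList D) (matAddr 0)
      (matAddr (M * M)) (matAddr (M * M + N * N)) (matAddr (M * M + N * N + N * N)) A B C D where
  A := (((holdsMat_matList [] A rfl).append _).append _).append _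
  B := ((holdsMat_matList _ B (length_matList _).symm).append _).append _
  C := (holdsMat_matList _ C (by simp only [List.length_append, length_matList])).append _
  D := holdsMat_matList _ D (by simp only [List.length_append, length_matList])

theorem HoldsVec.append {ι : Type} {mem : List ℝ} {t : ι → ℕ} {v : ι → ℝ} (h : HoldsVec mem t v)
    (l : List ℝ) : HoldsVec (mem ++ l) t v :=
  h.mono (List.prefix_append _ _)

theorem holdsVec_ofFn {J o : ℕ} (l : List ℝ) (v : Fin J → ℝ) (ho : o = l.length) :
    HoldsVec (l ++ List.ofFn v) (fun j : Fin J => o + j) v := fun j =>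
  Holds.append_right (i := j) (by simp [Holds]) (by rw [ho])

theorem holdsMat_flatten {J o : ℕ} (l : List ℝ) (X : Fin J → Matrix (Fin M) (Fin N) ℝ)
    (ho : o = l.length) (j : Fin J) :
    HoldsMat (l ++ (List.ofFn fun j => matList (X j)).flatten) (matAddr (o + j * (M * N)))
      (X j) := by
  intro i k
  have index_lt : (i : ℕ) * N + k < M * N :=
    calc (i : ℕ) * N + k < (i + 1) * N := by rw [add_one_mul]; exact Nat.add_lt_add_left k.2 _
      _ ≤ M * N := Nat.mul_le_mul_right _ i.2
  refine Holds.append_right (i := j * (M * N) + (i * N + k)) ?_ (by rw [ho, matAddr, add_assoc])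
  rw [Holds, getElem?_flatten_ofFn _ (fun j => length_matList (X j)) j index_lt, getElem?_matList]

/-- The addresses of the shifts and factors for iteration `j` when the list `ADIData.toList` is
stored from address `o` on. -/
def stepAddr (M N J o : ℕ) (j : Fin J) : StepAddr M N :=
  (o + 4 + j, o + 4 + J + j, matAddr (o + 4 + J + J + j * (M * M)),
    matAddr (o + 4 + J + J + J * (M * M) + j * (N * N)))

theorem ADIData.length_toList (S : ADIData M N) :
    S.toList.length = 4 + S.J + S.J + S.J * (M * M) + S.J * (N * N) := by
  rw [toList, List.length_append, List.length_append,
    length_flatten_ofFn _ fun j => length_matList (S.L j),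
    length_flatten_ofFn _ fun j => length_matList (S.R j)]
  simp only [List.length_append, List.length_ofFn, List.length_cons, List.length_nil]

theorem holdsStep_stepAddr (l : List ℝ) (S : ADIData M N) (j : Fin S.J) :
    HoldsStep (l ++ S.toList) (stepAddr M N S.J l.length j) S j := by
  simp only [ADIData.toList, ← List.append_assoc]
  refine
    { p := (((holdsVec_ofFn _ S.p ?_).append _).append _).append _ j
      q := ((holdsVec_ofFn _ S.q ?_).append _).append _ j
      L := (holdsMat_flatten _ S.L ?_ j).append _
      R := holdsMat_flatten _ S.R ?_ j }
  on_goal 4 => rw [List.length_append, length_flatten_ofFn _ fun j => length_matList (S.L j)]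
  all_goals
    simp only [List.length_append, List.length_ofFn, List.length_cons, List.length_nil]

end Layout

/-- The precomputation program; extreme eigenvalues are computed to relative accuracy `1 / s`. -/
def preProg (s : ℕ) (bc : BC) (m n p : ℕ) : Prog :=
  let M := bc.dof m p
  let N := bc.dof n p
  (preFrag (femPattern bc m p) (femPattern bc n p) s (matAddr 0) (matAddr (M * M))
    (matAddr (M * M + N * N)) (matAddr (M * M + N * N + N * N)) (coeffLength M N)).toProg
    (coeffLength M N + 1)

/-- The solve program for `J` iterations. -/
def solveProg (bc : BC) (m n p J : ℕ) : Prog :=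
  let M := bc.dof m p
  let N := bc.dof n p
  let o := coeffLength M N + (4 + J + J + J * (M * M) + J * (N * N))
  (solveFrag (femPattern bc m p) (femPattern bc n p) J (matAddr 0) (matAddr (M * M))
    (matAddr (M * M + N * N)) (matAddr (M * M + N * N + N * N)) (matAddr o)
    (stepAddr M N J (coeffLength M N))).toProg (o + M * N)

theorem pre_cost_le {s J M N K : ℝ} (hs : 0 ≤ s) (hJ : 0 ≤ J) (hM₀ : 0 ≤ M) (hN₀ : 0 ≤ N)
    (hM : M ≤ K) (hN : N ≤ K) (hK : 1 ≤ K) :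
    (170 + 280 * s) * M ^ 2 + (172 + 280 * s) * N ^ 2 + 64 + J * (103 + 65 * (M + N)) ≤
      (406 + 560 * s) * (K ^ 2 + J * K) := by
  have one_le_sq : 1 ≤ K ^ 2 := one_le_pow₀ hK
  calc (170 + 280 * s) * M ^ 2 + (172 + 280 * s) * N ^ 2 + 64 + J * (103 + 65 * (M + N))
      ≤ (170 + 280 * s) * K ^ 2 + (172 + 280 * s) * K ^ 2 + 64 * K ^ 2 +
        J * (103 * K + 65 * (K + K)) := by
        gcongr <;> linarith
    _ = (406 + 560 * s) * K ^ 2 + 233 * (J * K) := by ring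
    _ ≤ (406 + 560 * s) * K ^ 2 + (406 + 560 * s) * (J * K) := by
        gcongr
        linarith
    _ = _ := by ring

theorem solve_cost_le {J M N K : ℝ} (hJ : 1 ≤ J) (hN₀ : 0 ≤ N) (hM : M ≤ K) (hN : N ≤ K)
    (hK : 1 ≤ K) :
    J * (10 * (M + N) + 88 * (M * N)) + 55 * N + 22 * (M * N) + 2 ≤ 200 * (J * K ^ 2) := by
  have mul_le_sq : M * N ≤ K ^ 2 := by
    rw [sq]
    exact mul_le_mul hM hN hN₀ (by linarith)
  have le_sq : K ≤ K ^ 2 := le_self_pow₀ hK two_ne_zero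
  have iterations : J * (10 * (M + N) + 88 * (M * N)) ≤ J * (108 * K ^ 2) :=
    mul_le_mul_of_nonneg_left (by linarith) (by linarith)
  have : K ^ 2 ≤ J * K ^ 2 := le_mul_of_one_le_left (sq_nonneg K) hJ
  linarith

namespace Discretisation

variable {bc : BC} {a b c d ω : ℝ} {m n p : ℕ} (P : Discretisation bc a b c d ω m n p)

theorem length_matrices : P.matrices.length = coeffLength (bc.dof m p) (bc.dof n p) := by
  simp only [matrices, List.length_append, length_matList, coeffLength]

theorem isSparseDefinite : IsSparseDefinite (femPattern bc m p) (femPattern bc n p)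
    P.matA P.matB P.matC P.matD where
  conforms_A := P.x.screened_conforms bc ω p
  conforms_neg_B := (neg_neg (P.y.screened bc ω p)).symm ▸ P.y.screened_conforms bc ω p
  conforms_C := P.y.mass_conforms bc p
  conforms_D := P.x.mass_conforms bc p
  posDef_A := P.x.screened_posDef bc P.one_le_m P.omega_ne_zero
  posDef_neg_B :=
    (neg_neg (P.y.screened bc ω p)).symm ▸ P.y.screened_posDef bc P.one_le_n P.omega_ne_zero
  posDef_C := P.y.mass_posDef bc P.one_le_n
  posDef_D := P.x.mass_posDef bc P.one_le_m

theorem dof_x_le_maxDof : bc.dof m p ≤ P.maxDof := le_max_left _ _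

theorem dof_y_le_maxDof : bc.dof n p ≤ P.maxDof := le_max_right _ _

theorem one_le_maxDof : 1 ≤ P.maxDof := P.dof_x_pos.trans_le P.dof_x_le_maxDof

theorem one_le_numElem : 1 ≤ P.numElem := P.one_le_m.trans (le_max_left _ _)

variable {P} {δ ε : ℝ} {S : ADIData (bc.dof m p) (bc.dof n p)}

theorem IsPre.a_pos (hS : P.IsPre δ ε S) (hδ : δ < 1) : 0 < S.a :=
  hS.encl_left.pos P.isSparseDefinite.posDef_A P.isSparseDefinite.posDef_D hδ

theorem IsPre.d_neg (hS : P.IsPre δ ε S) (hδ : δ < 1) : S.d < 0 :=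
  neg_pos.1 (hS.encl_right.neg.pos P.isSparseDefinite.posDef_neg_B P.isSparseDefinite.posDef_C hδ)

theorem IsPre.one_le_J (hS : P.IsPre δ ε S) (hδ : δ < 1) (hε₀ : 0 < ε) (hε₁ : ε < 1) :
    1 ≤ S.J :=
  (one_le_adiCount (hS.a_pos hδ) hS.encl_left.1 hS.encl_right.1 (hS.d_neg hδ) hε₀ hε₁).trans_eq
    hS.count.symm

variable (P)

theorem exists_isPre_preProg (hδ : δ < 1) {s : ℕ} (hs : 0 < s) (hsδ : 1 / (s : ℝ) ≤ δ) (ε : ℝ) :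
    ∃ S : ADIData (bc.dof m p) (bc.dof n p), P.IsPre δ ε S ∧
      (preProg s bc m n p).output (P.preInput ε) = S.toList ∧
      ((preProg s bc m n p).cost (P.preInput ε) : ℝ) ≤
        (406 + 560 * s) * ((P.maxDof : ℝ) ^ 2 + S.J * P.maxDof) := by
  obtain ⟨S, hS, computes⟩ := preFrag_computes P.dof_x_pos P.dof_y_pos P.isSparseDefinite
    hs hsδ hδ (ε := ε) (mem := P.preInput ε)
    ((HoldsCoeffs.of_matList _ _ _ _).mono (List.prefix_append _ _))
    (Holds.append_right (i := 0) rfl P.length_matrices.symm)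
  obtain ⟨output, cost⟩ := computes.toProg (R := (· = S.toList))
    (s := coeffLength (bc.dof m p) (bc.dof n p) + 1)
    (by rw [preInput, List.length_append, P.length_matrices, List.length_singleton])
  refine ⟨S, hS, output, (Nat.cast_le.2 cost).trans ?_⟩
  push_cast
  exact pre_cost_le (Nat.cast_nonneg _) (Nat.cast_nonneg _) (Nat.cast_nonneg _)
    (Nat.cast_nonneg _) (Nat.cast_le.2 P.dof_x_le_maxDof) (Nat.cast_le.2 P.dof_y_le_maxDof)
    (Nat.one_le_cast.2 P.one_le_maxDof)

theorem solveProg_output_and_cost_le (hδ : δ < 1) (hε₀ : 0 < ε) (hε₁ : ε < 1)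
    (hS : P.IsPre δ ε S) (F : Matrix (Fin (bc.dof m p)) (Fin (bc.dof n p)) ℝ) :
    (solveProg bc m n p S.J).output (P.solveInput S F) = matList (P.solution S F) ∧
      ((solveProg bc m n p S.J).cost (P.solveInput S F) : ℝ) ≤
        200 * (S.J * (P.maxDof : ℝ) ^ 2) := by
  have prefix_data : P.matrices ++ S.toList <+: P.solveInput S F := List.prefix_append _ _
  have length_data := congrArg₂ (· + ·) P.length_matrices S.length_toList
  rw [← List.length_append] at length_data
  have computes := solveFrag_computes P.isSparseDefinite hS
    ((HoldsCoeffs.of_matList _ _ _ _).mono ((List.prefix_append _ _).trans prefix_data))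
    (holdsMat_matList _ F length_data.symm)
    fun j => (holdsStep_stepAddr P.matrices S j).mono prefix_data
  rw [P.length_matrices] at computes
  obtain ⟨output, cost⟩ := computes.toProg (R := (· = matList (P.solution S F)))
    (by rw [solveInput, List.length_append, length_data, length_matList])
  refine ⟨output, (Nat.cast_le.2 cost).trans ?_⟩
  push_cast
  exact solve_cost_le (Nat.one_le_cast.2 (hS.one_le_J hδ hε₀ hε₁)) (Nat.cast_nonneg _)
    (Nat.cast_le.2 P.dof_x_le_maxDof) (Nat.cast_le.2 P.dof_y_le_maxDof)
    (Nat.one_le_cast.2 P.one_le_maxDof)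

end Discretisation

/-! ### Complexity on quasi-uniform meshes -/

theorem half_le_log {x : ℝ} (hx : 2 ≤ x) : 1 / 2 ≤ Real.log x := by
  linarith [Real.log_two_gt_d9, Real.log_le_log two_pos hx]

theorem two_le_inv {ε : ℝ} (hε₀ : 0 < ε) (hε₁ : ε ≤ 1 / 2) : 2 ≤ ε⁻¹ := by
  rwa [le_inv_comm₀ two_pos hε₀, inv_eq_one_div]

theorem log_le_of_le_mul_pow {C N g : ℝ} {k : ℕ} (hg : 0 < g) (hle : g ≤ C * N ^ k)
    (hN : 2 ≤ N) : Real.log g ≤ (2 * |Real.log C| + k) * Real.log N := by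
  have hC : 0 < C := pos_of_mul_pos_left (hg.trans_le hle) (by positivity)
  have log_le := Real.log_le_log hg hle
  rw [Real.log_mul hC.ne' (by positivity), Real.log_pow] at log_le
  have log_C := le_abs_self (Real.log C)
  have absorbed := mul_le_mul_of_nonneg_left (half_le_log hN) (abs_nonneg (Real.log C))
  linarith

theorem log_four_div_le {ε : ℝ} (hε₀ : 0 < ε) (hε₁ : ε ≤ 1 / 2) :
    Real.log (4 / ε) ≤ 3 * Real.log ε⁻¹ := by
  have log_two_le := Real.log_le_log two_pos (two_le_inv hε₀ hε₁)
  rw [div_eq_mul_inv, Real.log_mul (by norm_num) (by positivity),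
    (by norm_num : (4 : ℝ) = 2 ^ 2), Real.log_pow, Nat.cast_ofNat]
  linarith

theorem adiCount_le {a b c d ε C N : ℝ} {k : ℕ} (hγ : 1 < adiGamma a b c d)
    (hC : adiGamma a b c d ≤ C * N ^ k) (hN : 2 ≤ N) (hε₀ : 0 < ε) (hε₁ : ε ≤ 1 / 2) :
    (adiCount a b c d ε : ℝ) ≤
      (6 * |Real.log (16 * C)| + 3 * k + 4) * (Real.log N * Real.log ε⁻¹) := by
  have log_N := half_le_log hN
  have log_ε := half_le_log (two_le_inv hε₀ hε₁)
  have γ_le := log_le_of_le_mul_pow (C := 16 * C) (by linarith : 0 < 16 * adiGamma a b c d)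
    (by linarith) hN
  have γ_nonneg : 0 ≤ Real.log (16 * adiGamma a b c d) := Real.log_nonneg (by linarith)
  have ε_nonneg : 0 ≤ Real.log (4 / ε) :=
    Real.log_nonneg ((one_le_div hε₀).2 (by linarith))
  have product_nonneg := mul_nonneg γ_nonneg ε_nonneg
  have product_le := mul_le_mul γ_le (log_four_div_le hε₀ hε₁) ε_nonneg (γ_nonneg.trans γ_le)
  have one_le : 1 ≤ 4 * (Real.log N * Real.log ε⁻¹) := by nlinarith
  have quotient_le := div_le_self product_nonneg
    (one_le_pow₀ (by linarith [Real.pi_gt_three]) : 1 ≤ Real.pi ^ 2)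
  refine (Nat.ceil_lt_add_one (div_nonneg product_nonneg (sq_nonneg _))).le.trans ?_
  linarith

theorem BC.elements_le_dof (bc : BC) {n p : ℕ} (hn : 1 ≤ n) (hp : 1 ≤ p) :
    n ≤ bc.dof n p + 1 ∧ p ≤ bc.dof n p + 1 := by
  obtain ⟨k, rfl⟩ := Nat.exists_eq_add_of_le' hp
  obtain ⟨l, rfl⟩ := Nat.exists_eq_add_of_le' hn
  have : k ≤ (l + 1) * k := Nat.le_mul_of_pos_left k l.succ_pos
  cases bc <;> simp only [dof, numHats, Nat.add_sub_cancel] <;> lia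

theorem IsEnclosure.div_le {S : Set ℝ} {δ a b lo hi : ℝ} (hδ₀ : 0 ≤ δ) (hδ₁ : δ < 1)
    (h : IsEnclosure δ S a b) (hlo : 0 < lo) (hS : S ⊆ Set.Icc lo hi) :
    b / a ≤ (1 + δ) * hi / ((1 - δ) * lo) := by
  obtain ⟨-, -, ⟨s, hs, a_near⟩, ⟨t, ht, b_near⟩⟩ := h
  rw [abs_of_pos (hlo.trans_le (hS hs).1)] at a_near
  rw [abs_of_pos (hlo.trans_le (hS ht).1)] at b_near
  have a_ge : (1 - δ) * lo ≤ a := by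
    linarith [neg_abs_le (a - s), mul_le_mul_of_nonneg_left (hS hs).1 (sub_pos.2 hδ₁).le]
  have b_le : b ≤ (1 + δ) * hi := by
    linarith [le_abs_self (b - t), mul_le_mul_of_nonneg_left (hS ht).2 (by linarith : 0 ≤ 1 + δ)]
  have hi_nonneg : 0 ≤ hi := hlo.le.trans ((hS hs).1.trans (hS hs).2)
  exact div_le_div₀ (by positivity) b_le (mul_pos (sub_pos.2 hδ₁) hlo) a_ge

namespace Discretisation

variable {bc : BC} {a b c d ω : ℝ} {m n p : ℕ}

theorem eigUpper_le (P : Discretisation bc a b c d ω m n p) (hN : 2 ≤ P.maxDof) (ρ : ℝ) :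
    256 * ((p : ℝ) + 1) ^ 8 * (m : ℝ) ^ 2 / (ρ * (b - a)) ^ 2 + ω ^ 2 / 2 ≤
      (262144 / (ρ * (b - a)) ^ 2 + ω ^ 2 / 2) * (P.maxDof : ℝ) ^ 10 := by
  obtain ⟨m_le_dof, p_le_dof⟩ := bc.elements_le_dof P.one_le_m P.one_le_p
  have dof_le := P.dof_x_le_maxDof
  have m_le : (m : ℝ) ≤ 2 * P.maxDof := by exact_mod_cast (by lia : m ≤ 2 * P.maxDof)
  have p_le : (p : ℝ) + 1 ≤ 2 * P.maxDof := by exact_mod_cast (by lia : p + 1 ≤ 2 * P.maxDof)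
  have one_le : (1 : ℝ) ≤ (P.maxDof : ℝ) ^ 10 :=
    one_le_pow₀ (Nat.one_le_cast.2 P.one_le_maxDof)
  calc 256 * ((p : ℝ) + 1) ^ 8 * (m : ℝ) ^ 2 / (ρ * (b - a)) ^ 2 + ω ^ 2 / 2
      ≤ 256 * (2 * (P.maxDof : ℝ)) ^ 8 * (2 * P.maxDof) ^ 2 / (ρ * (b - a)) ^ 2 +
        ω ^ 2 / 2 * (P.maxDof : ℝ) ^ 10 := by
        gcongr
        exact le_mul_of_one_le_right (by positivity) one_le
    _ = _ := by ring

theorem IsPre.adiGamma_le_pow {P : Discretisation bc a b c d ω m n p} {δ ε ρ : ℝ}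
    {S : ADIData (bc.dof m p) (bc.dof n p)} (hS : P.IsPre δ ε S) (hδ₀ : 0 ≤ δ) (hδ₁ : δ < 1)
    (hρ : 0 < ρ) (hx : P.x.QuasiUniform ρ) (hN : 2 ≤ P.maxDof) :
    adiGamma S.a S.b S.c S.d ≤
      (1 + δ) * (262144 / (ρ * (b - a)) ^ 2 + ω ^ 2 / 2) / ((1 - δ) * bc.eigLower a b ω) *
        (P.maxDof : ℝ) ^ 10 := by
  have eigLower_pos := BC.eigLower_pos (P.x.lt P.one_le_m) P.omega_ne_zero
  calc adiGamma S.a S.b S.c S.d ≤ S.b / S.a :=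
        adiGamma_le (hS.a_pos hδ₁) hS.encl_left.1 hS.encl_right.1 (hS.d_neg hδ₁)
    _ ≤ (1 + δ) * (256 * ((p : ℝ) + 1) ^ 8 * (m : ℝ) ^ 2 / (ρ * (b - a)) ^ 2 + ω ^ 2 / 2) /
          ((1 - δ) * bc.eigLower a b ω) :=
        hS.encl_left.div_le hδ₀ hδ₁ eigLower_pos fun _ hμ =>
          P.x.mem_Icc_of_mem_genSpectrum bc P.one_le_m P.one_le_p hρ hx hμ
    _ ≤ (1 + δ) * ((262144 / (ρ * (b - a)) ^ 2 + ω ^ 2 / 2) * (P.maxDof : ℝ) ^ 10) /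
          ((1 - δ) * bc.eigLower a b ω) := by
        have : 0 < 1 - δ := sub_pos.2 hδ₁
        gcongr
        exact P.eigUpper_le hN ρ
    _ = _ := by ring

end Discretisation

theorem exists_J_le (bc : BC) (a b ω : ℝ) {δ ρ : ℝ} (hδ₀ : 0 ≤ δ) (hδ₁ : δ < 1) (hρ : 0 < ρ) :
    ∃ K : ℝ, 0 ≤ K ∧ ∀ (c d : ℝ) (m n p : ℕ) (P : Discretisation bc a b c d ω m n p),
      P.x.QuasiUniform ρ → 2 ≤ P.maxDof → ∀ ε : ℝ, 0 < ε → ε ≤ 1 / 2 →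
      ∀ S : ADIData (bc.dof m p) (bc.dof n p), P.IsPre δ ε S →
        (S.J : ℝ) ≤ K * (Real.log P.maxDof * Real.log ε⁻¹) := by
  refine ⟨6 * |Real.log (16 * ((1 + δ) * (262144 / (ρ * (b - a)) ^ 2 + ω ^ 2 / 2) /
      ((1 - δ) * bc.eigLower a b ω)))| + 3 * (10 : ℕ) + 4, by positivity,
    fun c d m n p P hx hN ε hε₀ hε₁ S hS => ?_⟩
  rw [hS.count]
  exact adiCount_le
    (one_lt_adiGamma (hS.a_pos hδ₁) hS.encl_left.1 hS.encl_right.1 (hS.d_neg hδ₁))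
    (hS.adiGamma_le_pow hδ₀ hδ₁ hρ hx hN) (by exact_mod_cast hN) hε₀ hε₁

theorem costs_le {N l e J J' Q κ : ℝ} (hN : 1 ≤ N) (hl : 1 / 2 ≤ l) (he : 1 / 2 ≤ e)
    (hQ : 0 ≤ Q) (hκ : 200 ≤ κ) (hJ : J ≤ Q * (l * e)) (hJ' : J' ≤ Q * (l * e)) :
    J' ≤ κ * (4 + 2 * Q) * (l * e) ∧
      κ * (N ^ 2 + J * N) ≤ κ * (4 + 2 * Q) * (N ^ 2 + N * l * e) ∧
      κ * (N ^ 2 + J * N) + 200 * (J' * N ^ 2) ≤ κ * (4 + 2 * Q) * (N ^ 2 * l * e) := by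
  have one_le : 1 ≤ 4 * (l * e) := by nlinarith
  have le_sq : N ≤ N ^ 2 := le_self_pow₀ hN two_ne_zero
  refine ⟨hJ'.trans ?_, ?_, ?_⟩
  · gcongr
    nlinarith
  · calc κ * (N ^ 2 + J * N) ≤ κ * (N ^ 2 + Q * (l * e) * N) := by gcongr
      _ ≤ κ * ((4 + 2 * Q) * N ^ 2 + (4 + 2 * Q) * (N * l * e)) := by
        have : 0 ≤ Q * N ^ 2 := by positivity
        have : 0 ≤ N * l * e := by positivity
        have : 0 ≤ Q * (N * l * e) := by positivity
        exact mul_le_mul_of_nonneg_left (by linarith [sq_nonneg N]) (by linarith)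
      _ = _ := by ring
  · calc κ * (N ^ 2 + J * N) + 200 * (J' * N ^ 2)
        ≤ κ * (N ^ 2 * (4 * (l * e)) + Q * (l * e) * N ^ 2) + κ * (Q * (l * e) * N ^ 2) := by
          refine add_le_add ?_ (le_trans ?_ (mul_le_mul_of_nonneg_right hκ (by positivity)))
          · gcongr
            exact le_mul_of_one_le_right (by positivity) one_le
          · gcongr
      _ = _ := by ring

theorem exists_cost_le (bc : BC) (a b ω : ℝ) {δ ρ : ℝ} (hδ₀ : 0 ≤ δ) (hδ₁ : δ < 1) (hρ : 0 < ρ)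
    {s : ℕ} (hs : 0 < s) (hsδ : 1 / (s : ℝ) ≤ δ) :
    ∃ K : ℝ, 0 ≤ K ∧ ∀ (c d : ℝ) (m n p : ℕ) (P : Discretisation bc a b c d ω m n p),
      P.x.QuasiUniform ρ → 2 ≤ P.maxDof → ∀ ε : ℝ, 0 < ε → ε ≤ 1 / 2 →
        ((preProg s bc m n p).cost (P.preInput ε) : ℝ) ≤
          K * ((P.maxDof : ℝ) ^ 2 + P.maxDof * Real.log P.maxDof * Real.log ε⁻¹) ∧
        ∀ S : ADIData (bc.dof m p) (bc.dof n p), P.IsPre δ ε S →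
          (S.J : ℝ) ≤ K * (Real.log P.maxDof * Real.log ε⁻¹) ∧
          ∀ F : Matrix (Fin (bc.dof m p)) (Fin (bc.dof n p)) ℝ,
            ((preProg s bc m n p).cost (P.preInput ε) : ℝ) +
              ((solveProg bc m n p S.J).cost (P.solveInput S F) : ℝ) ≤
              K * ((P.maxDof : ℝ) ^ 2 * Real.log P.maxDof * Real.log ε⁻¹) := by
  obtain ⟨Q, hQ, J_le⟩ := exists_J_le bc a b ω hδ₀ hδ₁ hρ
  have hκ : (200 : ℝ) ≤ 406 + 560 * s := by
    linarith [(Nat.cast_nonneg s : (0 : ℝ) ≤ s)]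
  refine ⟨(406 + 560 * s) * (4 + 2 * Q), by positivity, fun c d m n p P hx hN ε hε₀ hε₁ => ?_⟩
  obtain ⟨S₀, hS₀, -, pre_cost⟩ := P.exists_isPre_preProg hδ₁ hs hsδ ε
  have one_le_N : (1 : ℝ) ≤ P.maxDof := by exact_mod_cast P.one_le_maxDof
  have log_N := half_le_log (x := P.maxDof) (by exact_mod_cast hN)
  have log_ε := half_le_log (two_le_inv hε₀ hε₁)
  have J₀_le := J_le c d m n p P hx hN ε hε₀ hε₁ S₀ hS₀
  refine ⟨pre_cost.trans (costs_le one_le_N log_N log_ε hQ hκ J₀_le J₀_le).2.1, fun S hS => ?_⟩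
  obtain ⟨count_le, -, total_le⟩ := costs_le one_le_N log_N log_ε hQ hκ J₀_le
    (J_le c d m n p P hx hN ε hε₀ hε₁ S hS)
  exact ⟨count_le, fun F => (add_le_add pre_cost
    (P.solveProg_output_and_cost_le hδ₁ hε₀ (by linarith) hS F).2).trans total_le⟩

theorem exists_pos_one_div_le {δ : ℝ} (hδ : 0 < δ) : ∃ s : ℕ, 0 < s ∧ 1 / (s : ℝ) ≤ δ := by
  obtain ⟨k, hk⟩ := exists_nat_one_div_lt hδ
  exact ⟨k + 1, k.succ_pos, by exact_mod_cast hk.le⟩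

end GenADI

end

open GenADI in
theorem mainTheorem6_general (δ : ℝ) (hδ₀ : 0 < δ) (hδ₁ : δ < 1) :
    ∃ (pre : BC → ℕ → ℕ → ℕ → Prog) (solve : BC → ℕ → ℕ → ℕ → ℕ → Prog),
      (∃ K : ℝ, 0 ≤ K ∧ ∀ (bc : BC) (a b c d ω : ℝ) (m n p : ℕ)
        (P : Discretisation bc a b c d ω m n p) (ε : ℝ), 0 < ε → ε < 1 →
        ∃ S : ADIData (bc.dof m p) (bc.dof n p), P.IsPre δ ε S ∧
          (pre bc m n p).output (P.preInput ε) = S.toList ∧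
          ((pre bc m n p).cost (P.preInput ε) : ℝ) ≤
            K * ((P.maxDof : ℝ) ^ 2 + (S.J : ℝ) * (P.maxDof : ℝ))) ∧
      (∃ K : ℝ, ∀ (bc : BC) (a b c d ω : ℝ) (m n p : ℕ)
        (P : Discretisation bc a b c d ω m n p) (ε : ℝ), 0 < ε → ε < 1 →
        ∀ S : ADIData (bc.dof m p) (bc.dof n p), P.IsPre δ ε S →
        ∀ F : Matrix (Fin (bc.dof m p)) (Fin (bc.dof n p)) ℝ,
          (solve bc m n p S.J).output (P.solveInput S F) = matList (P.solution S F) ∧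
          ((solve bc m n p S.J).cost (P.solveInput S F) : ℝ) ≤
            K * ((S.J : ℝ) * (P.maxDof : ℝ) ^ 2)) ∧
      (∀ (bc : BC) (a b ω ρ : ℝ), 0 < ρ →
        ∃ K : ℝ, 0 ≤ K ∧ ∀ (c d : ℝ) (m n p : ℕ) (P : Discretisation bc a b c d ω m n p),
        P.x.QuasiUniform ρ → 2 ≤ P.maxDof → ∀ ε : ℝ, 0 < ε → ε ≤ 1 / 2 →
          ((pre bc m n p).cost (P.preInput ε) : ℝ) ≤
            K * ((P.maxDof : ℝ) ^ 2 +
              (P.maxDof : ℝ) * Real.log (P.maxDof : ℝ) * Real.log ε⁻¹) ∧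
          ∀ S : ADIData (bc.dof m p) (bc.dof n p), P.IsPre δ ε S →
            (S.J : ℝ) ≤ K * (Real.log (P.maxDof : ℝ) * Real.log ε⁻¹) ∧
            ∀ F : Matrix (Fin (bc.dof m p)) (Fin (bc.dof n p)) ℝ,
              ((pre bc m n p).cost (P.preInput ε) : ℝ) +
                ((solve bc m n p S.J).cost (P.solveInput S F) : ℝ) ≤
                K * ((P.maxDof : ℝ) ^ 2 * Real.log (P.maxDof : ℝ) * Real.log ε⁻¹)) := by
  obtain ⟨s, hs, hsδ⟩ := exists_pos_one_div_le hδ₀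
  exact ⟨preProg s, solveProg,
    ⟨406 + 560 * s, by positivity,
      fun _ _ _ _ _ _ _ _ _ P ε _ _ => P.exists_isPre_preProg hδ₁ hs hsδ ε⟩,
    ⟨200, fun _ _ _ _ _ _ _ _ _ P _ hε₀ hε₁ _ hS F =>
      P.solveProg_output_and_cost_le hδ₁ hε₀ hε₁ hS F⟩,
    fun bc a b ω ρ hρ => exists_cost_le bc a b ω hδ₀.le hδ₁ hρ hs hsδ⟩

theorem mainTheorem6 (δ : ℝ) (hδ₀ : 0 < δ) (hδ₁ : δ < 1) :
    ∃ (pre : GenADI.BC → ℕ → ℕ → ℕ → GenADI.Prog)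
      (solve : GenADI.BC → ℕ → ℕ → ℕ → ℕ → GenADI.Prog),
      -- the precomputation costs `O(n N² + J N)`
      (∃ K : ℝ, ∀ (bc : GenADI.BC) (a b c d ω : ℝ) (m n p : ℕ)
        (P : GenADI.Discretisation bc a b c d ω m n p) (ε : ℝ), 0 < ε → ε < 1 →
        ∃ S : GenADI.ADIData (bc.dof m p) (bc.dof n p), P.IsPre δ ε S ∧
          (pre bc m n p).output (P.preInput ε) = S.toList ∧
          ((pre bc m n p).cost (P.preInput ε) : ℝ) ≤
            K * ((P.numElem : ℝ) * (P.maxDof : ℝ) ^ 2 + (S.J : ℝ) * (P.maxDof : ℝ))) ∧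
      -- each solve costs `O(J N²)`
      (∃ K : ℝ, ∀ (bc : GenADI.BC) (a b c d ω : ℝ) (m n p : ℕ)
        (P : GenADI.Discretisation bc a b c d ω m n p) (ε : ℝ), 0 < ε → ε < 1 →
        ∀ S : GenADI.ADIData (bc.dof m p) (bc.dof n p), P.IsPre δ ε S →
        ∀ F : Matrix (Fin (bc.dof m p)) (Fin (bc.dof n p)) ℝ,
          (solve bc m n p S.J).output (P.solveInput S F) = GenADI.matList (P.solution S F) ∧
          ((solve bc m n p S.J).cost (P.solveInput S F) : ℝ) ≤
            K * ((S.J : ℝ) * (P.maxDof : ℝ) ^ 2)) ∧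
      -- on quasi-uniform families `J = O(log N log ε⁻¹)`, and the costs are bounded accordingly
      (∀ (bc : GenADI.BC) (a b c d ω ρ : ℝ), 0 < ρ →
        ∃ K : ℝ, ∀ (m n p : ℕ) (P : GenADI.Discretisation bc a b c d ω m n p),
        P.x.QuasiUniform ρ → P.y.QuasiUniform ρ → 2 ≤ P.maxDof →
        ∀ ε : ℝ, 0 < ε → ε ≤ 1 / 2 →
          ((pre bc m n p).cost (P.preInput ε) : ℝ) ≤
            K * ((P.numElem : ℝ) * (P.maxDof : ℝ) ^ 2 +
              (P.maxDof : ℝ) * Real.log (P.maxDof : ℝ) * Real.log ε⁻¹) ∧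
          ∀ S : GenADI.ADIData (bc.dof m p) (bc.dof n p), P.IsPre δ ε S →
            (S.J : ℝ) ≤ K * (Real.log (P.maxDof : ℝ) * Real.log ε⁻¹) ∧
            ∀ F : Matrix (Fin (bc.dof m p)) (Fin (bc.dof n p)) ℝ,
              ((solve bc m n p S.J).cost (P.solveInput S F) : ℝ) ≤
                K * ((P.maxDof : ℝ) ^ 2 * Real.log (P.maxDof : ℝ) * Real.log ε⁻¹)) ∧
      -- quasi-optimal complexity as `p → ∞` with a bounded number of elements
      (∀ (bc : GenADI.BC) (a b c d ω ρ : ℝ) (n₀ : ℕ), 0 < ρ →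
        ∃ K : ℝ, ∀ (m n p : ℕ) (P : GenADI.Discretisation bc a b c d ω m n p),
        P.x.QuasiUniform ρ → P.y.QuasiUniform ρ → P.numElem ≤ n₀ → 2 ≤ P.maxDof →
        ∀ ε : ℝ, 0 < ε → ε ≤ 1 / 2 →
          ((pre bc m n p).cost (P.preInput ε) : ℝ) ≤
            K * ((P.maxDof : ℝ) ^ 2 +
              (P.maxDof : ℝ) * Real.log (P.maxDof : ℝ) * Real.log ε⁻¹) ∧
          ∀ S : GenADI.ADIData (bc.dof m p) (bc.dof n p), P.IsPre δ ε S →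
            ∀ F : Matrix (Fin (bc.dof m p)) (Fin (bc.dof n p)) ℝ,
              ((pre bc m n p).cost (P.preInput ε) : ℝ) +
                ((solve bc m n p S.J).cost (P.solveInput S F) : ℝ) ≤
                K * ((P.maxDof : ℝ) ^ 2 * Real.log (P.maxDof : ℝ) * Real.log ε⁻¹)) := by
  obtain ⟨pre, solve, ⟨K, hK, pre_spec⟩, solve_spec, quasiUniform⟩ :=
    mainTheorem6_general δ hδ₀ hδ₁
  have sq_le {bc a b c d ω m n p} (P : GenADI.Discretisation bc a b c d ω m n p) :
      (P.maxDof : ℝ) ^ 2 ≤ P.numElem * (P.maxDof : ℝ) ^ 2 :=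
    le_mul_of_one_le_left (sq_nonneg _) (Nat.one_le_cast.2 P.one_le_numElem)
  refine ⟨pre, solve, ⟨K, fun bc a b c d ω m n p P ε hε₀ hε₁ => ?_⟩, solve_spec,
    fun bc a b c d ω ρ hρ => ?_, fun bc a b c d ω ρ n₀ hρ => ?_⟩
  · obtain ⟨S, hS, output_eq, pre_le⟩ := pre_spec bc a b c d ω m n p P ε hε₀ hε₁
    exact ⟨S, hS, output_eq, pre_le.trans (by gcongr; exact sq_le P)⟩
  · obtain ⟨K, hK, cost_le⟩ := quasiUniform bc a b ω ρ hρ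
    refine ⟨K, fun m n p P hx _ hN ε hε₀ hε₁ => ?_⟩
    obtain ⟨pre_le, total_le⟩ := cost_le c d m n p P hx hN ε hε₀ hε₁
    exact ⟨pre_le.trans (by gcongr; exact sq_le P), fun S hS => ⟨(total_le S hS).1, fun F =>
      (le_add_of_nonneg_left (Nat.cast_nonneg _)).trans ((total_le S hS).2 F)⟩⟩
  · obtain ⟨K, -, cost_le⟩ := quasiUniform bc a b ω ρ hρ
    refine ⟨K, fun m n p P hx _ _ hN ε hε₀ hε₁ => ?_⟩
    obtain ⟨pre_le, total_le⟩ := cost_le c d m n p P hx hN ε hε₀ hε₁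
    exact ⟨pre_le, fun S hS => (total_le S hS).2⟩
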